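/- **Setting.** Let $p$ be a prime, $n\ge 1$, $G_{\mathbb Q}=\mathrm{Gal}(\overline{\mathbb Q}/\mathbb Q)$, and let $\rho:G_{\mathbb Q}\to \mathrm{GL}_n(\overline{\mathbb F}_p)$ be a continuous semisimple representation. Fix a decomposition group $G_p$ at a prime above $p$, with inertia group $I_p$, and a complex conjugation $\mathfrak c\in G_{\mathbb Q}$; Frobenius elements are arithmetic, and $\omega$ is the mod $p$ cyclotomic character. *Level and nebentype.* The level of $\rho$ is $N=\prod_{q\ne p}q^{n_q}$ with $n_q=\sum_{i\ge0}\frac{|\rho(G_{q,i})|}{|\rho(G_{q,0})|}\dim M/M^{G_{q,i}}$, where $M=\overline{\mathbb F}_p^n$ and $G_{q,i}$ are the lower ramification groups at $q$ of the field cut out by $\rho$. The nebentype is the Dirichlet character $\epsilon:(\mathbb Z/N)^\times\to\overline{\mathbb F}_p^\times$ such that $\det\rho=\omega^k\epsilon$ for some $k\in\mathbb Z$, with $\epsilon$ viewed as a character of $G_{\mathbb Q}$ by $\mathrm{Frob}_\ell\mapsto\epsilon(\ell)$. *Weights.* For a $p$-restricted $n$-tuple $(b_1,\dots,b_n)$,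 i.e. $0\le b_i-b_{i+1}\le p-1$ for $i<n$ and $0\le b_n<p-1$, let $F(b_1,\dots,b_n)$ be the simple submodule of the dual Weyl module of $\mathrm{GL}_n(\overline{\mathbb F}_p)$ of highest weight $(b_1,\dots,b_n)$, restricted to $\mathrm{GL}_n(\mathbb F_p)$. For arbitrary integers, $F(a_1,\dots,a_n)'$ denotes any $F(b_1,\dots,b_n)$ with $(b_i)$ $p$-restricted and $a_i\equiv b_i \pmod{p-1}$. *Derived tuples.* For a simple $G_p$-module of dimension $d$, $I_p$ acts diagonally by the characters $\psi^{m},\psi^{mp},\dots,\psi^{mp^{d-1}}$ in some order, for a fundamental character $\psi$ of niveau $d$ and some $m\in\mathbb Z$; if $m=\sum_{i=1}^{d}a_ip^{i-1}$ with $0\le a_i-a_d\le p-1$ for all $i$, the decreasing rearrangement of $(a_1,\dots,a_d)$ is a derived tuple. For a general $G_p$-module take a composition series, an adapted basis $(e_j)$ on whose images in the composition factors $I_p$ acts diagonally, and the concatenation $(a_j)$ of tuples derived from the factors; then $(a_{\sigma(j)})_j$ is derived for every permutation $\sigma$ that keeps the relative order of the entries coming from each factor and for which $I_p$ remains upper triangular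 in the ordered basis $(e_{\sigma(j)})$. A standard Levi subgroup $L$ is the common stabilizer of the coordinate subspaces $D_c$ attached to the classes $c$ of a partition of $\{1,\dots,n\}$; it is $\rho$-minimal if it is minimal among those containing a conjugate of $\rho(G_{\mathbb Q})$. If $\rho$ takes values in a $\rho$-minimal $L$, an $n$-tuple is derived from $\rho$ with Levi subgroup $L$ if, for each $c$, its entries in the positions of $c$ form a tuple derived from the $G_p$-module $D_c$. An $n$-tuple is derived from $\rho$ if it is derived from some conjugate of $\rho$ with some such $L$. *Predicted weights.* A weight predicted for $\rho$ is a module $V=F(a_1-(n-1),a_2-(n-2),\dots,a_n)'$, where, for some conjugate $\rho'$ of $\rho$ with values in a $\rho$-minimal standard Levi subgroup $L$, $\rho'(\mathfrak c)$ is conjugate inside $L$ to $\pm\mathrm{diag}(1,-1,1,\dots)$ and $(a_1,\dots,a_n)$ is derived from $\rho'$ with Levi subgroup $L$. *Attached eigenclasses.* Let $\Gamma_0(N)\subset \mathrm{SL}_n(\mathbb Z)$ be the subgroup of matrices with first row $\equiv(*,0,\dots,0)$ mod $N$. For a $\mathrm{GL}_n(\mathbb F_p)$-module $V$, let $V(\epsilon)$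 be $V$ with integral matrices $A$ with first row $\equiv(*,0,\dots,0)$ mod $N$ and positive determinant prime to $pN$ acting through reduction mod $p$, multiplied by $\epsilon(A_{11})$. For primes $\ell\nmid pN$ and $0\le k\le n$ let $T(\ell,k)$ be the Hecke operator on $H^i(\Gamma_0(N),V(\epsilon))$ of the double coset of $\mathrm{diag}(1,\dots,1,\ell,\dots,\ell)$ ($k$ entries $\ell$). A nonzero class $\alpha$ with $T(\ell,k)\alpha=a(\ell,k)\alpha$ for all these $\ell,k$ is an eigenclass, and $\rho$ is attached to $\alpha$ if $\rho$ is unramified outside $pN$ and $\sum_{k=0}^n(-1)^k\ell^{k(k-1)/2}a(\ell,k)X^k=\det(1-\rho(\mathrm{Frob}_\ell)X)$ for all primes $\ell\nmid pN$. **Theorem.** Let $N$, $\epsilon$, $V$ be the level, the nebentype and a weight predicted for $\rho$, let $i\ge0$, and suppose that $\rho$ is attached to an eigenclass in $H^i(\Gamma_0(N),V(\epsilon))$. Put $\rho^\vee={}^t\rho^{-1}$ and $W=V^*\otimes\det^{-(n-1)}$. Then $\rho^\vee$ is attached to an eigenclass in $H^i(\Gamma_0(N),W(\epsilon^{-1}))$,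 and $N$, $\epsilon^{-1}$, $W$ are the level, the nebentype and a weight predicted for $\rho^\vee$. Moreover, if $(b_1,\dots,b_n)$ is an $n$-tuple derived from $\rho$, then $(-b_n,\dots,-b_1)$ is an $n$-tuple derived from $\rho^\vee$. -/

import Mathlib

open scoped NumberField Polynomial Pointwise Topology Matrix MatrixGroups

noncomputable section

namespace GaloisHecke

/-- An algebraic closure of `ℚ`. -/
abbrev Qbar : Type := AlgebraicClosure ℚ

/-- The absolute Galois group of `ℚ`. -/
abbrev GQ : Type := Gal(Qbar/ℚ)

/-- An algebraic closure of the field with `p` elements. -/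
abbrev Fpbar (p : ℕ) [Fact p.Prime] : Type := AlgebraicClosure (ZMod p)

/-! ### Galois representations -/

section Galois

variable {p : ℕ} [Fact p.Prime] {n : ℕ}

/-- The linear representation on column vectors attached to `ρ : G_ℚ → GL_n(F̄_p)`. -/
def galRep (ρ : GQ →* GL (Fin n) (Fpbar p)) :
    Representation (Fpbar p) GQ (Fin n → Fpbar p) :=
  (Matrix.toLinAlgEquiv' (R := Fpbar p) (n := Fin n)).toMonoidHom.comp
    ((Units.coeHom (Matrix (Fin n) (Fin n) (Fpbar p))).comp ρ)

/-- The automorphism `A ↦ ᵗA⁻¹` of `GL_n`. -/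
def transposeInv (R : Type*) [CommRing R] : GL (Fin n) R →* GL (Fin n) R where
  toFun A := ⟨(A⁻¹).valᵀ, A.valᵀ,
    by rw [← Matrix.transpose_mul, Units.mul_inv, Matrix.transpose_one],
    by rw [← Matrix.transpose_mul, Units.inv_mul, Matrix.transpose_one]⟩
  map_one' := by
    apply Units.ext
    simp only [inv_one, Units.val_one, Matrix.transpose_one]
  map_mul' A B := by
    apply Units.ext
    simp only [mul_inv_rev, Units.val_mul, Matrix.transpose_mul]

/-- The contragredient `ρ^∨ = ᵗρ⁻¹`. -/
def contragredient (ρ : GQ →* GL (Fin n) (Fpbar p)) : GQ →* GL (Fin n) (Fpbar p) :=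
  (transposeInv (Fpbar p)).comp ρ

/-- The conjugate representation `g ↦ M ρ(g) M⁻¹`. -/
def conjBy (M : GL (Fin n) (Fpbar p)) (ρ : GQ →* GL (Fin n) (Fpbar p)) :
    GQ →* GL (Fin n) (Fpbar p) :=
  (MulAut.conj M).toMonoidHom.comp ρ

/-- `c ∈ G_ℚ` is a complex conjugation: it is induced by complex conjugation through some
embedding of `Q̄` in `ℂ`. -/
def IsComplexConj (c : GQ) : Prop :=
  ∃ φ : Qbar →+* ℂ, NumberField.ComplexEmbedding.IsConj φ c

/-- `𝔩` is a prime ideal of the ring of all algebraic integers above the rational prime `ℓ`.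
Its decomposition group in `G_ℚ` is `MulAction.stabilizer GQ 𝔩`, its inertia group is
`𝔩.inertia GQ`. -/
structure IsAbove (𝔩 : Ideal (𝓞 Qbar)) (ℓ : ℕ) : Prop where
  isPrime : 𝔩.IsPrime
  mem : (ℓ : 𝓞 Qbar) ∈ 𝔩

/-- `ρ` is unramified at the rational prime `ℓ`. -/
def IsUnramifiedAt (ρ : GQ →* GL (Fin n) (Fpbar p)) (ℓ : ℕ) : Prop :=
  ∀ 𝔩 : Ideal (𝓞 Qbar), IsAbove 𝔩 ℓ → ∀ g ∈ 𝔩.inertia GQ, ρ g = 1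

/-! ### Level -/

/-- The field cut out by `ρ`. -/
abbrev splittingField (ρ : GQ →* GL (Fin n) (Fpbar p)) : IntermediateField ℚ Qbar :=
  IntermediateField.fixedField ρ.ker

/-- The elements of `G_ℚ` that restrict, on the field `K` cut out by `ρ`, to the `i`-th ramification
group (lower numbering) `{τ ∈ Gal(K/ℚ) : τ x ≡ x mod 𝔮^(i+1) for all x ∈ 𝓞_K}` of a prime `𝔮`. -/
def ramificationSet (ρ : GQ →* GL (Fin n) (Fpbar p)) (𝔮 : Ideal (𝓞 (splittingField ρ))) (i : ℕ) :
    Set GQ :=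
  {g | ∃ τ ∈ (𝔮 ^ (i + 1)).inertia Gal(splittingField ρ/ℚ),
    ∀ x : splittingField ρ, g (x : Qbar) = (τ x : Qbar)}

/-- The vectors fixed by all elements of a subset of `G_ℚ`. -/
def fixedBy (ρ : GQ →* GL (Fin n) (Fpbar p)) (S : Set GQ) :
    Submodule (Fpbar p) (Fin n → Fpbar p) :=
  ⨅ g ∈ S, LinearMap.ker (galRep ρ g - 1)

/-- The exponent `∑_i (g_i / g_0) dim (M / M^{G_i})` of the conductor, computed at `𝔮`. -/
def conductorExponent (ρ : GQ →* GL (Fin n) (Fpbar p)) (𝔮 : Ideal (𝓞 (splittingField ρ))) : ℚ :=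
  ∑ᶠ i : ℕ, (Nat.card (ρ '' ramificationSet ρ 𝔮 i) : ℚ) / Nat.card (ρ '' ramificationSet ρ 𝔮 0) *
    Module.finrank (Fpbar p) ((Fin n → Fpbar p) ⧸ fixedBy ρ (ramificationSet ρ 𝔮 i))

/-- `N` is the level of `ρ`: the prime-to-`p` part of its Artin conductor. -/
structure IsLevel (ρ : GQ →* GL (Fin n) (Fpbar p)) (N : ℕ) : Prop where
  ne_zero : N ≠ 0
  not_dvd : ¬ p ∣ N
  exponent : ∀ q : ℕ, q.Prime → q ≠ p → ∀ 𝔮 : Ideal (𝓞 (splittingField ρ)), 𝔮.IsPrime →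
    (q : 𝓞 (splittingField ρ)) ∈ 𝔮 → (N.factorization q : ℚ) = conductorExponent ρ 𝔮

/-! ### Nebentype -/

/-- The cyclotomic character `G_ℚ → (ℤ/m)ˣ`. -/
def cyclo (m : ℕ) [NeZero m] : GQ →* (ZMod m)ˣ :=
  (modularCyclotomicCharacter Qbar (n := m)
    (HasEnoughRootsOfUnity.natCard_rootsOfUnity Qbar m)).comp
    (MulSemiringAction.toRingAut GQ Qbar)

/-- The cyclotomic character `ω` modulo `p`, with values in `F̄_p`. -/
def omega (p : ℕ) [Fact p.Prime] : GQ →* (Fpbar p)ˣ :=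
  (Units.map (algebraMap (ZMod p) (Fpbar p)).toMonoidHom).comp (cyclo p)

/-- `ε` is the nebentype of `ρ` at level `N`: `det ρ = ω^k ε`, where the Dirichlet character `ε`
is viewed as a character of `G_ℚ` (sending Frobenius elements at `ℓ` to `ε(ℓ)`). For `N` prime to
`p` this factor is unramified at `p`. -/
def IsNebentype (ρ : GQ →* GL (Fin n) (Fpbar p)) (N : ℕ) [NeZero N]
    (ε : DirichletCharacter (Fpbar p) N) : Prop :=
  ∃ k : ℤ, ∀ g : GQ, (ρ g).val.det = ((omega p g ^ k : (Fpbar p)ˣ) : Fpbar p) * ε (cyclo N g)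

/-! ### Levi subgroups and the strict parity condition -/

/-- The span `D_c` of the standard basis vectors indexed by the class `c` of a set partition. -/
def leviBlock (s : Setoid (Fin n)) (c : Quotient s) : Submodule (Fpbar p) (Fin n → Fpbar p) :=
  Submodule.span _ ((fun j => Pi.single j 1) '' {j | Quotient.mk s j = c})

/-- The standard Levi subgroup attached to a set partition of `{1, …, n}`: the simultaneous
stabilizer of the subspaces `D_c`. -/
def standardLevi (s : Setoid (Fin n)) : Subgroup (GL (Fin n) (Fpbar p)) where
  carrier := {g | ∀ c : Quotient s,
    (leviBlock (p := p) s c).map (Matrix.toLin' g.val) = leviBlock s c}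
  one_mem' c := by simp
  mul_mem' {g h} hg hh c := by
    rw [Units.val_mul, Matrix.toLin'_mul, Submodule.map_comp, hh c, hg c]
  inv_mem' {g} hg c := by
    conv_lhs => rw [← hg c]
    rw [← Submodule.map_comp, ← Matrix.toLin'_mul, Units.inv_mul, Matrix.toLin'_one,
      Submodule.map_id]

/-- `L` is a `ρ`-minimal standard Levi subgroup: minimal among the standard Levi subgroups that
contain some conjugate of the image of `ρ`. -/
def IsMinimalLevi (ρ : GQ →* GL (Fin n) (Fpbar p)) (L : Subgroup (GL (Fin n) (Fpbar p))) : Prop :=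
  Minimal (fun L' => (∃ s : Setoid (Fin n), L' = standardLevi s) ∧
    ∃ M : GL (Fin n) (Fpbar p), ∀ g, conjBy M ρ g ∈ L') L

/-- The strict parity condition with the standard Levi subgroup `L` attached to `s`, for the
complex conjugation `c`. -/
structure StrictParity (c : GQ) (ρ : GQ →* GL (Fin n) (Fpbar p)) (s : Setoid (Fin n)) : Prop where
  mem_levi : ∀ g, ρ g ∈ standardLevi s
  minimal : IsMinimalLevi ρ (standardLevi s)
  conj : ∃ M ∈ standardLevi (p := p) s, ∃ u : ℤˣ,
    (M * ρ c * M⁻¹).val = (u : ℤ) • Matrix.diagonal fun i : Fin n => (-1 : Fpbar p) ^ (i : ℕ)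

/-! ### Derived tuples -/

/-- `ψ` is a fundamental character of niveau `d` of the inertia group at `𝔓`:
`g ↦ g(π)/π mod 𝔓` for some `π` with `π^(p^d - 1) = p`, followed by an embedding of the residue
field in `F̄_p`. -/
def IsFundamentalChar (𝔓 : Ideal (𝓞 Qbar)) (d : ℕ) (ψ : 𝔓.inertia GQ →* (Fpbar p)ˣ) : Prop :=
  ∃ (ι : 𝓞 Qbar ⧸ 𝔓 →+* Fpbar p) (π : Qbar), π ^ (p ^ d - 1) = (p : Qbar) ∧
    ∀ g : 𝔓.inertia GQ, ∃ u : 𝓞 Qbar,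
      (g : GQ) π = (u : Qbar) * π ∧ ι (Ideal.Quotient.mk 𝔓 u) = (ψ g : Fpbar p)

/-- The decreasing tuple `a` is derived from a simple module whose restriction to inertia is
diagonal with characters `φ`: with `d` the number of characters, the `φ_j` are a permutation of
the `ψ^(m p^i)`, `0 ≤ i < d`, for a fundamental character `ψ` of niveau `d`, and
`m = ∑ c_i p^i` with `0 ≤ c_i - c_{d-1} ≤ p - 1`, and `a` is the decreasing rearrangement of `c`. -/
def IsDerivedSimple (𝔓 : Ideal (𝓞 Qbar)) {B : Type} [Finite B] [LinearOrder B]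
    (φ : B → (𝔓.inertia GQ →* (Fpbar p)ˣ)) (a : B → ℤ) : Prop :=
  ∃ (ψ : 𝔓.inertia GQ →* (Fpbar p)ˣ) (m : ℤ) (c : Fin (Nat.card B) → ℤ)
    (τ τ' : B ≃ Fin (Nat.card B)),
    IsFundamentalChar 𝔓 (Nat.card B) ψ ∧
    (∀ j, φ j = ψ ^ (m * (p : ℤ) ^ (τ j : ℕ))) ∧
    m = ∑ i, c i * (p : ℤ) ^ (i : ℕ) ∧
    (∀ i l : Fin (Nat.card B), (l : ℕ) + 1 = Nat.card B → 0 ≤ c i - c l ∧ c i - c l ≤ (p : ℤ) - 1) ∧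
    (∀ j, a j = c (τ' j)) ∧
    Antitone a

/-- The step `V_r` of the filtration spanned by the first `r` blocks of a basis `e`. -/
def filtrationStep {J : Type} {k : ℕ} (e : J → Fin n → Fpbar p) (blk : J → Fin k) (r : ℕ) :
    Submodule (Fpbar p) (Fin n → Fpbar p) :=
  Submodule.span _ (e '' {j | (blk j : ℕ) < r})

/-- `X` is stable under the decomposition group at `𝔓`. -/
def IsStable (𝔓 : Ideal (𝓞 Qbar)) (ρ : GQ →* GL (Fin n) (Fpbar p))
    (X : Submodule (Fpbar p) (Fin n → Fpbar p)) : Prop :=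
  ∀ g ∈ MulAction.stabilizer GQ 𝔓, X.map (galRep ρ g) ≤ X

/-- `e`, cut into consecutive blocks by `blk`, is a basis of `U` adapted to a composition series
`0 = V_0 ⊂ V_1 ⊂ … ⊂ V_k = U` of `U` as a module over the decomposition group at `𝔓`, and inertia
acts on the image of `e` in the composition factors diagonally, through the characters `φ`. -/
structure IsAdaptedBasis (𝔓 : Ideal (𝓞 Qbar)) (ρ : GQ →* GL (Fin n) (Fpbar p))
    (U : Submodule (Fpbar p) (Fin n → Fpbar p)) {J : Type} [LinearOrder J] {k : ℕ}
    (e : J → Fin n → Fpbar p) (blk : J → Fin k) (φ : J → (𝔓.inertia GQ →* (Fpbar p)ˣ)) : Prop where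
  monotone : Monotone blk
  surjective : Function.Surjective blk
  linearIndependent : LinearIndependent (Fpbar p) e
  span_eq : Submodule.span _ (Set.range e) = U
  stable : ∀ r ≤ k, IsStable 𝔓 ρ (filtrationStep e blk r)
  simple : ∀ r < k, ∀ X : Submodule (Fpbar p) (Fin n → Fpbar p), IsStable 𝔓 ρ X →
    filtrationStep e blk r ≤ X → X ≤ filtrationStep e blk (r + 1) →
    X = filtrationStep e blk r ∨ X = filtrationStep e blk (r + 1)
  diagonal : ∀ (g : 𝔓.inertia GQ) (j : J),
    galRep ρ g (e j) - (φ j g : Fpbar p) • e j ∈ filtrationStep e blk (blk j)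

/-- The tuple `t` is derived from `U`, viewed as a module over the decomposition group at `𝔓`:
concatenate tuples `a` derived from the composition factors, then apply a permutation `σ` that
keeps the order of the entries coming from each composition factor and for which the action of
inertia remains upper triangular with respect to the reordered basis. -/
def IsDerivedLocal (𝔓 : Ideal (𝓞 Qbar)) (ρ : GQ →* GL (Fin n) (Fpbar p))
    (U : Submodule (Fpbar p) (Fin n → Fpbar p)) {J : Type} [Finite J] [LinearOrder J]
    (t : J → ℤ) : Prop :=
  ∃ (k : ℕ) (e : J → Fin n → Fpbar p) (blk : J → Fin k)
    (φ : J → (𝔓.inertia GQ →* (Fpbar p)ˣ)) (a : J → ℤ) (σ : Equiv.Perm J),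
    IsAdaptedBasis 𝔓 ρ U e blk φ ∧
    (∀ r : Fin k, IsDerivedSimple 𝔓 (fun j : {j // blk j = r} => φ j) (fun j => a j)) ∧
    (∀ i j, i < j → blk i = blk j → σ.symm i < σ.symm j) ∧
    (∀ (g : 𝔓.inertia GQ) (j : J),
      galRep ρ g (e (σ j)) ∈ Submodule.span (Fpbar p) ((fun i => e (σ i)) '' {i | i ≤ j})) ∧
    t = fun j => a (σ j)

/-- The `n`-tuple `b` is derived from `ρ`, whose image lies in the standard Levi subgroup attached
to `s`: on each block `D_c`, the entries of `b` in the positions of `c`, in increasing order of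
positions, form a tuple derived from `D_c`. -/
def IsDerivedWithLevi (𝔓 : Ideal (𝓞 Qbar)) (ρ : GQ →* GL (Fin n) (Fpbar p)) (s : Setoid (Fin n))
    (b : Fin n → ℤ) : Prop :=
  ∀ c : Quotient s,
    IsDerivedLocal 𝔓 ρ (leviBlock s c) (fun j : {j : Fin n // Quotient.mk s j = c} => b j)

/-- `b` is an `n`-tuple derived from `ρ`, after conjugating `ρ` into a `ρ`-minimal standard Levi
subgroup. -/
def IsDerived (𝔓 : Ideal (𝓞 Qbar)) (ρ : GQ →* GL (Fin n) (Fpbar p)) (b : Fin n → ℤ) : Prop :=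
  ∃ (M : GL (Fin n) (Fpbar p)) (s : Setoid (Fin n)),
    (∀ g, conjBy M ρ g ∈ standardLevi s) ∧ IsMinimalLevi ρ (standardLevi s) ∧
    IsDerivedWithLevi 𝔓 (conjBy M ρ) s b

end Galois

/-! ### Irreducible modules of `GL_n(F_p)` and predicted weights -/

section Weights

variable {p : ℕ} [Fact p.Prime] {n : ℕ}

/-- The algebra of regular functions on `GL_n(F̄_p)`. -/
def regularFunctions (p : ℕ) [Fact p.Prime] (n : ℕ) :
    Subalgebra (Fpbar p) (GL (Fin n) (Fpbar p) → Fpbar p) :=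
  Algebra.adjoin (Fpbar p)
    (Set.range (fun (ij : Fin n × Fin n) (x : GL (Fin n) (Fpbar p)) => x.val ij.1 ij.2) ∪
      {fun x => (x.val.det)⁻¹})

/-- The dual Weyl module `W(b)`: the regular functions `f` on `GL_n` with
`f(β x) = β_{11}^{b_1} ⋯ β_{nn}^{b_n} f(x)` for `β` lower triangular; `GL_n` acts by right
translation, and the highest weight for the upper triangular Borel subgroup is `b`. -/
def dualWeyl (b : Fin n → ℤ) : Submodule (Fpbar p) (GL (Fin n) (Fpbar p) → Fpbar p) where
  carrier := {f | f ∈ regularFunctions p n ∧ ∀ β x : GL (Fin n) (Fpbar p),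
    (∀ i j, i < j → β.val i j = 0) → f (β * x) = (∏ i, β.val i i ^ b i) * f x}
  zero_mem' := ⟨zero_mem _, by simp⟩
  add_mem' {f g} hf hg := ⟨add_mem hf.1 hg.1, fun β x h => by
    simp [hf.2 β x h, hg.2 β x h, mul_add]⟩
  smul_mem' r f hf := ⟨Subalgebra.smul_mem _ hf.1 r, fun β x h => by
    simp [hf.2 β x h, mul_left_comm]⟩

/-- A space of functions on `GL_n(F̄_p)` is stable under right translations. -/
def IsTranslationStable (S : Submodule (Fpbar p) (GL (Fin n) (Fpbar p) → Fpbar p)) : Prop :=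
  ∀ f ∈ S, ∀ g : GL (Fin n) (Fpbar p), (fun x => f (x * g)) ∈ S

/-- The inclusion `GL_n(F_p) → GL_n(F̄_p)`. -/
def glMap (p : ℕ) [Fact p.Prime] (n : ℕ) : GL (Fin n) (ZMod p) →* GL (Fin n) (Fpbar p) :=
  Matrix.GeneralLinearGroup.map (algebraMap (ZMod p) (Fpbar p))

/-- The representation `σ` of `GL_n(F_p)` is isomorphic to `F(b)`, the simple submodule of the dual
Weyl module `W(b)` over `GL_n(F̄_p)`, restricted to `GL_n(F_p)`. -/
def IsModuleF (b : Fin n → ℤ) {V : Type} [AddCommGroup V] [Module (Fpbar p) V]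
    (σ : Representation (Fpbar p) (GL (Fin n) (ZMod p)) V) : Prop :=
  ∃ S : Submodule (Fpbar p) (GL (Fin n) (Fpbar p) → Fpbar p),
    S ≤ dualWeyl b ∧ S ≠ ⊥ ∧ IsTranslationStable S ∧
    (∀ S' ≤ S, IsTranslationStable S' → S' = ⊥ ∨ S' = S) ∧
    ∃ e : V ≃ₗ[Fpbar p] S, ∀ (g : GL (Fin n) (ZMod p)) (v : V) (x : GL (Fin n) (Fpbar p)),
      (e (σ g v)).val x = (e v).val (x * glMap p n g)

/-- `p`-restricted tuples. -/
structure IsRestricted (p : ℕ) (b : Fin n → ℤ) : Prop where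
  step : ∀ i j : Fin n, (i : ℕ) + 1 = j → 0 ≤ b i - b j ∧ b i - b j ≤ (p : ℤ) - 1
  last : ∀ i : Fin n, (i : ℕ) + 1 = n → 0 ≤ b i ∧ b i < (p : ℤ) - 1

/-- `σ` is (one of the possible meanings of) `F(a_1, …, a_n)'`: it is isomorphic to `F(b)` for a
`p`-restricted `b` congruent to `a` modulo `p - 1`. -/
def IsModuleFPrime (a : Fin n → ℤ) {V : Type} [AddCommGroup V] [Module (Fpbar p) V]
    (σ : Representation (Fpbar p) (GL (Fin n) (ZMod p)) V) : Prop :=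
  ∃ b : Fin n → ℤ, IsRestricted p b ∧ (∀ i, a i ≡ b i [ZMOD (p : ℤ) - 1]) ∧ IsModuleF b σ

/-- `σ` is a weight predicted for `ρ`: some conjugate of `ρ` satisfies the strict parity condition
with a standard Levi subgroup `L`, and `σ` is `F(a_1 - (n-1), a_2 - (n-2), …, a_n)'` for an
`n`-tuple `a` derived from that conjugate with Levi subgroup `L`. -/
def IsPredictedWeight (𝔓 : Ideal (𝓞 Qbar)) (c : GQ) (ρ : GQ →* GL (Fin n) (Fpbar p))
    {V : Type} [AddCommGroup V] [Module (Fpbar p) V]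
    (σ : Representation (Fpbar p) (GL (Fin n) (ZMod p)) V) : Prop :=
  ∃ (M : GL (Fin n) (Fpbar p)) (s : Setoid (Fin n)) (a : Fin n → ℤ),
    StrictParity c (conjBy M ρ) s ∧ IsDerivedWithLevi 𝔓 (conjBy M ρ) s a ∧
    IsModuleFPrime (fun i => a i - ((n : ℤ) - 1 - (i : ℕ))) σ

/-- `ρ` is a continuous semisimple Galois representation, and `N`, `ε`, `σ` are the level, the
nebentype and a weight predicted for `ρ`. -/
structure IsPredicted (𝔓 : Ideal (𝓞 Qbar)) (c : GQ) (ρ : GQ →* GL (Fin n) (Fpbar p))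
    (N : ℕ) [NeZero N] (ε : DirichletCharacter (Fpbar p) N)
    {V : Type} [AddCommGroup V] [Module (Fpbar p) V]
    (σ : Representation (Fpbar p) (GL (Fin n) (ZMod p)) V) : Prop where
  continuous : Continuous[krullTopology ℚ Qbar, ⊥] ρ
  semisimple : (galRep ρ).IsSemisimpleRepresentation
  level : IsLevel ρ N
  nebentype : IsNebentype ρ N ε
  weight : IsPredictedWeight 𝔓 c ρ σ

/-- The twist of a representation by a character. -/
def twist {G k V : Type} [Monoid G] [Field k] [AddCommGroup V] [Module k V]
    (χ : G →* kˣ) (σ : Representation k G V) : Representation k G V where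
  toFun g := (χ g : k) • σ g
  map_one' := by simp
  map_mul' g h := by
    rw [map_mul, map_mul, Units.val_mul, smul_mul_smul_comm]

/-- The character `det` of `GL_n(F_p)`, with values in `F̄_p`. -/
def detChar (p : ℕ) [Fact p.Prime] (n : ℕ) : GL (Fin n) (ZMod p) →* (Fpbar p)ˣ :=
  (Units.map (algebraMap (ZMod p) (Fpbar p)).toMonoidHom).comp Matrix.GeneralLinearGroup.det

/-- `V* ⊗ det^{-(n-1)}`. -/
def dualWeight {V : Type} [AddCommGroup V] [Module (Fpbar p) V]
    (σ : Representation (Fpbar p) (GL (Fin n) (ZMod p)) V) :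
    Representation (Fpbar p) (GL (Fin n) (ZMod p)) (Module.Dual (Fpbar p) V) :=
  twist (detChar p n ^ (-((n : ℤ) - 1))) σ.dual

end Weights

/-! ### Cohomology and Hecke operators -/

section Hecke

variable {n : ℕ} [NeZero n]

/-- The first row of `A` is congruent to `(*, 0, …, 0)` modulo `N`. -/
def FirstRow (N : ℕ) (A : Matrix (Fin n) (Fin n) ℤ) : Prop :=
  ∀ j, j ≠ 0 → (N : ℤ) ∣ A 0 j

theorem FirstRow.mul_entry {N : ℕ} {A : Matrix (Fin n) (Fin n) ℤ} (hA : FirstRow N A)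
    (B : Matrix (Fin n) (Fin n) ℤ) (j : Fin n) : (N : ℤ) ∣ (A * B) 0 j - A 0 0 * B 0 j := by
  rw [Matrix.mul_apply, ← Finset.add_sum_erase _ _ (Finset.mem_univ 0), add_sub_cancel_left]
  exact Finset.dvd_sum fun k hk => Dvd.dvd.mul_right (hA k (Finset.ne_of_mem_erase hk)) _

theorem FirstRow.mul {N : ℕ} {A B : Matrix (Fin n) (Fin n) ℤ} (hA : FirstRow N A)
    (hB : FirstRow N B) : FirstRow N (A * B) := fun j hj =>
  (dvd_sub_left (Dvd.dvd.mul_left (hB j hj) _)).1 (hA.mul_entry B j)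

theorem FirstRow.one (N : ℕ) : FirstRow N (1 : Matrix (Fin n) (Fin n) ℤ) := fun j hj => by
  rw [Matrix.one_apply_ne' hj]
  exact dvd_zero _

theorem FirstRow.of_mul_eq_one {N : ℕ} {A B : Matrix (Fin n) (Fin n) ℤ} (hA : FirstRow N A)
    (h : A * B = 1) : FirstRow N B := fun j hj => by
  have h0 := hA.mul_entry B 0
  have hj' := hA.mul_entry B j
  rw [h, Matrix.one_apply_eq] at h0
  rw [h, Matrix.one_apply_ne' hj, zero_sub, dvd_neg] at hj'
  obtain ⟨u, hu⟩ := h0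
  have : IsCoprime (N : ℤ) (A 0 0) := ⟨u, B 0 0, by linarith⟩
  exact this.dvd_of_dvd_mul_left hj'

/-- The subgroup `Γ_0(N)` of `SL_n(ℤ)`. -/
def Gamma0 (n : ℕ) [NeZero n] (N : ℕ) : Subgroup (SL(n, ℤ)) where
  carrier := {A | FirstRow N A.val}
  one_mem' := FirstRow.one N
  mul_mem' {A B} hA hB := by
    simpa using FirstRow.mul hA hB
  inv_mem' {A} hA := FirstRow.of_mul_eq_one (A := A.val) hA (by
    rw [← Matrix.SpecialLinearGroup.coe_mul, mul_inv_cancel, Matrix.SpecialLinearGroup.coe_one])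

/-- The semigroup of integral matrices with positive determinant prime to `pN` and first row
congruent to `(*, 0, …, 0)` modulo `N`; for `p` prime to `N` it is the semigroup generated by
`Γ_0(N)` and `S_{pN}`. -/
def heckeMonoid (n : ℕ) [NeZero n] (p N : ℕ) : Submonoid (Matrix (Fin n) (Fin n) ℤ) where
  carrier := {A | FirstRow N A ∧ 0 < A.det ∧ IsCoprime A.det ((p * N : ℕ) : ℤ)}
  one_mem' := ⟨FirstRow.one N, by simp, by simpa using isCoprime_one_left⟩
  mul_mem' {A B} hA hB := ⟨hA.1.mul hB.1, by rw [Matrix.det_mul]; exact mul_pos hA.2.1 hB.2.1,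
    by rw [Matrix.det_mul]; exact hA.2.2.mul_left hB.2.2⟩

/-- The inclusion of `Γ_0(N)` in the Hecke semigroup. -/
def gammaIncl (n : ℕ) [NeZero n] (p N : ℕ) : Gamma0 n N →* heckeMonoid n p N where
  toFun γ := ⟨γ.val.val, γ.prop, by simp, by simpa using isCoprime_one_left⟩
  map_one' := rfl
  map_mul' _ _ := Subtype.ext (by simp)

/-- The inclusion of the Hecke semigroup in `GL_n(ℚ)`. -/
def toGLQ (n : ℕ) [NeZero n] (p N : ℕ) : heckeMonoid n p N →* GL (Fin n) ℚ where
  toFun A := Matrix.GeneralLinearGroup.mkOfDetNeZero (A.val.map (Int.cast : ℤ → ℚ)) (by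
    have h : (A.val.map (Int.cast : ℤ → ℚ)).det = (A.val.det : ℚ) :=
      ((Int.castRingHom ℚ).map_det A.val).symm
    rw [h]
    exact_mod_cast A.prop.2.1.ne')
  map_one' := Units.ext (by
    simp [Matrix.GeneralLinearGroup.mkOfDetNeZero, Matrix.map_one])
  map_mul' A B := Units.ext (by
    simpa [Matrix.GeneralLinearGroup.mkOfDetNeZero] using
      Matrix.map_mul (L := A.val) (M := B.val) (f := Int.castRingHom ℚ))

/-- Reduction of the Hecke semigroup modulo `p`. -/
def reduce (n : ℕ) [NeZero n] (p N : ℕ) [Fact p.Prime] : heckeMonoid n p N →* GL (Fin n) (ZMod p)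
    where
  toFun A := Matrix.GeneralLinearGroup.mkOfDetNeZero (A.val.map (Int.cast : ℤ → ZMod p)) (by
    have h : (A.val.map (Int.cast : ℤ → ZMod p)).det = (A.val.det : ZMod p) :=
      ((Int.castRingHom (ZMod p)).map_det A.val).symm
    rw [h, Ne, ZMod.intCast_zmod_eq_zero_iff_dvd]
    intro hd
    have hp : IsCoprime (p : ℤ) ((p * N : ℕ) : ℤ) := A.prop.2.2.of_isCoprime_of_dvd_left hd
    have h1 : IsUnit (p : ℤ) := hp.isUnit_of_dvd' dvd_rfl (by push_cast; exact dvd_mul_right _ _)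
    exact (Nat.prime_iff_prime_int.1 (Fact.out : p.Prime)).not_isUnit h1)
  map_one' := Units.ext (by
    simp [Matrix.GeneralLinearGroup.mkOfDetNeZero, Matrix.map_one])
  map_mul' A B := Units.ext (by
    simpa [Matrix.GeneralLinearGroup.mkOfDetNeZero] using
      Matrix.map_mul (L := A.val) (M := B.val) (f := Int.castRingHom (ZMod p)))

variable {p : ℕ} [Fact p.Prime] {N : ℕ} {V : Type} [AddCommGroup V] [Module (Fpbar p) V]

/-- The module `V(ε) = V ⊗ F_ε` over the Hecke semigroup: `A` acts through its reduction modulo `p`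
on `V`, times the value of `ε` at the `(1,1)` entry of `A`. -/
def coeff (ε : DirichletCharacter (Fpbar p) N)
    (σ : Representation (Fpbar p) (GL (Fin n) (ZMod p)) V) :
    Representation (Fpbar p) (heckeMonoid n p N) V where
  toFun A := ε ((A.val 0 0 : ℤ) : ZMod N) • σ (reduce n p N A)
  map_one' := by simp
  map_mul' A B := by
    have h : (((A * B).val 0 0 : ℤ) : ZMod N) = (A.val 0 0 : ZMod N) * (B.val 0 0 : ZMod N) := by
      rw [← sub_eq_zero, ← Int.cast_mul, ← Int.cast_sub, ZMod.intCast_zmod_eq_zero_iff_dvd]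
      exact A.prop.1.mul_entry B.val 0
    rw [h, map_mul, map_mul, map_mul, smul_mul_smul_comm]

/-- `V(ε)` as a representation of `Γ_0(N)`. -/
abbrev coeffRep (ε : DirichletCharacter (Fpbar p) N)
    (σ : Representation (Fpbar p) (GL (Fin n) (ZMod p)) V) : Rep (Fpbar p) (Gamma0 n N) :=
  Rep.of ((coeff ε σ).comp (gammaIncl n p N))

/-- `Hⁱ(Γ_0(N), V(ε))`. -/
abbrev coh (ε : DirichletCharacter (Fpbar p) N)
    (σ : Representation (Fpbar p) (GL (Fin n) (ZMod p)) V) (i : ℕ) : ModuleCat (Fpbar p) :=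
  groupCohomology (coeffRep ε σ) i

/-- `f` is a homogeneous `i`-cocycle of `Γ_0(N)` with values in `V(ε)`, on the free `Γ_0(N)`-set
`GL_n(ℚ)`. Since the complex of the `F̄_p[GL_n(ℚ)^{i+1}]` is a free resolution of the trivial
module over `Γ_0(N)`, these cocycles compute the cohomology of `Γ_0(N)`. -/
structure IsHomogCocycle (ε : DirichletCharacter (Fpbar p) N)
    (σ : Representation (Fpbar p) (GL (Fin n) (ZMod p)) V) (i : ℕ)
    (f : (Fin (i + 1) → GL (Fin n) ℚ) → V) : Prop where
  equivariant : ∀ (γ : Gamma0 n N) (x : Fin (i + 1) → GL (Fin n) ℚ),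
    f (fun j => toGLQ n p N (gammaIncl n p N γ) * x j) = coeff ε σ (gammaIncl n p N γ) (f x)
  cocycle : ∀ x : Fin (i + 2) → GL (Fin n) ℚ,
    ∑ j : Fin (i + 2), (-1 : Fpbar p) ^ (j : ℕ) • f (fun l => x (j.succAbove l)) = 0

/-- The inhomogeneous cochain `(γ_1, …, γ_i) ↦ f(1, γ_1, γ_1 γ_2, …, γ_1 ⋯ γ_i)` on `Γ_0(N)`. -/
def restrictCochain (ε : DirichletCharacter (Fpbar p) N)
    (σ : Representation (Fpbar p) (GL (Fin n) (ZMod p)) V) (i : ℕ)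
    (f : (Fin (i + 1) → GL (Fin n) ℚ) → V) : (Fin i → Gamma0 n N) → coeffRep ε σ :=
  fun γ => f fun j => toGLQ n p N (gammaIncl n p N (Fin.partialProd γ j))

/-- The homogeneous cochain `f` represents the class `α`. -/
def Represents (ε : DirichletCharacter (Fpbar p) N)
    (σ : Representation (Fpbar p) (GL (Fin n) (ZMod p)) V) (i : ℕ)
    (f : (Fin (i + 1) → GL (Fin n) ℚ) → V) (α : coh ε σ i) : Prop :=
  ∃ h : inhomogeneousCochains.d (coeffRep ε σ) i (restrictCochain ε σ i f) = 0,
    groupCohomology.π (coeffRep ε σ) i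
      (groupCohomology.cocyclesMk (restrictCochain ε σ i f) h) = α

/-- The double coset `Γ_0(N) s Γ_0(N)`, inside the Hecke semigroup. -/
def DoubleCoset (n : ℕ) [NeZero n] (p N : ℕ) (s : Matrix (Fin n) (Fin n) ℤ) : Type :=
  {A : heckeMonoid n p N // ∃ γ δ : Gamma0 n N,
    A.val = (gammaIncl n p N γ).val * s * (gammaIncl n p N δ).val}

/-- Two elements of `Γ_0(N) s Γ_0(N)` are equivalent if they are in the same coset `A Γ_0(N)`. -/
def cosetSetoid (n : ℕ) [NeZero n] (p N : ℕ) (s : Matrix (Fin n) (Fin n) ℤ) :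
    Setoid (DoubleCoset n p N s) where
  r A B := ∃ γ : Gamma0 n N, B.val = A.val * gammaIncl n p N γ
  iseqv :=
    { refl := fun A => ⟨1, by simp⟩
      symm := by
        rintro A B ⟨γ, h⟩
        exact ⟨γ⁻¹, by rw [h, mul_assoc, ← map_mul, mul_inv_cancel, map_one, mul_one]⟩
      trans := by
        rintro A B C ⟨γ, h⟩ ⟨δ, h'⟩
        exact ⟨γ * δ, by rw [h', h, mul_assoc, map_mul]⟩ }

/-- The Hecke operator of `Γ_0(N) s Γ_0(N) = ⊔ s_j Γ_0(N)` on homogeneous cochains: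
`(T f)(x_0, …, x_i) = ∑_j s_j f(s_j⁻¹ x_0, …, s_j⁻¹ x_i)`. For equivariant `f` the terms do not
depend on the choice of the `s_j`. -/
def heckeOp (ε : DirichletCharacter (Fpbar p) N)
    (σ : Representation (Fpbar p) (GL (Fin n) (ZMod p)) V) (i : ℕ)
    (s : Matrix (Fin n) (Fin n) ℤ) (f : (Fin (i + 1) → GL (Fin n) ℚ) → V) :
    (Fin (i + 1) → GL (Fin n) ℚ) → V :=
  fun x => ∑ᶠ q : Quotient (cosetSetoid n p N s),
    coeff ε σ q.out.val (f fun j => (toGLQ n p N q.out.val)⁻¹ * x j)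

/-- The class `β` is the image of `α` under the Hecke operator of `Γ_0(N) s Γ_0(N)`. -/
def HeckeMapsTo (ε : DirichletCharacter (Fpbar p) N)
    (σ : Representation (Fpbar p) (GL (Fin n) (ZMod p)) V) (i : ℕ)
    (s : Matrix (Fin n) (Fin n) ℤ) (α β : coh ε σ i) : Prop :=
  ∃ f, IsHomogCocycle ε σ i f ∧ Represents ε σ i f α ∧ Represents ε σ i (heckeOp ε σ i s f) β

/-- `D(ℓ, k) = diag(1, …, 1, ℓ, …, ℓ)` with `k` entries equal to `ℓ`. -/
def matD (n ℓ k : ℕ) : Matrix (Fin n) (Fin n) ℤ :=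
  Matrix.diagonal fun i => if n ≤ (i : ℕ) + k then (ℓ : ℤ) else 1

/-- `α` is an eigenclass of all the `T(ℓ, k)`, with `ℓ` a prime not dividing `pN` and `0 ≤ k ≤ n`,
with eigenvalues `a(ℓ, k)`. -/
structure IsEigenclass (ε : DirichletCharacter (Fpbar p) N)
    (σ : Representation (Fpbar p) (GL (Fin n) (ZMod p)) V) (i : ℕ)
    (α : coh ε σ i) (a : ℕ → ℕ → Fpbar p) : Prop where
  ne_zero : α ≠ 0
  eigen : ∀ ℓ k : ℕ, ℓ.Prime → ¬ ℓ ∣ p * N → k ≤ n →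
    HeckeMapsTo ε σ i (matD n ℓ k) α (a ℓ k • α)

/-- `ρ` is attached to the eigenclass `α ∈ Hⁱ(Γ_0(N), V(ε))`: it is unramified outside `pN`, and
`∑_k (-1)^k ℓ^{k(k-1)/2} a(ℓ, k) X^k = det(1 - ρ(Frob_ℓ) X)` for all primes `ℓ` not dividing `pN`,
where the `a(ℓ, k)` are the Hecke eigenvalues of `α` and `Frob_ℓ` is an arithmetic Frobenius. -/
def IsAttached (ρ : GQ →* GL (Fin n) (Fpbar p)) (ε : DirichletCharacter (Fpbar p) N)
    (σ : Representation (Fpbar p) (GL (Fin n) (ZMod p)) V) (i : ℕ) (α : coh ε σ i) : Prop :=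
  ∃ a : ℕ → ℕ → Fpbar p, IsEigenclass ε σ i α a ∧
    ∀ ℓ : ℕ, ℓ.Prime → ¬ ℓ ∣ p * N → IsUnramifiedAt ρ ℓ ∧
      ∀ 𝔩 : Ideal (𝓞 Qbar), IsAbove 𝔩 ℓ → ∀ g : GQ, IsArithFrobAt ℤ g 𝔩 →
        (ρ g).val.charpolyRev = ∑ k ∈ Finset.range (n + 1),
          Polynomial.C ((-1) ^ k * (ℓ : Fpbar p) ^ (k * (k - 1) / 2) * a ℓ k) * Polynomial.X ^ k

end Hecke

end GaloisHecke

end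

noncomputable section

namespace GaloisHecke

/-! ### The contragredient: pairing with `ρ`, nebentype, semisimplicity -/

section Basics

variable {p : ℕ} [Fact p.Prime] {n : ℕ}

/-! Everything follows from the automorphism A ↦ ᵗA⁻¹, corrected on each side so that it respects
the chosen normalizations.

Galois side. The dot product pairs ρ^∨ with ρ (`contragredient_dotProduct`), so composition series
and adapted bases pass to orthogonal complements and dual bases. This inverts the characters of
inertia and reverses the order of the factors. Conjugation by the longest Weyl element w₀ makes the
action upper triangular again and replaces the partition defining the Levi subgroup by its reversal;
hence (b_1, …, b_n) becomes (-b_n, …, -b_1) (`IsDerived.contragredient`). The matrix diag(1, -1, 1,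
…) is its own inverse transpose and is changed by w₀ at most by a sign
(`StrictParity.contragredient`). The level does not change: the ramification groups at q ≠ p are
cyclic modulo a normal subgroup of order prime to p, and for such groups a representation and its
dual have fixed spaces of the same dimension (`finrank_fixedBy_contragredient`).

Weights. A simple submodule of a dual Weyl module contains a function h ≠ 0 invariant under upper
unipotent matrices. On the big cell h(ᵗx) = h(x), hence everywhere, and the translates of h then
carry a contravariant form (`exists_contravariant`). So V* is V with g acting through ᵗg⁻¹, which is
F(-b_n, …, -b_1) if V is F(b). The twist by det^{-(n-1)} produces the shift by (n-1, …, 0) required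
of the dual tuple (`IsModuleFPrime.dualWeight`).

Cohomology. With D = diag(N, 1, …, 1), the map γ ↦ D ᵗγ⁻¹ D⁻¹ preserves Γ_0(N), and together with
the duality of coefficients it identifies H^i with values in V(ε) and in W(ε⁻¹). A coset
representative s for T(ℓ,k) goes to ℓ D ᵗs⁻¹ D⁻¹, one for T(ℓ,n-k). The scalar ℓ acts by a(ℓ,n), so
the dual class has eigenvalues a(ℓ,n-k) / (a(ℓ,n) ℓ^{k(n-1)}) (`IsEigenclass.exists_dual`). These
are the coefficients demanded by det(1 - A⁻¹X), which up to a constant is det(1 - AX) read backwards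
(`charpolyRev_transposeInv`). -/

@[simp]
theorem galRep_apply (ρ : GQ →* GL (Fin n) (Fpbar p)) (g : GQ) (v : Fin n → Fpbar p) :
    galRep ρ g v = (ρ g).val *ᵥ v := rfl

@[simp]
theorem transposeInv_val {R : Type*} [CommRing R] (A : GL (Fin n) R) :
    (transposeInv R A).val = (A⁻¹).valᵀ := rfl

@[simp]
theorem transposeInv_inv_val {R : Type*} [CommRing R] (A : GL (Fin n) R) :
    (transposeInv R A)⁻¹.val = A.valᵀ := rfl

theorem transposeInv_transposeInv {R : Type*} [CommRing R] (A : GL (Fin n) R) :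
    transposeInv R (transposeInv R A) = A := by
  apply Units.ext
  rw [transposeInv_val, transposeInv_inv_val, Matrix.transpose_transpose]

theorem transposeInv_injective {R : Type*} [CommRing R] :
    Function.Injective (transposeInv (n := n) R) :=
  Function.LeftInverse.injective transposeInv_transposeInv

theorem contragredient_apply (ρ : GQ →* GL (Fin n) (Fpbar p)) (g : GQ) :
    contragredient ρ g = transposeInv _ (ρ g) := rfl

theorem contragredient_contragredient (ρ : GQ →* GL (Fin n) (Fpbar p)) :
    contragredient (contragredient ρ) = ρ :=
  MonoidHom.ext fun g => transposeInv_transposeInv (ρ g)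

theorem conjBy_apply (M : GL (Fin n) (Fpbar p)) (ρ : GQ →* GL (Fin n) (Fpbar p)) (g : GQ) :
    conjBy M ρ g = M * ρ g * M⁻¹ := rfl

theorem conjBy_conjBy (M M' : GL (Fin n) (Fpbar p)) (ρ : GQ →* GL (Fin n) (Fpbar p)) :
    conjBy M (conjBy M' ρ) = conjBy (M * M') ρ := by
  ext1 g
  simp only [conjBy_apply, mul_inv_rev]
  group

theorem contragredient_conjBy (M : GL (Fin n) (Fpbar p)) (ρ : GQ →* GL (Fin n) (Fpbar p)) :
    contragredient (conjBy M ρ) = conjBy (transposeInv _ M) (contragredient ρ) := by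
  ext1 g
  simp only [conjBy_apply, contragredient_apply, map_mul, map_inv]

/-- Every transfer of submodules and bases from ρ to ρ^∨ rests on this adjunction. -/
theorem contragredient_dotProduct (ρ : GQ →* GL (Fin n) (Fpbar p)) (g : GQ)
    (x y : Fin n → Fpbar p) :
    galRep (contragredient ρ) g x ⬝ᵥ y = x ⬝ᵥ galRep ρ g⁻¹ y := by
  rw [galRep_apply, galRep_apply, contragredient_apply, transposeInv_val, map_inv,
    Matrix.mulVec_transpose, ← Matrix.dotProduct_mulVec]

/-- Equal kernels cut out the same field, so both conductors are computed with the same ramification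
groups. -/
theorem ker_contragredient (ρ : GQ →* GL (Fin n) (Fpbar p)) :
    (contragredient ρ).ker = ρ.ker := by
  ext g
  rw [MonoidHom.mem_ker, MonoidHom.mem_ker, contragredient_apply]
  exact map_eq_one_iff _ transposeInv_injective

theorem continuous_contragredient {ρ : GQ →* GL (Fin n) (Fpbar p)}
    (h : Continuous[krullTopology ℚ Qbar, ⊥] ρ) :
    Continuous[krullTopology ℚ Qbar, ⊥] (contragredient ρ) := by
  let _ : TopologicalSpace (GL (Fin n) (Fpbar p)) := ⊥
  have : DiscreteTopology (GL (Fin n) (Fpbar p)) := ⟨rfl⟩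
  exact (continuous_of_discreteTopology (f := transposeInv (n := n) (Fpbar p))).comp h

theorem IsUnramifiedAt.contragredient {ρ : GQ →* GL (Fin n) (Fpbar p)} {ℓ : ℕ}
    (h : IsUnramifiedAt ρ ℓ) : IsUnramifiedAt (contragredient ρ) ℓ := fun 𝔩 h𝔩 g hg => by
  rw [contragredient_apply, h 𝔩 h𝔩 g hg, map_one]

theorem IsNebentype.contragredient {ρ : GQ →* GL (Fin n) (Fpbar p)} {N : ℕ} [NeZero N]
    {ε : DirichletCharacter (Fpbar p) N} (h : IsNebentype ρ N ε) :
    IsNebentype (contragredient ρ) N ε⁻¹ := by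
  obtain ⟨k, hk⟩ := h
  refine ⟨-k, fun g => ?_⟩
  rw [contragredient_apply, transposeInv_val, Matrix.det_transpose, Matrix.coe_units_inv,
    Matrix.det_nonsing_inv, Ring.inverse_eq_inv', hk g, mul_inv, zpow_neg, Units.val_inv_eq_inv_val,
    MulChar.inv_apply_eq_inv']

/-! ### Orthogonal complements for the dot product -/

/-- The orthogonal complement for the dot product. -/
def dotPerp (X : Submodule (Fpbar p) (Fin n → Fpbar p)) :
    Submodule (Fpbar p) (Fin n → Fpbar p) :=
  LinearMap.BilinForm.orthogonal (dotProductBilin (Fpbar p) (Fpbar p)) X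

theorem mem_dotPerp {X : Submodule (Fpbar p) (Fin n → Fpbar p)} {y : Fin n → Fpbar p} :
    y ∈ dotPerp X ↔ ∀ x ∈ X, y ⬝ᵥ x = 0 := by
  simp only [dotPerp, LinearMap.BilinForm.mem_orthogonal_iff,
    dotProductBilin_apply_apply]
  exact forall₂_congr fun x _ => by rw [dotProduct_comm]

theorem dotPerp_anti {X Y : Submodule (Fpbar p) (Fin n → Fpbar p)} (h : X ≤ Y) :
    dotPerp Y ≤ dotPerp X :=
  LinearMap.BilinForm.orthogonal_le h

/-- Only nondegeneracy is used. Isotropic vectors may exist over F̄_p, so a subspace and its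
orthogonal need not be complementary. -/
theorem dotPerp_dotPerp (X : Submodule (Fpbar p) (Fin n → Fpbar p)) :
    dotPerp (dotPerp X) = X := by
  refine LinearMap.BilinForm.orthogonal_orthogonal ⟨fun x hx => ?_, fun x hx => ?_⟩ ?_ X
  · exact dotProduct_eq_zero_iff.1 fun y => hx y
  · exact dotProduct_eq_zero_iff.1 fun y => by rw [dotProduct_comm]; exact hx y
  · intro x y h
    rwa [dotProductBilin_apply_apply, dotProduct_comm]

theorem dotPerp_le_iff {X Y : Submodule (Fpbar p) (Fin n → Fpbar p)} :
    dotPerp Y ≤ dotPerp X ↔ X ≤ Y :=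
  ⟨fun h => by simpa only [dotPerp_dotPerp] using dotPerp_anti h, dotPerp_anti⟩

/-- Passing to the orthogonal complement reverses the lattice of subspaces. -/
def dotPerpIso : Submodule (Fpbar p) (Fin n → Fpbar p) ≃o
    (Submodule (Fpbar p) (Fin n → Fpbar p))ᵒᵈ where
  toFun X := OrderDual.toDual (dotPerp X)
  invFun X := dotPerp (OrderDual.ofDual X)
  left_inv := dotPerp_dotPerp
  right_inv := dotPerp_dotPerp
  map_rel_iff' := dotPerp_le_iff

theorem dotPerp_inf (X Y : Submodule (Fpbar p) (Fin n → Fpbar p)) :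
    dotPerp (X ⊓ Y) = dotPerp X ⊔ dotPerp Y :=
  dotPerpIso.map_inf X Y

theorem mem_dotPerp_of_stable {ρ : GQ →* GL (Fin n) (Fpbar p)}
    {X : Submodule (Fpbar p) (Fin n → Fpbar p)} {g : GQ}
    (h : ∀ x ∈ X, galRep ρ g⁻¹ x ∈ X) {y : Fin n → Fpbar p} (hy : y ∈ dotPerp X) :
    galRep (contragredient ρ) g y ∈ dotPerp X := by
  rw [mem_dotPerp] at hy ⊢
  intro x hx
  rw [contragredient_dotProduct]
  exact hy _ (h x hx)

/-- The orthogonal complement of a subrepresentation, as a subrepresentation of the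
contragredient. -/
def perpSubrep (ρ : GQ →* GL (Fin n) (Fpbar p)) :
    Subrepresentation (galRep ρ) ≃o (Subrepresentation (galRep (contragredient ρ)))ᵒᵈ where
  toFun X := OrderDual.toDual ⟨dotPerp X.toSubmodule, fun g _ hy =>
    mem_dotPerp_of_stable (fun _ hx => X.apply_mem_toSubmodule g⁻¹ hx) hy⟩
  invFun X := ⟨dotPerp (OrderDual.ofDual X).toSubmodule, fun g v hy => by
    have := mem_dotPerp_of_stable (ρ := contragredient ρ) (g := g)
      (fun _ hx => (OrderDual.ofDual X).apply_mem_toSubmodule g⁻¹ hx) hy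
    rwa [contragredient_contragredient] at this⟩
  left_inv X := Subrepresentation.toSubmodule_injective (dotPerp_dotPerp _)
  right_inv X := Subrepresentation.toSubmodule_injective
    (dotPerp_dotPerp (OrderDual.ofDual X).toSubmodule)
  map_rel_iff' {X Y} := dotPerp_le_iff (X := X.toSubmodule) (Y := Y.toSubmodule)

/-- Semisimplicity means that the lattice of subrepresentations is complemented, a property stable
under reversal of the order; `perpSubrep` is such a reversal. -/
theorem semisimple_contragredient {ρ : GQ →* GL (Fin n) (Fpbar p)}
    (h : (galRep ρ).IsSemisimpleRepresentation) :
    (galRep (contragredient ρ)).IsSemisimpleRepresentation := by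
  have := (perpSubrep ρ).complementedLattice_iff.1 h
  exact ⟨fun X => by
    obtain ⟨Y, hY⟩ := this.exists_isCompl (OrderDual.toDual X)
    exact ⟨OrderDual.ofDual Y, hY.ofDual⟩⟩

end Basics

end GaloisHecke

namespace GaloisHecke

/-! ### The longest Weyl group element -/

section RevGL

variable {n : ℕ} {R : Type*} [CommRing R]

/-- The permutation matrix of the order-reversing permutation. -/
def revMatrix (n : ℕ) (R : Type*) [CommRing R] : Matrix (Fin n) (Fin n) R :=
  (1 : Matrix (Fin n) (Fin n) R).submatrix Fin.rev id

theorem revMatrix_mul (A : Matrix (Fin n) (Fin n) R) :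
    revMatrix n R * A = A.submatrix Fin.rev id := by
  ext i j
  simp [revMatrix, Matrix.mul_apply, Matrix.one_apply]

theorem mul_revMatrix (A : Matrix (Fin n) (Fin n) R) :
    A * revMatrix n R = A.submatrix id Fin.rev := by
  ext i j
  simp [revMatrix, Matrix.mul_apply, Matrix.one_apply, Fin.rev_eq_iff]

theorem revMatrix_mul_self : revMatrix n R * revMatrix n R = 1 := by
  rw [revMatrix_mul, revMatrix, Matrix.submatrix_submatrix, Fin.rev_involutive.comp_self]
  rfl

/-- The permutation matrix of the order-reversing permutation, in `GL_n`. -/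
def revGL (n : ℕ) (R : Type*) [CommRing R] : GL (Fin n) R :=
  ⟨revMatrix n R, revMatrix n R, revMatrix_mul_self, revMatrix_mul_self⟩

theorem revGL_inv : (revGL n R)⁻¹ = revGL n R := rfl

theorem revGL_conj_apply (A : GL (Fin n) R) (i j : Fin n) :
    (revGL n R * A * (revGL n R)⁻¹).val i j = A.val i.rev j.rev := by
  rw [revGL_inv]
  change (revMatrix n R * A.val * revMatrix n R) i j = _
  rw [mul_revMatrix, revMatrix_mul]
  rfl

end RevGL

/-! ### Levi subgroups and strict parity for the contragredient -/

section Levi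

variable {p : ℕ} [Fact p.Prime] {n : ℕ}

theorem mem_leviBlock {s : Setoid (Fin n)} {c : Quotient s} {v : Fin n → Fpbar p} :
    v ∈ leviBlock s c ↔ ∀ j, Quotient.mk s j ≠ c → v j = 0 := by
  constructor
  · intro hv j hj
    have : leviBlock (p := p) s c ≤ LinearMap.ker (LinearMap.proj j) := by
      refine Submodule.span_le.2 ?_
      rintro _ ⟨i, hi, rfl⟩
      refine Pi.single_eq_of_ne ?_ _
      rintro rfl
      exact hj hi
    exact this hv
  · intro h
    rw [pi_eq_sum_univ' v]
    refine Submodule.sum_mem _ fun j _ => ?_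
    by_cases hj : Quotient.mk s j = c
    · refine Submodule.smul_mem _ _ (Submodule.subset_span ⟨j, hj, ?_⟩)
      ext i
      simp [Pi.single_apply, eq_comm]
    · rw [h j hj, zero_smul]
      exact zero_mem _

/-- Vanishing of the entries between different classes gives one inclusion for each D_c; the other
is a dimension count, since g is injective. -/
theorem mem_standardLevi_iff {s : Setoid (Fin n)} {g : GL (Fin n) (Fpbar p)} :
    g ∈ standardLevi s ↔ ∀ i j, ¬ s i j → g.val i j = 0 := by
  constructor
  · intro h i j hij
    have h1 : Matrix.toLin' g.val (Pi.single j 1) ∈ leviBlock s (Quotient.mk s j) := by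
      rw [← h (Quotient.mk s j)]
      exact Submodule.mem_map_of_mem (Submodule.subset_span ⟨j, rfl, rfl⟩)
    have h2 := mem_leviBlock.1 h1 i fun h => hij (Quotient.exact h)
    simpa using h2
  · intro h c
    refine Submodule.eq_of_le_of_finrank_eq ?_ ?_
    · rintro _ ⟨v, hv, rfl⟩
      rw [SetLike.mem_coe, mem_leviBlock] at hv
      rw [mem_leviBlock]
      intro i hi
      rw [Matrix.toLin'_apply, Matrix.mulVec, dotProduct]
      refine Finset.sum_eq_zero fun j _ => ?_
      by_cases hj : Quotient.mk s j = c
      · rw [h i j fun hij => hi ((Quotient.sound hij).trans hj), zero_mul]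
      · rw [hv j hj, mul_zero]
    · exact (Submodule.equivMapOfInjective _
        (Matrix.mulVec_injective_of_isUnit g.isUnit) _).finrank_eq.symm

theorem transposeInv_mem_standardLevi {s : Setoid (Fin n)} {g : GL (Fin n) (Fpbar p)}
    (h : g ∈ standardLevi s) : transposeInv _ g ∈ standardLevi s := by
  rw [mem_standardLevi_iff]
  intro i j hij
  rw [transposeInv_val, Matrix.transpose_apply]
  exact mem_standardLevi_iff.1 (inv_mem h) j i fun h => hij (s.symm' h)

theorem revGL_conj_mem_standardLevi_iff {s : Setoid (Fin n)} {g : GL (Fin n) (Fpbar p)} :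
    revGL n _ * g * (revGL n _)⁻¹ ∈ standardLevi (s.comap Fin.rev) ↔ g ∈ standardLevi s := by
  rw [mem_standardLevi_iff, mem_standardLevi_iff]
  simp only [revGL_conj_apply, Setoid.comap_rel]
  exact ⟨fun h i j => by simpa using h i.rev j.rev, fun h i j => h _ _⟩

theorem revGL_conj_mem_standardLevi_comap_iff {s : Setoid (Fin n)} {g : GL (Fin n) (Fpbar p)} :
    revGL n _ * g * (revGL n _)⁻¹ ∈ standardLevi s ↔ g ∈ standardLevi (s.comap Fin.rev) := by
  rw [mem_standardLevi_iff, mem_standardLevi_iff]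
  simp only [revGL_conj_apply, Setoid.comap_rel]
  exact ⟨fun h i j => by simpa using h i.rev j.rev, fun h i j => by simpa using h i.rev j.rev⟩

theorem conjBy_contragredient_mem_standardLevi {s : Setoid (Fin n)}
    {ρ : GQ →* GL (Fin n) (Fpbar p)} {M : GL (Fin n) (Fpbar p)} {g : GQ}
    (h : conjBy M ρ g ∈ standardLevi s) :
    conjBy (revGL n _ * transposeInv _ M) (contragredient ρ) g ∈
      standardLevi (s.comap Fin.rev) := by
  rw [← conjBy_conjBy, ← contragredient_conjBy, conjBy_apply]
  exact revGL_conj_mem_standardLevi_iff.2 (transposeInv_mem_standardLevi h)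

theorem comap_rev_comap_rev (s : Setoid (Fin n)) :
    (s.comap Fin.rev).comap Fin.rev = s := by
  ext i j
  simp [Setoid.comap_rel]

theorem standardLevi_comap_rev_le {s t : Setoid (Fin n)}
    (h : standardLevi (p := p) s ≤ standardLevi t) :
    standardLevi (p := p) (s.comap Fin.rev) ≤ standardLevi (t.comap Fin.rev) := fun _ hg =>
  revGL_conj_mem_standardLevi_comap_iff.1 (h (revGL_conj_mem_standardLevi_comap_iff.2 hg))

/-- Contragredient and reversal of the partition are both involutions, so a smaller Levi subgroup
for ρ^∨ would give a smaller one for ρ. -/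
theorem IsMinimalLevi.contragredient {ρ : GQ →* GL (Fin n) (Fpbar p)} {s : Setoid (Fin n)}
    (h : IsMinimalLevi ρ (standardLevi s)) :
    IsMinimalLevi (contragredient ρ) (standardLevi (s.comap Fin.rev)) := by
  obtain ⟨⟨-, M, hM⟩, hmin⟩ := h
  refine ⟨⟨⟨_, rfl⟩, _, fun g => conjBy_contragredient_mem_standardLevi (hM g)⟩, ?_⟩
  rintro _ ⟨⟨t, rfl⟩, M', hM'⟩ hle
  have h1 : standardLevi (p := p) (t.comap Fin.rev) ≤ standardLevi s := by
    simpa only [comap_rev_comap_rev] using standardLevi_comap_rev_le hle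
  have h2 := hmin ⟨⟨_, rfl⟩, _, fun g => by
    simpa only [contragredient_contragredient] using
      conjBy_contragredient_mem_standardLevi (hM' g)⟩ h1
  simpa only [comap_rev_comap_rev] using standardLevi_comap_rev_le h2

theorem IsMinimalLevi.conjBy_iff {ρ : GQ →* GL (Fin n) (Fpbar p)} {M : GL (Fin n) (Fpbar p)}
    {L : Subgroup (GL (Fin n) (Fpbar p))} :
    IsMinimalLevi (conjBy M ρ) L ↔ IsMinimalLevi ρ L := by
  have : ∀ L' : Subgroup (GL (Fin n) (Fpbar p)),
      (∃ M', ∀ g, conjBy M' (conjBy M ρ) g ∈ L') ↔ ∃ M', ∀ g, conjBy M' ρ g ∈ L' := by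
    refine fun L' => ⟨fun ⟨M', h⟩ => ⟨M' * M, by simpa only [conjBy_conjBy] using h⟩,
      fun ⟨M', h⟩ => ⟨M' * M⁻¹, by simpa only [conjBy_conjBy, inv_mul_cancel_right] using h⟩⟩
  simp only [IsMinimalLevi, this]

/-- A = ±diag(1, -1, …) is a diagonal involution, hence equal to its inverse transpose; only the
effect of w₀ on it remains to be computed. -/
theorem StrictParity.contragredient {c : GQ} {ρ : GQ →* GL (Fin n) (Fpbar p)}
    {M : GL (Fin n) (Fpbar p)} {s : Setoid (Fin n)} (h : StrictParity c (conjBy M ρ) s) :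
    StrictParity c (conjBy (revGL n _ * transposeInv _ M) (contragredient ρ))
      (s.comap Fin.rev) where
  mem_levi g := conjBy_contragredient_mem_standardLevi (h.mem_levi g)
  minimal := IsMinimalLevi.conjBy_iff.2 (IsMinimalLevi.conjBy_iff.1 h.minimal).contragredient
  conj := by
    obtain ⟨M', hM', u, hu⟩ := h.conj
    set A := M' * conjBy M ρ c * M'⁻¹ with hA
    have hAA : A * A = 1 := by
      apply Units.ext
      rw [Units.val_mul, hu, Matrix.smul_mul, Matrix.mul_smul, smul_smul, ← Units.val_mul,
        Int.units_mul_self, Units.val_one, one_smul, Matrix.diagonal_mul_diagonal, Units.val_one,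
        ← Matrix.diagonal_one]
      congr 1
      ext i
      rw [← mul_pow, neg_one_mul, neg_neg, one_pow]
    have hAt : transposeInv _ A = A := by
      apply Units.ext
      rw [transposeInv_val, inv_eq_of_mul_eq_one_right hAA, hu, Matrix.transpose_smul,
        Matrix.diagonal_transpose]
    -- Reversal turns (-1)^i into (-1)^(n-1-i) = (-1)^(n-1) (-1)^i, which explains the new sign.
    refine ⟨revGL n _ * transposeInv _ M' * (revGL n _)⁻¹,
      revGL_conj_mem_standardLevi_iff.2 (transposeInv_mem_standardLevi hM'),
      u * (-1) ^ (n - 1), ?_⟩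
    have h1 : revGL n _ * transposeInv _ M' * (revGL n _)⁻¹ *
        conjBy (revGL n _ * transposeInv _ M) (GaloisHecke.contragredient ρ) c *
        (revGL n _ * transposeInv _ M' * (revGL n _)⁻¹)⁻¹ =
        revGL n _ * A * (revGL n _)⁻¹ := by
      conv_rhs => rw [← hAt, hA]
      rw [← conjBy_conjBy, ← contragredient_conjBy, conjBy_apply, contragredient_apply, map_mul,
        map_mul, map_inv]
      group
    rw [h1]
    ext i j
    rw [revGL_conj_apply, hu, Matrix.smul_apply, Matrix.smul_apply]
    by_cases hij : i = j
    · subst hij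
      rw [Matrix.diagonal_apply_eq, Matrix.diagonal_apply_eq, Fin.val_rev]
      have hi : n - 1 = (n - (i + 1)) + i := by omega
      rw [hi, Units.val_mul, Units.val_pow_eq_pow_val, Units.val_neg, Units.val_one, pow_add]
      simp only [zsmul_eq_mul]
      push_cast
      rw [mul_assoc, mul_assoc, ← mul_pow]
      simp
    · rw [Matrix.diagonal_apply_ne _ hij, Matrix.diagonal_apply_ne _
        (fun h => hij (Fin.rev_injective h)), smul_zero, smul_zero]

end Levi

end GaloisHecke

namespace GaloisHecke

/-! ### Derived tuples of the contragredient -/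

section Derived

variable {p : ℕ} [Fact p.Prime] {n : ℕ}

/-! ### Tuples derived from simple modules -/

/-- Since π^(p^d - 1) = p is fixed by g, the quotient g(π)/π is a root of unity of order dividing
p^d - 1. Exponents of ψ therefore matter only modulo p^d - 1. -/
theorem IsFundamentalChar.pow_eq_one {𝔓 : Ideal (𝓞 Qbar)} {d : ℕ}
    {ψ : 𝔓.inertia GQ →* (Fpbar p)ˣ} (h : IsFundamentalChar 𝔓 d ψ) (hd : d ≠ 0) :
    ψ ^ (p ^ d - 1) = 1 := by
  obtain ⟨ι, π, hπ, hψ⟩ := h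
  have hp : p.Prime := Fact.out
  have hπ0 : π ≠ 0 := by
    rintro rfl
    rw [zero_pow (Nat.sub_ne_zero_of_lt (Nat.one_lt_pow hd hp.one_lt)), eq_comm,
      Nat.cast_eq_zero] at hπ
    exact hp.ne_zero hπ
  ext g
  obtain ⟨u, hu, hι⟩ := hψ g
  have h1 : (u : Qbar) ^ (p ^ d - 1) = 1 := by
    have h2 : (g : GQ) (π ^ (p ^ d - 1)) = π ^ (p ^ d - 1) := by rw [hπ, map_natCast]
    rw [map_pow, hu, mul_pow] at h2
    exact mul_right_cancel₀ (pow_ne_zero _ hπ0) (h2.trans (one_mul _).symm)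
  have h2 : u ^ (p ^ d - 1) = 1 := NumberField.RingOfIntegers.ext (by simpa using h1)
  rw [MonoidHom.pow_apply, Units.val_pow_eq_pow_val, ← hι, ← map_pow, ← map_pow, h2]
  simp

theorem dvd_pow_sub_pow_mod (b : ℤ) (d x : ℕ) : b ^ d - 1 ∣ b ^ x - b ^ (x % d) := by
  have h : b ^ x - b ^ (x % d) = b ^ (x % d) * ((b ^ d) ^ (x / d) - 1 ^ (x / d)) := by
    rw [one_pow, mul_sub, mul_one, ← pow_mul, ← pow_add, Nat.mod_add_div]
  rw [h]
  exact Dvd.dvd.mul_left (sub_dvd_pow_sub_pow _ _ _) _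

/-- Modulo b^d - 1 a power of b depends only on its exponent modulo d, so rotating the digits by s
amounts to division by b^s. -/
theorem dvd_rotate_digits (b : ℤ) {d : ℕ} [NeZero d] (c : Fin d → ℤ) (s t : Fin d) :
    b ^ d - 1 ∣ (∑ i, c (i + s) * b ^ (i : ℕ)) * b ^ ((t + s : Fin d) : ℕ) -
      (∑ i, c i * b ^ (i : ℕ)) * b ^ (t : ℕ) := by
  rw [← Equiv.sum_comp (Equiv.addRight s) (fun i => c i * b ^ (i : ℕ)), Finset.sum_mul,
    Finset.sum_mul, ← Finset.sum_sub_distrib]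
  refine Finset.dvd_sum fun i _ => ?_
  rw [Equiv.coe_addRight, Fin.val_add, Fin.val_add, mul_assoc, mul_assoc, ← mul_sub]
  refine Dvd.dvd.mul_left ?_ _
  have h1 := (dvd_pow_sub_pow_mod b d ((t : ℕ) + s)).mul_left (b ^ (i : ℕ))
  have h2 := (dvd_pow_sub_pow_mod b d ((i : ℕ) + s)).mul_left (b ^ (t : ℕ))
  have h3 : b ^ (i : ℕ) * b ^ (((t : ℕ) + s) % d) - b ^ (((i : ℕ) + s) % d) * b ^ (t : ℕ) =
      b ^ (t : ℕ) * (b ^ ((i : ℕ) + s) - b ^ (((i : ℕ) + s) % d)) -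
      b ^ (i : ℕ) * (b ^ ((t : ℕ) + s) - b ^ (((t : ℕ) + s) % d)) := by
    ring
  rw [h3]
  exact dvd_sub h2 h1

/-- Inverting the characters negates the digits. The last digit must be the smallest, so the negated
digits have to be rotated; a rotation only permutes the characters ψ^(m p^i). -/
theorem IsDerivedSimple.dual {𝔓 : Ideal (𝓞 Qbar)} {B B' : Type} [Finite B] [LinearOrder B]
    [Finite B'] [LinearOrder B'] [Nonempty B] {φ : B → (𝔓.inertia GQ →* (Fpbar p)ˣ)} {a : B → ℤ}
    (h : IsDerivedSimple 𝔓 φ a) (r : B' ≃ B) (hr : Antitone r) :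
    IsDerivedSimple 𝔓 (fun j => (φ (r j))⁻¹) (fun j => -a (r j)) := by
  obtain ⟨ψ, m, c, τ, τ', hψ, hφ, hm, hc, ha, hanti⟩ := h
  have hd : NeZero (Nat.card B) := ⟨Nat.card_pos.ne'⟩
  have hpow := hψ.pow_eq_one hd.out
  unfold IsDerivedSimple
  rw [Nat.card_congr r]
  generalize Nat.card B = d at *
  obtain ⟨d, rfl⟩ : ∃ d', d = d' + 1 := Nat.exists_eq_succ_of_ne_zero hd.out
  obtain ⟨M, hM⟩ := Finite.exists_max c
  -- The rotation that brings the largest digit c M to the last place, where its negative is the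
  -- minimum.
  set s : Fin (d + 1) := M - Fin.last d with hs
  refine ⟨ψ, ∑ i : Fin (d + 1), -c (i + s) * (p : ℤ) ^ (i : ℕ), fun i => -c (i + s),
    (r.trans τ).trans (Equiv.addRight s), (r.trans τ').trans (Equiv.subRight s), hψ, ?_, rfl,
    ?_, ?_, ?_⟩
  · intro j
    obtain ⟨t, ht⟩ := dvd_rotate_digits p c s (τ (r j))
    rw [← hm] at ht
    have h3 : (∑ i : Fin (d + 1), -c (i + s) * (p : ℤ) ^ (i : ℕ)) *
        (p : ℤ) ^ (((r.trans τ).trans (Equiv.addRight s) j : Fin (d + 1)) : ℕ) =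
        -(m * (p : ℤ) ^ (τ (r j) : ℕ)) + ((p : ℤ) ^ (d + 1) - 1) * (-t) := by
      simp only [neg_mul, Finset.sum_neg_distrib, Equiv.trans_apply, Equiv.coe_addRight]
      linarith
    ext g
    have h2 : (ψ g) ^ ((p : ℤ) ^ (d + 1) - 1) = 1 := by
      have h4 := DFunLike.congr_fun hpow g
      rw [MonoidHom.pow_apply, MonoidHom.one_apply, ← zpow_natCast,
        Nat.cast_sub (Nat.one_le_pow _ _ (Fact.out : p.Prime).pos)] at h4
      exact_mod_cast h4
    simp only [MonoidHom.inv_apply, hφ]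
    rw [h3, MonoidHom.zpow_apply, MonoidHom.zpow_apply, zpow_add, zpow_mul _ _ (-t), h2, one_zpow,
      mul_one, zpow_neg]
  · intro i l hl
    have hl' : l = Fin.last d := Fin.ext (by simpa using hl)
    subst hl'
    have h1 := hc M (Fin.last d) rfl
    have h2 := hc (i + s) (Fin.last d) rfl
    have h3 := hM (i + s)
    have h4 : Fin.last d + s = M := by rw [hs, add_sub_cancel]
    simp only [h4]
    constructor <;> linarith [h1.2, h2.1]
  · intro j
    simp [ha]
  · intro i j hij
    exact neg_le_neg (hanti (hr hij))

/-! ### Dual families -/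

/-- `e` and `e'` are dual bases of `U` for the dot product. -/
structure IsDualPair {J : Type} (U : Submodule (Fpbar p) (Fin n → Fpbar p))
    (e e' : J → Fin n → Fpbar p) : Prop where
  span_left : Submodule.span (Fpbar p) (Set.range e) = U
  span_right : Submodule.span (Fpbar p) (Set.range e') = U
  dot_self : ∀ i, e' i ⬝ᵥ e i = 1
  dot_ne : ∀ i j, i ≠ j → e' i ⬝ᵥ e j = 0

/-- Disjointness from the orthogonal makes the dot product nondegenerate on U, so the dual basis
exists inside U itself. -/
theorem exists_isDualPair {J : Type} [Finite J] {U : Submodule (Fpbar p) (Fin n → Fpbar p)}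
    (hU : Disjoint U (dotPerp U)) {e : J → Fin n → Fpbar p}
    (hli : LinearIndependent (Fpbar p) e)
    (hsp : Submodule.span (Fpbar p) (Set.range e) = U) : ∃ e', IsDualPair U e e' := by
  classical
  subst hsp
  let b := Module.Basis.span hli
  let B : LinearMap.BilinForm (Fpbar p) (Fin n → Fpbar p) := dotProductBilin (Fpbar p) (Fpbar p)
  have hB : (B.restrict (Submodule.span (Fpbar p) (Set.range e))).Nondegenerate := by
    refine LinearMap.BilinForm.nondegenerate_restrict_of_disjoint_orthogonal B ?_ hU
    intro x y h
    change y ⬝ᵥ x = 0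
    rw [dotProduct_comm]
    exact h
  let b' := LinearMap.BilinForm.dualBasis _ hB b
  have hdot : ∀ i j, (b' i : Fin n → Fpbar p) ⬝ᵥ e j = if j = i then 1 else 0 := fun i j => by
    have := LinearMap.BilinForm.apply_dualBasis_left (hB := hB) b i j
    rw [← this]
    change _ = (b' i : Fin n → Fpbar p) ⬝ᵥ (b j : Fin n → Fpbar p)
    rw [Module.Basis.span_apply]
  refine ⟨fun j => b' j, rfl, ?_, fun i => by simp [hdot], fun i j hij => by
    simp [hdot, hij.symm]⟩
  have := congrArg (Submodule.map (Submodule.subtype _)) b'.span_eq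
  rwa [Submodule.map_span, ← Set.range_comp, Submodule.map_top, Submodule.range_subtype] at this

theorem IsDualPair.eq_sum {J : Type} [Fintype J] {U : Submodule (Fpbar p) (Fin n → Fpbar p)}
    {e e' : J → Fin n → Fpbar p} (h : IsDualPair U e e') {y : Fin n → Fpbar p} (hy : y ∈ U) :
    y = ∑ j, (y ⬝ᵥ e j) • e' j := by
  rw [← h.span_right, Submodule.mem_span_range_iff_exists_fun] at hy
  obtain ⟨c, rfl⟩ := hy
  refine Finset.sum_congr rfl fun j _ => ?_
  congr 1
  rw [sum_dotProduct, Finset.sum_eq_single j, smul_dotProduct, h.dot_self, smul_eq_mul, mul_one]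
  · intro i _ hij
    rw [smul_dotProduct, h.dot_ne _ _ hij, smul_zero]
  · simp

/-- It turns filtration and triangularity conditions on the dual basis into orthogonality relations
with the original one. -/
theorem IsDualPair.mem_span_iff {J : Type} [Finite J]
    {U : Submodule (Fpbar p) (Fin n → Fpbar p)} {e e' : J → Fin n → Fpbar p}
    (h : IsDualPair U e e') (S : Set J) (y : Fin n → Fpbar p) :
    y ∈ Submodule.span (Fpbar p) (e' '' S) ↔ y ∈ U ∧ ∀ j ∉ S, y ⬝ᵥ e j = 0 := by
  have := Fintype.ofFinite J
  constructor
  · intro hy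
    refine ⟨?_, fun j hj => ?_⟩
    · rw [← h.span_right]
      exact Submodule.span_mono (Set.image_subset_range _ _) hy
    · have hle : Submodule.span (Fpbar p) (e' '' S) ≤
          dotPerp (Submodule.span (Fpbar p) {e j}) := by
        refine Submodule.span_le.2 ?_
        rintro _ ⟨i, hi, rfl⟩
        rw [SetLike.mem_coe, mem_dotPerp]
        intro x hx
        obtain ⟨a, rfl⟩ := Submodule.mem_span_singleton.1 hx
        rw [dotProduct_smul, h.dot_ne i j (by rintro rfl; exact hj hi), smul_zero]
      exact mem_dotPerp.1 (hle hy) _ (Submodule.mem_span_singleton_self _)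
  · rintro ⟨hy, h0⟩
    rw [h.eq_sum hy]
    refine Submodule.sum_mem _ fun j _ => ?_
    by_cases hj : j ∈ S
    · exact Submodule.smul_mem _ _ (Submodule.subset_span ⟨j, hj, rfl⟩)
    · rw [h0 j hj, zero_smul]
      exact zero_mem _

theorem IsDualPair.linearIndependent {J : Type} [Finite J]
    {U : Submodule (Fpbar p) (Fin n → Fpbar p)} {e e' : J → Fin n → Fpbar p}
    (h : IsDualPair U e e') : LinearIndependent (Fpbar p) e' := by
  have := Fintype.ofFinite J
  rw [Fintype.linearIndependent_iff]
  intro c hc j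
  have h1 : (∑ i, c i • e' i) ⬝ᵥ e j = 0 := by rw [hc, zero_dotProduct]
  rwa [sum_dotProduct, Finset.sum_eq_single j, smul_dotProduct, h.dot_self, smul_eq_mul,
    mul_one] at h1
  · intro i _ hij
    rw [smul_dotProduct, h.dot_ne _ _ hij, smul_zero]
  · simp

theorem dotProduct_eq_zero_of_mem_span {J : Type} {e : J → Fin n → Fpbar p} {S : Set J}
    {x y : Fin n → Fpbar p} (hx : ∀ i ∈ S, y ⬝ᵥ e i = 0)
    (hy : x ∈ Submodule.span (Fpbar p) (e '' S)) : y ⬝ᵥ x = 0 := by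
  induction hy using Submodule.span_induction with
  | mem x h => obtain ⟨i, hi, rfl⟩ := h; exact hx i hi
  | zero => exact dotProduct_zero _
  | add x z _ _ h1 h2 => rw [dotProduct_add, h1, h2, add_zero]
  | smul a x _ h1 => rw [dotProduct_smul, h1, smul_zero]

/-! ### Duality for derived tuples -/

/-- By the modular law U ∩ (U^⊥ + X) = X + (U ∩ U^⊥), and the last term vanishes. So relative
orthogonals in U form an order-reversing involution. -/
theorem inf_dotPerp_inf_dotPerp {U X : Submodule (Fpbar p) (Fin n → Fpbar p)}
    (hU : Disjoint U (dotPerp U)) (hX : X ≤ U) : U ⊓ dotPerp (U ⊓ dotPerp X) = X := by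
  rw [dotPerp_inf, dotPerp_dotPerp, inf_comm, sup_comm, sup_inf_assoc_of_le _ hX, inf_comm,
    hU.eq_bot, sup_bot_eq]

/-- After the reversal the first m blocks are the last m old ones, whose dual vectors annihilate
precisely the first k - m blocks. -/
theorem filtrationStep_dual {J J' : Type} [Finite J] {k : ℕ}
    {U : Submodule (Fpbar p) (Fin n → Fpbar p)} {e e' : J → Fin n → Fpbar p}
    (h : IsDualPair U e e') (r : J' ≃ J) (blk : J → Fin k) (m : ℕ) :
    filtrationStep (fun j => e' (r j)) (fun j => (blk (r j)).rev) m =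
      U ⊓ dotPerp (filtrationStep e blk (k - m)) := by
  have h1 : (fun j => e' (r j)) '' {j | ((blk (r j)).rev : ℕ) < m} =
      e' '' {j | k - m ≤ (blk j : ℕ)} := by
    rw [show (fun j => e' (r j)) = e' ∘ r from rfl, Set.image_comp]
    congr 1
    ext j
    simp only [Set.mem_image, Set.mem_ofPred_eq, Fin.val_rev]
    constructor
    · rintro ⟨i, hi, rfl⟩
      have := (blk (r i)).isLt
      omega
    · intro hj
      refine ⟨r.symm j, ?_, r.apply_symm_apply j⟩
      rw [r.apply_symm_apply]
      have := (blk j).isLt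
      omega
  ext y
  rw [filtrationStep, h1, h.mem_span_iff, Submodule.mem_inf, and_congr_right_iff, mem_dotPerp]
  intro _
  constructor
  · intro h0 x hx
    refine dotProduct_eq_zero_of_mem_span (fun i hi => h0 i ?_) hx
    have hi' : (blk i : ℕ) < k - m := hi
    exact fun h => absurd hi' (not_lt.2 h)
  · intro h0 j hj
    have hj' : (blk j : ℕ) < k - m := lt_of_not_ge fun h => hj h
    exact h0 _ (Submodule.subset_span ⟨j, hj', rfl⟩)

theorem IsStable.inf_dotPerp {𝔓 : Ideal (𝓞 Qbar)} {ρ : GQ →* GL (Fin n) (Fpbar p)}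
    {U X : Submodule (Fpbar p) (Fin n → Fpbar p)} (hU : IsStable 𝔓 (contragredient ρ) U)
    (hX : IsStable 𝔓 ρ X) : IsStable 𝔓 (contragredient ρ) (U ⊓ dotPerp X) := by
  rintro g hg _ ⟨y, hy, rfl⟩
  exact ⟨hU g hg ⟨y, hy.1, rfl⟩, mem_dotPerp_of_stable
    (fun x hx => hX g⁻¹ (inv_mem hg) ⟨x, hx, rfl⟩) hy.2⟩

theorem filtrationStep_le {J : Type} {k : ℕ} (e : J → Fin n → Fpbar p) (blk : J → Fin k) (m : ℕ) :
    filtrationStep e blk m ≤ Submodule.span _ (Set.range e) :=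
  Submodule.span_mono (Set.image_subset_range _ _)

theorem filtrationStep_last {J : Type} {k : ℕ} (e : J → Fin n → Fpbar p) (blk : J → Fin k) :
    filtrationStep e blk k = Submodule.span _ (Set.range e) := by
  rw [filtrationStep, ← Set.image_univ]
  congr 2
  ext j
  simp

/-- Relative orthogonals of a composition series, in reverse order, are a composition series of the
dual. A submodule between two dual steps is handled by applying simplicity to its relative
orthogonal. -/
theorem IsAdaptedBasis.dual {𝔓 : Ideal (𝓞 Qbar)} {ρ : GQ →* GL (Fin n) (Fpbar p)}
    {U : Submodule (Fpbar p) (Fin n → Fpbar p)} {J J' : Type} [Finite J] [LinearOrder J]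
    [LinearOrder J'] {k : ℕ} {e e' : J → Fin n → Fpbar p} {blk : J → Fin k}
    {φ : J → (𝔓.inertia GQ →* (Fpbar p)ˣ)} (h : IsAdaptedBasis 𝔓 ρ U e blk φ)
    (hU : Disjoint U (dotPerp U)) (hst : ∀ g, ∀ v ∈ U, galRep (contragredient ρ) g v ∈ U)
    (he : IsDualPair U e e') (r : J' ≃ J) (hr : Antitone r) :
    IsAdaptedBasis 𝔓 (contragredient ρ) U (fun j => e' (r j)) (fun j => (blk (r j)).rev)
      (fun j => (φ (r j))⁻¹) := by
  have hst' : IsStable 𝔓 (contragredient ρ) U := by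
    rintro g - _ ⟨v, hv, rfl⟩
    exact hst g v hv
  have hUρ : IsStable 𝔓 ρ U := by
    have := h.stable k le_rfl
    rwa [filtrationStep_last, h.span_eq] at this
  refine ⟨?_, ?_, ?_, ?_, ?_, ?_, ?_⟩
  · intro i j hij
    exact Fin.rev_le_rev.2 (h.monotone (hr hij))
  · exact Fin.rev_surjective.comp (h.surjective.comp r.surjective)
  · exact he.linearIndependent.comp r r.injective
  · have h1 : Set.range (fun j => e' (r j)) = Set.range e' := r.surjective.range_comp e'
    rw [h1, he.span_right]
  · intro m _
    rw [filtrationStep_dual he]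
    exact hst'.inf_dotPerp (h.stable _ (Nat.sub_le _ _))
  · intro m hm X hX h1 h2
    rw [filtrationStep_dual he] at h1 h2 ⊢
    rw [filtrationStep_dual he]
    have hk : k - m = k - (m + 1) + 1 := by omega
    have hle : ∀ m, filtrationStep e blk m ≤ U := fun m =>
      h.span_eq ▸ filtrationStep_le e blk m
    have hXU : X ≤ U := h2.trans inf_le_left
    have hY : IsStable 𝔓 ρ (U ⊓ dotPerp X) := by
      have := IsStable.inf_dotPerp (ρ := contragredient ρ)
        (by rwa [contragredient_contragredient]) hX
      rwa [contragredient_contragredient] at this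
    have hY1 : filtrationStep e blk (k - (m + 1)) ≤ U ⊓ dotPerp X := by
      rw [← inf_dotPerp_inf_dotPerp hU (hle (k - (m + 1)))]
      exact inf_le_inf_left _ (dotPerp_anti h2)
    have hY2 : U ⊓ dotPerp X ≤ filtrationStep e blk (k - (m + 1) + 1) := by
      rw [← hk, ← inf_dotPerp_inf_dotPerp hU (hle (k - m))]
      exact inf_le_inf_left _ (dotPerp_anti h1)
    rw [← inf_dotPerp_inf_dotPerp hU hXU]
    rcases h.simple (k - (m + 1)) (by omega) _ hY hY1 hY2 with h3 | h3
    · right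
      rw [h3]
    · left
      rw [h3, hk]
  · intro g j
    rw [filtrationStep_dual he, Submodule.mem_inf, mem_dotPerp]
    have hjU : e' (r j) ∈ U := he.span_right ▸ Submodule.subset_span ⟨_, rfl⟩
    refine ⟨U.sub_mem (hst _ _ hjU) (U.smul_mem _ hjU), fun x hx => ?_⟩
    have hlt := (blk (r j)).isLt
    refine dotProduct_eq_zero_of_mem_span (fun i hi => ?_) hx
    have hi' : blk i ≤ blk (r j) := by
      simp only [Set.mem_ofPred_eq, Fin.val_rev] at hi
      rw [Fin.le_def]
      omega
    have h1 := h.diagonal g⁻¹ i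
    -- The error term of g⁻¹ on e_i lies in blocks before that of i, hence strictly before that of r
    -- j, where the dual vector vanishes.
    have h2 : e' (r j) ⬝ᵥ (galRep ρ ↑(g⁻¹) (e i) - (φ i g⁻¹ : Fpbar p) • e i) = 0 := by
      refine dotProduct_eq_zero_of_mem_span (fun l hl => he.dot_ne _ _ ?_) h1
      rintro rfl
      exact absurd (Fin.lt_def.2 hl) (not_lt.2 hi')
    rw [sub_dotProduct, contragredient_dotProduct, smul_dotProduct]
    rw [dotProduct_sub, dotProduct_smul, sub_eq_zero] at h2
    rw [sub_eq_zero]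
    refine h2.trans ?_
    by_cases hij : r j = i
    · subst hij
      rw [map_inv, MonoidHom.inv_apply]
    · rw [he.dot_ne _ _ hij, smul_zero, smul_zero]

/-- In the dual basis an upper triangular action becomes lower triangular, and upper triangular
again when the basis is read backwards. -/
theorem IsDerivedLocal.dual {𝔓 : Ideal (𝓞 Qbar)} {ρ : GQ →* GL (Fin n) (Fpbar p)}
    {U : Submodule (Fpbar p) (Fin n → Fpbar p)} {J J' : Type} [Finite J] [LinearOrder J]
    [Finite J'] [LinearOrder J'] {t : J → ℤ} (h : IsDerivedLocal 𝔓 ρ U t)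
    (hU : Disjoint U (dotPerp U)) (hst : ∀ g, ∀ v ∈ U, galRep (contragredient ρ) g v ∈ U)
    (r : J' ≃ J) (hr : Antitone r) :
    IsDerivedLocal 𝔓 (contragredient ρ) U (fun j => -t (r j)) := by
  obtain ⟨k, e, blk, φ, a, σ, had, hsimp, hord, htri, rfl⟩ := h
  obtain ⟨e', he⟩ := exists_isDualPair hU had.linearIndependent had.span_eq
  have hlt : ∀ i j, i < j ↔ r j < r i := fun i j =>
    ((hr.strictAnti_of_injective r.injective).lt_iff_gt).symm
  -- The shuffle of the dual basis is σ conjugated by the reversal r.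
  refine ⟨k, fun j => e' (r j), fun j => (blk (r j)).rev, fun j => (φ (r j))⁻¹,
    fun j => -a (r j), (r.trans σ).trans r.symm, had.dual hU hst he r hr, ?_, ?_, ?_, ?_⟩
  · intro m
    have hne : Nonempty {j // blk j = m.rev} := by
      obtain ⟨j, hj⟩ := had.surjective m.rev
      exact ⟨⟨j, hj⟩⟩
    exact (hsimp m.rev).dual
      (r.subtypeEquiv (p := fun j => (blk (r j)).rev = m) (q := fun j => blk j = m.rev)
        fun j => Fin.rev_eq_iff)
      (fun i j hij => hr hij)
  · intro i j hij hblk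
    have := hord _ _ ((hlt i j).1 hij) (Fin.rev_injective hblk).symm
    simpa [hlt] using this
  · intro g j
    have h1 : (fun i => e' (r (((r.trans σ).trans r.symm) i))) '' {i | i ≤ j} =
        e' '' (σ '' {i | r j ≤ i}) := by
      rw [← Set.image_comp]
      ext v
      constructor
      · rintro ⟨i, hi, rfl⟩
        exact ⟨r i, hr hi, by simp⟩
      · rintro ⟨i, hi, rfl⟩
        refine ⟨r.symm i, ?_, by simp⟩
        rw [Set.mem_ofPred_eq, ← not_lt, hlt, not_lt, r.apply_symm_apply]
        exact hi
    rw [h1, he.mem_span_iff]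
    refine ⟨hst _ _ (he.span_right ▸ Submodule.subset_span ⟨_, rfl⟩), fun i hi => ?_⟩
    obtain ⟨l, rfl⟩ := σ.surjective i
    have hl : l < r j := by
      by_contra h
      exact hi ⟨l, not_lt.1 h, rfl⟩
    rw [contragredient_dotProduct]
    have h2 := htri g⁻¹ l
    rw [show (fun i => e (σ i)) = e ∘ σ from rfl, Set.image_comp] at h2
    refine dotProduct_eq_zero_of_mem_span (fun i hi => ?_) h2
    obtain ⟨l', hl', rfl⟩ := hi
    refine he.dot_ne _ _ ?_
    simp only [Equiv.trans_apply, Equiv.apply_symm_apply]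
    intro h
    exact absurd (σ.injective h) (lt_of_le_of_lt hl' hl).ne'
  · funext j
    simp

/-! ### Conjugation -/

/-- The linear automorphism of column vectors given by an element of `GL_n`. -/
def vecEquiv (M : GL (Fin n) (Fpbar p)) : (Fin n → Fpbar p) ≃ₗ[Fpbar p] (Fin n → Fpbar p) :=
  Matrix.GeneralLinearGroup.toLin M |> LinearMap.GeneralLinearGroup.generalLinearEquiv _ _

theorem vecEquiv_apply (M : GL (Fin n) (Fpbar p)) (v : Fin n → Fpbar p) :
    vecEquiv M v = M.val *ᵥ v := rfl

theorem galRep_conjBy (M : GL (Fin n) (Fpbar p)) (ρ : GQ →* GL (Fin n) (Fpbar p)) (g : GQ)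
    (v : Fin n → Fpbar p) : galRep (conjBy M ρ) g (vecEquiv M v) = vecEquiv M (galRep ρ g v) := by
  rw [galRep_apply, galRep_apply, vecEquiv_apply, vecEquiv_apply, Matrix.mulVec_mulVec,
    Matrix.mulVec_mulVec, conjBy_apply, ← Units.val_mul, ← Units.val_mul, inv_mul_cancel_right]

theorem IsStable.map_conjBy {𝔓 : Ideal (𝓞 Qbar)} {ρ : GQ →* GL (Fin n) (Fpbar p)}
    {X : Submodule (Fpbar p) (Fin n → Fpbar p)} (M : GL (Fin n) (Fpbar p)) (h : IsStable 𝔓 ρ X) :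
    IsStable 𝔓 (conjBy M ρ) (X.map (vecEquiv M).toLinearMap) := by
  rintro g hg _ ⟨_, ⟨v, hv, rfl⟩, rfl⟩
  exact ⟨_, h g hg ⟨v, hv, rfl⟩, (galRep_conjBy M ρ g v).symm⟩

theorem filtrationStep_map {J : Type} {k : ℕ} (e : J → Fin n → Fpbar p) (blk : J → Fin k) (r : ℕ)
    (M : GL (Fin n) (Fpbar p)) :
    filtrationStep (fun j => vecEquiv M (e j)) blk r =
      (filtrationStep e blk r).map (vecEquiv M).toLinearMap := by
  rw [filtrationStep, filtrationStep, Submodule.map_span, ← Set.image_comp]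
  rfl

theorem conjBy_inv_conjBy (M : GL (Fin n) (Fpbar p)) (ρ : GQ →* GL (Fin n) (Fpbar p)) :
    conjBy M⁻¹ (conjBy M ρ) = ρ := by
  rw [conjBy_conjBy, inv_mul_cancel]
  ext1 g
  rw [conjBy_apply, one_mul, inv_one, mul_one]

theorem map_vecEquiv_inv_map (M : GL (Fin n) (Fpbar p))
    (X : Submodule (Fpbar p) (Fin n → Fpbar p)) :
    (X.map (vecEquiv M⁻¹).toLinearMap).map (vecEquiv M).toLinearMap = X := by
  rw [← Submodule.map_comp]
  convert Submodule.map_id X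
  refine LinearMap.ext fun v => ?_
  change M.val *ᵥ (M⁻¹.val *ᵥ v) = v
  rw [Matrix.mulVec_mulVec, ← Units.val_mul, mul_inv_cancel, Units.val_one, Matrix.one_mulVec]

theorem IsDerivedLocal.conjBy {𝔓 : Ideal (𝓞 Qbar)} {ρ : GQ →* GL (Fin n) (Fpbar p)}
    {U : Submodule (Fpbar p) (Fin n → Fpbar p)} {J : Type} [Finite J] [LinearOrder J] {t : J → ℤ}
    (h : IsDerivedLocal 𝔓 ρ U t) (M : GL (Fin n) (Fpbar p)) :
    IsDerivedLocal 𝔓 (conjBy M ρ) (U.map (vecEquiv M).toLinearMap) t := by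
  obtain ⟨k, e, blk, φ, a, σ, had, hsimp, hord, htri, rfl⟩ := h
  refine ⟨k, fun j => vecEquiv M (e j), blk, φ, a, σ,
    ⟨had.monotone, had.surjective, ?_, ?_, ?_, ?_, ?_⟩, hsimp, hord, ?_, rfl⟩
  · exact had.linearIndependent.map' _ (vecEquiv M).ker
  · rw [← had.span_eq, Submodule.map_span, ← Set.range_comp]
    rfl
  · intro r hr
    rw [filtrationStep_map]
    exact (had.stable r hr).map_conjBy M
  · intro r hr X hX h1 h2
    rw [filtrationStep_map] at h1 h2 ⊢
    rw [filtrationStep_map]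
    have hX' := hX.map_conjBy M⁻¹
    rw [conjBy_inv_conjBy] at hX'
    have hinj : Function.Injective (vecEquiv M) := (vecEquiv M).injective
    rw [← map_vecEquiv_inv_map M X] at h1 h2 ⊢
    rw [Submodule.map_le_map_iff_of_injective hinj] at h1 h2
    rcases had.simple r hr _ hX' h1 h2 with h3 | h3
    · left; rw [h3]
    · right; rw [h3]
  · intro g j
    rw [filtrationStep_map, galRep_conjBy, ← map_smul, ← map_sub]
    exact ⟨_, had.diagonal g j, rfl⟩
  · intro g j
    rw [galRep_conjBy, show (fun i => vecEquiv M (e (σ i))) =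
      (vecEquiv M).toLinearMap ∘ (fun i => e (σ i)) from rfl, Set.image_comp, ← Submodule.map_span]
    exact ⟨_, htri g j, rfl⟩

/-! ### Tuples derived from the contragredient -/

/-- Coordinate subspaces are nondegenerate for the dot product, which lets D_c serve as its own dual
space. -/
theorem disjoint_leviBlock (s : Setoid (Fin n)) (c : Quotient s) :
    Disjoint (leviBlock (p := p) s c) (dotPerp (leviBlock s c)) := by
  rw [Submodule.disjoint_def]
  intro v hv hv'
  ext j
  by_cases hj : Quotient.mk s j = c
  · have := mem_dotPerp.1 hv' (Pi.single j 1) (Submodule.subset_span ⟨j, hj, rfl⟩)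
    simpa using this
  · exact mem_leviBlock.1 hv j hj

/-- The local duality reverses the order inside each D_c. Conjugation by w₀ carries D_c to the block
of the reversed positions, so that increasing positions again match the order of the tuple. -/
theorem IsDerivedWithLevi.dual {𝔓 : Ideal (𝓞 Qbar)} {ρ : GQ →* GL (Fin n) (Fpbar p)}
    {s : Setoid (Fin n)} {b : Fin n → ℤ} (h : IsDerivedWithLevi 𝔓 ρ s b)
    (hρ : ∀ g, ρ g ∈ standardLevi s) :
    IsDerivedWithLevi 𝔓 (conjBy (revGL n _) (contragredient ρ)) (s.comap Fin.rev)
      (fun j => -b j.rev) := by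
  intro c
  induction c using Quotient.inductionOn with
  | h i =>
  have hiff : ∀ j : Fin n, Quotient.mk (s.comap Fin.rev) j = Quotient.mk (s.comap Fin.rev) i ↔
      Quotient.mk s j.rev = Quotient.mk s i.rev := fun j => by
    rw [Quotient.eq, Quotient.eq]
    rfl
  have h1 := h (Quotient.mk s i.rev)
  have hst : ∀ g, ∀ v ∈ leviBlock (p := p) s (Quotient.mk s i.rev),
      galRep (contragredient ρ) g v ∈ leviBlock s (Quotient.mk s i.rev) := by
    intro g v hv
    rw [← transposeInv_mem_standardLevi (hρ g) (Quotient.mk s i.rev)]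
    exact ⟨v, hv, rfl⟩
  have h2 := h1.dual (disjoint_leviBlock s _) hst
    (Fin.revPerm.subtypeEquiv
      (p := fun j => Quotient.mk (s.comap Fin.rev) j = Quotient.mk (s.comap Fin.rev) i) hiff)
    (fun x y hxy => Fin.rev_le_rev.2 hxy)
  have h3 := h2.conjBy (revGL n _)
  have h4 : (leviBlock (p := p) s (Quotient.mk s i.rev)).map (vecEquiv (revGL n _)).toLinearMap =
      leviBlock (s.comap Fin.rev) (Quotient.mk (s.comap Fin.rev) i) := by
    rw [leviBlock, Submodule.map_span, leviBlock]
    congr 1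
    ext v
    have hsingle : ∀ j : Fin n, vecEquiv (revGL n (Fpbar p)) (Pi.single j 1) =
        Pi.single j.rev 1 := fun j => by
      rw [vecEquiv_apply, Matrix.mulVec_single_one]
      ext l
      simp [revGL, revMatrix, Matrix.one_apply, Pi.single_apply, Fin.rev_eq_iff]
    constructor
    · rintro ⟨_, ⟨j, hj, rfl⟩, rfl⟩
      refine ⟨j.rev, ?_, (hsingle j).symm⟩
      rw [Set.mem_ofPred_eq, hiff, Fin.rev_rev]
      exact hj
    · rintro ⟨j, hj, rfl⟩
      refine ⟨_, ⟨j.rev, (hiff j).1 hj, rfl⟩, ?_⟩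
      exact (hsingle _).trans (by rw [Fin.rev_rev])
  rw [h4] at h3
  exact h3

theorem IsDerivedWithLevi.contragredient {𝔓 : Ideal (𝓞 Qbar)} {ρ : GQ →* GL (Fin n) (Fpbar p)}
    {M : GL (Fin n) (Fpbar p)} {s : Setoid (Fin n)} {b : Fin n → ℤ}
    (h : IsDerivedWithLevi 𝔓 (conjBy M ρ) s b) (hρ : ∀ g, conjBy M ρ g ∈ standardLevi s) :
    IsDerivedWithLevi 𝔓 (conjBy (revGL n _ * transposeInv _ M) (contragredient ρ))
      (s.comap Fin.rev) (fun j => -b j.rev) := by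
  rw [← conjBy_conjBy, ← contragredient_conjBy]
  exact h.dual hρ

theorem IsDerived.contragredient {𝔓 : Ideal (𝓞 Qbar)} {ρ : GQ →* GL (Fin n) (Fpbar p)}
    {b : Fin n → ℤ} (h : IsDerived 𝔓 ρ b) :
    IsDerived 𝔓 (contragredient ρ) (fun j => -b j.rev) := by
  obtain ⟨M, s, hM, hmin, hb⟩ := h
  exact ⟨_, _, fun g => conjBy_contragredient_mem_standardLevi (hM g), hmin.contragredient,
    hb.contragredient hM⟩

end Derived

end GaloisHecke

/-! ### Ramification groups of a prime of a Dedekind domain -/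

namespace GaloisHecke

section Ramification

variable {R : Type*} [CommRing R] {G : Type*} [Group G] [MulSemiringAction G R] {P : Ideal R}

theorem smul_mem_pow_of_mem_inertia {σ : G} (hσ : σ ∈ P.inertia G) {x : R} {k : ℕ}
    (hx : x ∈ P ^ k) : σ • x ∈ P ^ k := by
  have h : P ≤ P.comap (MulSemiringAction.toRingHom G R σ) := fun y hy => by
    have h1 : σ • y - y ∈ P := hσ y
    exact (P.sub_mem_iff_left hy).1 h1
  exact Ideal.le_comap_pow (MulSemiringAction.toRingHom G R σ) k (Ideal.pow_right_mono h k hx)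

theorem inertia_pow_le {i j : ℕ} (h : i ≤ j) : (P ^ j).inertia G ≤ (P ^ i).inertia G :=
  fun _ hσ x => Ideal.pow_le_pow_right h (hσ x)

theorem inertia_pow_succ_le (i : ℕ) : (P ^ (i + 1)).inertia G ≤ P.inertia G := fun _ hσ x =>
  Ideal.pow_le_self (Nat.succ_ne_zero i) (hσ x)

/-- Induction along products with σ(ab) - ab = (σa - a)σb + a(σb - b): the operator σ - 1 raises the
order at P by i. -/
theorem smul_sub_self_mem_pow {σ : G} {i : ℕ} (hσ : σ ∈ (P ^ (i + 1)).inertia G) (k : ℕ) {x : R}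
    (hx : x ∈ P ^ (k + 1)) : σ • x - x ∈ P ^ (k + 1 + i) := by
  induction k generalizing x with
  | zero => simpa [add_comm] using hσ x
  | succ k ih =>
    rw [pow_succ] at hx
    induction hx using Submodule.mul_induction_on' with
    | mem_mul_mem a ha b hb =>
      have h1 : σ • (a * b) - a * b = (σ • a - a) * (σ • b) + a * (σ • b - b) := by
        rw [smul_mul']; ring
      rw [h1]
      refine Ideal.add_mem _ ?_ ?_
      · have hb' : σ • b ∈ P := by
          simpa using smul_mem_pow_of_mem_inertia (inertia_pow_succ_le i hσ) (k := 1)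
            (by simpa using hb)
        rw [show k + 1 + 1 + i = k + 1 + i + 1 by omega, pow_succ]
        exact Ideal.mul_mem_mul (ih ha) hb'
      · rw [show k + 1 + 1 + i = (k + 1) + (i + 1) by omega, pow_add]
        exact Ideal.mul_mem_mul ha (hσ b)
    | add x _ y _ h1 h2 =>
      rw [smul_add, add_sub_add_comm]
      exact Ideal.add_mem _ h1 h2

/-- For i ≥ 1, σ^m x - x is m(σx - x) up to P^(i+2), because applying σ - 1 twice gains 2i + 1 ≥ i +
2; with m = q the factor q gives one more power of P. -/
theorem pow_mem_inertia_pow_succ {σ : G} {i q : ℕ} (hi : 1 ≤ i) (hq : (q : R) ∈ P)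
    (hσ : σ ∈ (P ^ (i + 1)).inertia G) : σ ^ q ∈ (P ^ (i + 2)).inertia G := by
  intro x
  have key : ∀ m : ℕ, (σ ^ m) • x - x - m * (σ • x - x) ∈ P ^ (i + 2) := by
    intro m
    induction m with
    | zero => simp
    | succ m ih =>
      have h1 : (σ ^ m) • x - x ∈ P ^ (i + 1) := (pow_mem hσ m) x
      have h2 := Ideal.pow_le_pow_right (show i + 2 ≤ i + 1 + i by omega)
        (smul_sub_self_mem_pow hσ i h1)
      have h3 : (σ ^ (m + 1)) • x - x - ((m + 1 : ℕ) : R) * (σ • x - x) =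
          ((σ ^ m) • x - x - m * (σ • x - x)) +
          (σ • ((σ ^ m) • x - x) - ((σ ^ m) • x - x)) := by
        rw [pow_succ', mul_smul, smul_sub]
        push_cast
        ring
      rw [h3]
      exact Ideal.add_mem _ ih h2
  have h1 : (q : R) * (σ • x - x) ∈ P ^ (i + 2) := by
    rw [pow_succ']
    exact Ideal.mul_mem_mul hq (hσ x)
  have := Ideal.add_mem _ (key q) h1
  rwa [sub_add_cancel] at this

theorem pow_pow_mem_inertia {σ : G} {q : ℕ} (hq : (q : R) ∈ P) (hσ : σ ∈ (P ^ 2).inertia G)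
    (m : ℕ) : σ ^ q ^ m ∈ (P ^ (m + 2)).inertia G := by
  induction m with
  | zero => simpa using hσ
  | succ m ih =>
    rw [pow_succ q, pow_mul]
    exact pow_mem_inertia_pow_succ (by omega) hq ih

/-- Krull's intersection theorem excludes each σ ≠ 1 from some ramification group; finiteness of G
makes the bound uniform. -/
theorem exists_inertia_pow_eq_bot [IsDomain R] [IsNoetherianRing R] [Finite G] [FaithfulSMul G R]
    (hP : P ≠ ⊤) : ∃ k, (P ^ k).inertia G = ⊥ := by
  have h1 : ∀ σ : G, ∃ k, σ ≠ 1 → σ ∉ (P ^ k).inertia G := by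
    intro σ
    by_contra! h
    refine (h 0).1 (FaithfulSMul.eq_of_smul_eq_smul (α := R) fun x => ?_)
    rw [one_smul, ← sub_eq_zero, ← Ideal.mem_bot, ← Ideal.iInf_pow_eq_bot_of_isDomain P hP,
      Ideal.mem_iInf]
    exact fun k => (h k).2 x
  choose k hk using h1
  obtain ⟨K, hK⟩ := (Set.finite_range k).bddAbove
  refine ⟨K, (Subgroup.eq_bot_iff_forall _).2 fun σ hσ => ?_⟩
  by_contra h
  exact hk σ h (inertia_pow_le (hK ⟨σ, rfl⟩) hσ)

/-- Wild inertia is a q-group. For q ≠ p its image can therefore be averaged over in characteristic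
p. -/
theorem exists_pow_pow_eq_one [IsDomain R] [IsNoetherianRing R] [Finite G] [FaithfulSMul G R]
    (hP : P ≠ ⊤) {q : ℕ} (hq : (q : R) ∈ P) :
    ∃ m, ∀ σ ∈ (P ^ 2).inertia G, σ ^ q ^ m = 1 := by
  obtain ⟨k, hk⟩ := exists_inertia_pow_eq_bot (G := G) hP
  refine ⟨k, fun σ hσ => ?_⟩
  rw [← Subgroup.mem_bot, ← hk]
  exact inertia_pow_le (by omega) (pow_pow_mem_inertia hq hσ k)

theorem conj_mem_inertia_pow {σ τ : G} {k : ℕ} (hσ : σ ∈ P.inertia G)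
    (hτ : τ ∈ (P ^ k).inertia G) : σ * τ * σ⁻¹ ∈ (P ^ k).inertia G := by
  intro x
  have h1 : (σ * τ * σ⁻¹) • x - x = σ • (τ • (σ⁻¹ • x) - σ⁻¹ • x) := by
    rw [smul_sub, mul_smul, mul_smul, smul_inv_smul]
  rw [h1]
  exact smul_mem_pow_of_mem_inertia hσ (hτ _)

/-- An element of the inertia group that fixes a uniformizer up to second order lies in the wild
inertia group. -/
theorem mem_inertia_sq [IsDedekindDomain R] [P.IsPrime] [Finite (R ⧸ P)] (hP : P ≠ ⊥) {π : R}
    (hπ : π ∈ P) (hπ' : π ∉ P ^ 2) {σ : G} (hσ : σ ∈ P.inertia G) (h : σ • π - π ∈ P ^ 2) :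
    σ ∈ (P ^ 2).inertia G := by
  intro x
  change σ • x - x ∈ P ^ 2
  have hσx : ∀ y, σ • y - y ∈ P := hσ
  have := Ideal.IsPrime.isMaximal (inferInstanceAs P.IsPrime) hP
  let _ := Ideal.Quotient.field P
  have := Fintype.ofFinite (R ⧸ P)
  set Q := Fintype.card (R ⧸ P)
  have hQ : (Q : R) ∈ P := by
    rw [← Ideal.Quotient.eq_zero_iff_mem, map_natCast]
    exact Nat.cast_card_eq_zero _
  -- Write x as x^Q plus an element of P. The automorphism σ fixes x^Q modulo P² since Q ∈ P, and it
  -- fixes P modulo P² since it fixes the uniformizer there.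
  have hxQ : x - x ^ Q ∈ P := by
    rw [← Ideal.Quotient.eq, map_pow, FiniteField.pow_card]
  have h1 : σ • x ^ Q - x ^ Q ∈ P ^ 2 := by
    obtain ⟨k, hk⟩ := Polynomial.powAddExpansion x (σ • x - x) Q
    rw [add_sub_cancel] at hk
    rw [smul_pow', hk, add_assoc, add_sub_cancel_left]
    refine Ideal.add_mem _ ?_ (Ideal.mul_mem_left _ _ (Ideal.pow_mem_pow (hσx x) 2))
    rw [pow_two, mul_assoc, mul_comm (x ^ _), ← mul_assoc]
    exact Ideal.mul_mem_right _ _ (Ideal.mul_mem_mul hQ (hσx x))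
  obtain ⟨d, e, he, hde⟩ := Ideal.exists_mul_add_mem_pow_succ (i := 1) hP π (x - x ^ Q)
    (by simpa using hπ) hπ' (by simpa using hxQ)
  have h2 : σ • (x - x ^ Q) - (x - x ^ Q) ∈ P ^ 2 := by
    have h3 : σ • (x - x ^ Q) - (x - x ^ Q) =
        (σ • π - π) * (σ • d) + π * (σ • d - d) + (σ • e - e) := by
      rw [← hde, smul_add, smul_mul']
      ring
    rw [h3]
    refine Ideal.add_mem _ (Ideal.add_mem _ (Ideal.mul_mem_right _ _ h) ?_)
      (Ideal.sub_mem _ (smul_mem_pow_of_mem_inertia hσ he) he)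
    rw [pow_two]
    exact Ideal.mul_mem_mul hπ (hσx d)
  have h3 : σ • x - x = (σ • (x - x ^ Q) - (x - x ^ Q)) + (σ • x ^ Q - x ^ Q) := by
    rw [smul_sub]
    ring
  rw [h3]
  exact Ideal.add_mem _ h2 h1

/-- Tame inertia is cyclic. -/
theorem exists_tame_generator [IsDedekindDomain R] [P.IsPrime] [Finite (R ⧸ P)] (hP : P ≠ ⊥) :
    ∃ t ∈ P.inertia G, ∀ σ ∈ P.inertia G, ∃ j : ℤ, ∃ τ ∈ (P ^ 2).inertia G, σ = t ^ j * τ := by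
  have hPtop : P ≠ ⊤ := Ideal.IsPrime.ne_top inferInstance
  obtain ⟨π, hπ, hπ'⟩ := Ideal.exists_mem_pow_notMem_pow_succ P hP hPtop 1
  have hπ1 : π ∈ P := by simpa using hπ
  have h1 : ∀ σ : P.inertia G, ∃ d : R, σ.val • π - π * d ∈ P ^ 2 := by
    intro σ
    obtain ⟨d, e, he, hde⟩ := Ideal.exists_mul_add_mem_pow_succ (i := 1) hP π (σ.val • π) hπ hπ'
      (smul_mem_pow_of_mem_inertia σ.prop hπ)
    exact ⟨d, by rwa [← hde, add_sub_cancel_left]⟩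
  choose d hd using h1
  have huniq : ∀ (σ : P.inertia G) (d' : R), σ.val • π - π * d' ∈ P ^ 2 →
      Ideal.Quotient.mk P (d σ) = Ideal.Quotient.mk P d' := by
    intro σ d' h
    rw [Ideal.Quotient.eq]
    refine Ideal.mul_add_mem_pow_succ_unique (i := 1) hP π (d σ) d' 0 0 hπ' (zero_mem _)
      (zero_mem _) ?_
    have := Ideal.sub_mem _ h (hd σ)
    convert this using 1
    ring
  -- The tame character σ ↦ σ(π)/π mod P, multiplicative because inertia acts trivially on R/P. Its
  -- image is a finite subgroup of the units of a domain, hence cyclic, and its kernel is wild by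
  -- `mem_inertia_sq`.
  let χ : P.inertia G →* R ⧸ P :=
    { toFun σ := Ideal.Quotient.mk P (d σ)
      map_one' := by
        rw [huniq 1 1 (by simp), map_one]
      map_mul' σ τ := by
        rw [← map_mul]
        refine huniq _ _ ?_
        have h2 : (σ * τ).val • π - π * (d σ * d τ) =
            σ.val • (τ.val • π - π * d τ) + (σ.val • π - π * d σ) * (σ.val • d τ) +
            π * (σ.val • d τ - d τ) * d σ := by
          rw [Subgroup.coe_mul, mul_smul, smul_sub, smul_mul']
          ring
        rw [h2]
        refine Ideal.add_mem _ (Ideal.add_mem _ (smul_mem_pow_of_mem_inertia σ.prop (hd τ))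
          (Ideal.mul_mem_right _ _ (hd σ))) (Ideal.mul_mem_right _ _ ?_)
        rw [pow_two]
        exact Ideal.mul_mem_mul hπ1 (σ.prop _) }
  obtain ⟨⟨_, t, rfl⟩, ht⟩ := IsCyclic.exists_generator (α := χ.toHomUnits.range)
  refine ⟨t, t.prop, fun σ hσ => ?_⟩
  obtain ⟨j, hj⟩ := Subgroup.mem_zpowers_iff.1 (ht ⟨_, ⟨σ, hσ⟩, rfl⟩)
  refine ⟨j, (t ^ j)⁻¹ * σ, ?_, by simp⟩
  have hj' : χ.toHomUnits t ^ j = χ.toHomUnits ⟨σ, hσ⟩ := congrArg Subtype.val hj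
  have h2 : χ ((t ^ j)⁻¹ * ⟨σ, hσ⟩) = 1 := by
    rw [← MonoidHom.coe_toHomUnits, map_mul, map_inv, map_zpow, hj', inv_mul_cancel, Units.val_one]
  refine mem_inertia_sq hP hπ1 hπ' (σ := (((t ^ j)⁻¹ * ⟨σ, hσ⟩ : P.inertia G) : G))
    (Subtype.prop _) ?_
  have h3 : d ((t ^ j)⁻¹ * ⟨σ, hσ⟩) - 1 ∈ P := by
    rw [← Ideal.Quotient.eq]
    exact h2.trans (map_one _).symm
  have h4 := Ideal.add_mem _ (hd ((t ^ j)⁻¹ * ⟨σ, hσ⟩))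
    (show π * (d ((t ^ j)⁻¹ * ⟨σ, hσ⟩) - 1) ∈ P ^ 2 by
      rw [pow_two]; exact Ideal.mul_mem_mul hπ1 h3)
  convert h4 using 1
  ring

end Ramification

/-! ### Fixed vectors of a representation and of its contragredient -/

section Fixed

variable {p : ℕ} [Fact p.Prime] {n : ℕ}

/-- The average of a finite group of matrices. -/
def matrixAverage (H : Subgroup (GL (Fin n) (Fpbar p))) [Fintype H] :
    Matrix (Fin n) (Fin n) (Fpbar p) :=
  (Fintype.card H : Fpbar p)⁻¹ • ∑ h : H, h.val.val

variable {H : Subgroup (GL (Fin n) (Fpbar p))} [Fintype H]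

theorem mul_matrixAverage {h : GL (Fin n) (Fpbar p)} (hh : h ∈ H) :
    h.val * matrixAverage H = matrixAverage H := by
  rw [matrixAverage, Matrix.mul_smul, Finset.mul_sum]
  congr 1
  exact Fintype.sum_equiv (Equiv.mulLeft ⟨h, hh⟩) _ _ fun x => rfl

theorem matrixAverage_mul {h : GL (Fin n) (Fpbar p)} (hh : h ∈ H) :
    matrixAverage H * h.val = matrixAverage H := by
  rw [matrixAverage, Matrix.smul_mul, Finset.sum_mul]
  congr 1
  exact Fintype.sum_equiv (Equiv.mulRight ⟨h, hh⟩) _ _ fun x => rfl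

theorem matrixAverage_comm {T : GL (Fin n) (Fpbar p)} (hT : ∀ h ∈ H, T * h * T⁻¹ ∈ H) :
    T.val * matrixAverage H = matrixAverage H * T.val := by
  rw [matrixAverage, Matrix.smul_mul, Finset.sum_mul, Matrix.mul_smul, Finset.mul_sum]
  congr 1
  let f : H → H := fun h => ⟨T * h * T⁻¹, hT h h.prop⟩
  have hf : Function.Injective f := fun a b hab => by
    have := congrArg Subtype.val hab
    exact Subtype.ext (mul_left_cancel (mul_right_cancel this))
  refine Fintype.sum_bijective f hf.bijective_of_finite _ _ fun h => ?_
  rw [← Units.val_mul, ← Units.val_mul, inv_mul_cancel_right]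

theorem matrixAverage_mulVec_eq_iff (hcard : (Fintype.card H : Fpbar p) ≠ 0)
    {v : Fin n → Fpbar p} :
    matrixAverage H *ᵥ v = v ↔ ∀ h ∈ H, h.val *ᵥ v = v := by
  constructor
  · intro hv h hh
    rw [← hv, Matrix.mulVec_mulVec, mul_matrixAverage hh]
  · intro hv
    rw [matrixAverage, Matrix.smul_mulVec, Matrix.sum_mulVec,
      Finset.sum_congr rfl fun h _ => hv h.val h.prop, Finset.sum_const, Finset.card_univ,
      ← Nat.cast_smul_eq_nsmul (Fpbar p), smul_smul, inv_mul_cancel₀ hcard, one_smul]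

theorem matrixAverage_transpose_mulVec_eq_iff (hcard : (Fintype.card H : Fpbar p) ≠ 0)
    {v : Fin n → Fpbar p} :
    (matrixAverage H)ᵀ *ᵥ v = v ↔ ∀ h ∈ H, h.valᵀ *ᵥ v = v := by
  constructor
  · intro hv h hh
    rw [← hv, Matrix.mulVec_mulVec, ← Matrix.transpose_mul, matrixAverage_mul hh]
  · intro hv
    rw [matrixAverage, Matrix.transpose_smul, Matrix.transpose_sum, Matrix.smul_mulVec,
      Matrix.sum_mulVec,
      Finset.sum_congr rfl fun h _ => hv h.val h.prop, Finset.sum_const, Finset.card_univ,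
      ← Nat.cast_smul_eq_nsmul (Fpbar p), smul_smul, inv_mul_cancel₀ hcard, one_smul]

theorem matrixAverage_mul_self (hcard : (Fintype.card H : Fpbar p) ≠ 0) :
    matrixAverage H * matrixAverage H = matrixAverage H := by
  refine Matrix.ext_of_mulVec_single fun i => ?_
  rw [← Matrix.mulVec_mulVec, matrixAverage_mulVec_eq_iff hcard]
  intro h hh
  rw [Matrix.mulVec_mulVec, mul_matrixAverage hh]

/-- A single matrix whose kernel is the intersection of two fixed spaces; its rank can then be
compared with that of its transpose. -/
theorem mulVec_eq_zero_iff_of_idempotent {E T : Matrix (Fin n) (Fin n) (Fpbar p)}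
    (hE : E * E = E) (hT : T * E = E * T) {v : Fin n → Fpbar p} :
    ((T - 1) * E + (1 - E)) *ᵥ v = 0 ↔ E *ᵥ v = v ∧ T *ᵥ v = v := by
  constructor
  · intro h
    have h1 : E * ((T - 1) * E + (1 - E)) = (T - 1) * E := by
      rw [mul_add, ← mul_assoc, mul_sub, mul_one, ← hT, mul_sub, hE, mul_one, sub_self, add_zero,
        sub_mul, mul_assoc, hE, sub_mul, one_mul]
    have h2 : ((T - 1) * E) *ᵥ v = 0 := by
      rw [← h1, ← Matrix.mulVec_mulVec, h, Matrix.mulVec_zero]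
    rw [Matrix.add_mulVec, h2, zero_add, Matrix.sub_mulVec, Matrix.one_mulVec, sub_eq_zero] at h
    refine ⟨h.symm, ?_⟩
    rwa [← Matrix.mulVec_mulVec, ← h, Matrix.sub_mulVec, Matrix.one_mulVec, sub_eq_zero] at h2
  · rintro ⟨h1, h2⟩
    rw [Matrix.add_mulVec, ← Matrix.mulVec_mulVec, h1, Matrix.sub_mulVec, Matrix.sub_mulVec, h1,
      h2, Matrix.one_mulVec, sub_self, zero_add]

theorem mem_fixedBy {ρ : GQ →* GL (Fin n) (Fpbar p)} {S : Set GQ} {v : Fin n → Fpbar p} :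
    v ∈ fixedBy ρ S ↔ ∀ g ∈ S, (ρ g).val *ᵥ v = v := by
  simp only [fixedBy, Submodule.mem_iInf, LinearMap.mem_ker, LinearMap.sub_apply, galRep_apply,
    Module.End.one_apply, sub_eq_zero]

theorem inv_mulVec_eq_iff {A : GL (Fin n) (Fpbar p)} {v : Fin n → Fpbar p} :
    (A⁻¹).val *ᵥ v = v ↔ A.val *ᵥ v = v := by
  constructor <;> intro h
  · conv_lhs => rw [← h]
    rw [Matrix.mulVec_mulVec, ← Units.val_mul, mul_inv_cancel, Units.val_one, Matrix.one_mulVec]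
  · conv_lhs => rw [← h]
    rw [Matrix.mulVec_mulVec, ← Units.val_mul, inv_mul_cancel, Units.val_one, Matrix.one_mulVec]

theorem zpow_mulVec_eq {A : GL (Fin n) (Fpbar p)} {v : Fin n → Fpbar p} (h : A.val *ᵥ v = v)
    (j : ℤ) : (A ^ j).val *ᵥ v = v := by
  have hmul : ∀ {A B : GL (Fin n) (Fpbar p)}, A.val *ᵥ v = v → B.val *ᵥ v = v →
      (A * B).val *ᵥ v = v := fun hA hB => by
    rw [Units.val_mul, ← Matrix.mulVec_mulVec, hB, hA]
  have hpow : ∀ m : ℕ, (A ^ m).val *ᵥ v = v := fun m => by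
    induction m with
    | zero => simp
    | succ m ih => rw [pow_succ]; exact hmul ih h
  cases j with
  | ofNat m => rw [Int.ofNat_eq_natCast, zpow_natCast]; exact hpow m
  | negSucc m => rw [zpow_negSucc, inv_mulVec_eq_iff]; exact hpow _

/-- Here S acts through a group generated by T and a subgroup H of order prime to p that T
normalizes. The order of T may be divisible by p, so only H is averaged. Fixed vectors form the
kernel of C for ρ and of ᵗC for ρ^∨, and the two ranks agree. -/
theorem finrank_fixedBy_contragredient {ρ : GQ →* GL (Fin n) (Fpbar p)} {S : Set GQ}
    (hcard : (Fintype.card H : Fpbar p) ≠ 0) {T : GL (Fin n) (Fpbar p)}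
    (hT : ∀ h ∈ H, T * h * T⁻¹ ∈ H) (hTS : ∃ g ∈ S, ρ g = T) (hH : ∀ h ∈ H, ∃ g ∈ S, ρ g = h)
    (hS : ∀ g ∈ S, ∃ j : ℤ, ∃ h ∈ H, ρ g = T ^ j * h) :
    Module.finrank (Fpbar p) (fixedBy (contragredient ρ) S) =
      Module.finrank (Fpbar p) (fixedBy ρ S) := by
  set E := matrixAverage H
  have hE := matrixAverage_mul_self (H := H) hcard
  have hTE := matrixAverage_comm hT
  set C := (T.val - 1) * E + (1 - E) with hC
  -- Transposition reverses the product; that T commutes with E restores the original shape.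
  have hCt : Cᵀ = (T.valᵀ - 1) * Eᵀ + (1 - Eᵀ) := by
    have h1 : C = E * (T.val - 1) + (1 - E) := by
      rw [hC, sub_mul, mul_sub, hTE, one_mul, mul_one]
    rw [h1, Matrix.transpose_add, Matrix.transpose_mul, Matrix.transpose_sub, Matrix.transpose_sub,
      Matrix.transpose_one]
  have h1 : fixedBy ρ S = LinearMap.ker (Matrix.mulVecLin C) := by
    ext v
    rw [mem_fixedBy, LinearMap.mem_ker, Matrix.mulVecLin_apply,
      mulVec_eq_zero_iff_of_idempotent hE hTE, matrixAverage_mulVec_eq_iff hcard]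
    constructor
    · intro h
      refine ⟨fun x hx => ?_, ?_⟩
      · obtain ⟨g, hg, rfl⟩ := hH x hx
        exact h g hg
      · obtain ⟨g, hg, rfl⟩ := hTS
        exact h g hg
    · rintro ⟨h1, h2⟩ g hg
      obtain ⟨j, x, hx, hgx⟩ := hS g hg
      rw [hgx, Units.val_mul, ← Matrix.mulVec_mulVec, h1 x hx, zpow_mulVec_eq h2]
  have h2 : fixedBy (contragredient ρ) S = LinearMap.ker (Matrix.mulVecLin Cᵀ) := by
    have hinv : ∀ {A : GL (Fin n) (Fpbar p)} {v : Fin n → Fpbar p},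
        (transposeInv _ A).val *ᵥ v = v ↔ A.valᵀ *ᵥ v = v := fun {A v} => by
      rw [← inv_mulVec_eq_iff, transposeInv_inv_val]
    ext v
    rw [mem_fixedBy, LinearMap.mem_ker, Matrix.mulVecLin_apply, hCt,
      mulVec_eq_zero_iff_of_idempotent (by rw [← Matrix.transpose_mul, hE])
        (by rw [← Matrix.transpose_mul, ← Matrix.transpose_mul, hTE]),
      matrixAverage_transpose_mulVec_eq_iff hcard]
    constructor
    · intro h
      refine ⟨fun x hx => ?_, ?_⟩
      · obtain ⟨g, hg, rfl⟩ := hH x hx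
        exact hinv.1 (h g hg)
      · obtain ⟨g, hg, rfl⟩ := hTS
        exact hinv.1 (h g hg)
    · rintro ⟨h1, h2⟩ g hg
      obtain ⟨j, x, hx, hgx⟩ := hS g hg
      rw [contragredient_apply, hgx, map_mul, map_zpow, Units.val_mul, ← Matrix.mulVec_mulVec,
        hinv.2 (h1 x hx), zpow_mulVec_eq (hinv.2 h2)]
  have h3 := LinearMap.finrank_range_add_finrank_ker (Matrix.mulVecLin C)
  have h4 := LinearMap.finrank_range_add_finrank_ker (Matrix.mulVecLin Cᵀ)
  have h5 : Module.finrank (Fpbar p) (LinearMap.range (Matrix.mulVecLin Cᵀ)) =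
      Module.finrank (Fpbar p) (LinearMap.range (Matrix.mulVecLin C)) := Matrix.rank_transpose C
  rw [h1, h2]
  omega

end Fixed

end GaloisHecke

namespace GaloisHecke

/-! ### Invariance of the level under duality -/

section Level

variable {p : ℕ} [Fact p.Prime] {n : ℕ}

instance isAlgebraic_Qbar : Algebra.IsAlgebraic ℚ Qbar := by
  have h := AlgebraicClosure.isAlgebraic ℚ
  rwa [Subsingleton.elim (AlgebraicClosure.instAlgebra ℚ) (DivisionRing.toRatAlgebra (R := Qbar))]
    at h

instance isGalois_Qbar : IsGalois ℚ Qbar :=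
  have : IsAlgClosure ℚ Qbar := ⟨inferInstance, inferInstance⟩
  have : Normal ℚ Qbar := IsAlgClosure.normal ℚ Qbar
  ⟨⟩

theorem isOpen_ker {ρ : GQ →* GL (Fin n) (Fpbar p)}
    (h : Continuous[krullTopology ℚ Qbar, ⊥] ρ) : IsOpen (ρ.ker : Set GQ) := by
  let _ : TopologicalSpace (GL (Fin n) (Fpbar p)) := ⊥
  have : DiscreteTopology (GL (Fin n) (Fpbar p)) := ⟨rfl⟩
  exact (isOpen_discrete {(1 : GL (Fin n) (Fpbar p))}).preimage h

theorem fixingSubgroup_splittingField {ρ : GQ →* GL (Fin n) (Fpbar p)}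
    (h : Continuous[krullTopology ℚ Qbar, ⊥] ρ) :
    (splittingField ρ).fixingSubgroup = ρ.ker :=
  InfiniteGalois.fixingSubgroup_fixedField ⟨ρ.ker, Subgroup.isClosed_of_isOpen _ (isOpen_ker h)⟩

theorem finite_splittingField {ρ : GQ →* GL (Fin n) (Fpbar p)}
    (h : Continuous[krullTopology ℚ Qbar, ⊥] ρ) :
    FiniteDimensional ℚ (splittingField ρ) ∧ IsGalois ℚ (splittingField ρ) := by
  have h1 : IsOpen (splittingField ρ).fixingSubgroup.carrier ∧
      (splittingField ρ).fixingSubgroup.Normal := by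
    rw [fixingSubgroup_splittingField h]
    exact ⟨isOpen_ker h, inferInstance⟩
  rw [InfiniteGalois.isOpen_and_normal_iff_finite_and_isGalois] at h1
  convert h1
  exact Subsingleton.elim _ _

theorem faithfulSMul_ringOfIntegers (K : Type*) [Field K] [NumberField K] :
    FaithfulSMul Gal(K/ℚ) (𝓞 K) := by
  refine ⟨fun {σ τ} h => ?_⟩
  ext x
  obtain ⟨a, b, -, rfl⟩ := IsFractionRing.div_surjective (A := 𝓞 K) x
  have h1 : ∀ y : 𝓞 K, σ (algebraMap (𝓞 K) K y) = τ (algebraMap (𝓞 K) K y) := fun y =>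
    congrArg (algebraMap (𝓞 K) K) (h y)
  rw [map_div₀, map_div₀, h1, h1]

theorem mem_ramificationSet_iff {ρ : GQ →* GL (Fin n) (Fpbar p)} [Normal ℚ (splittingField ρ)]
    {𝔮 : Ideal (𝓞 (splittingField ρ))} {i : ℕ} {g : GQ} :
    g ∈ ramificationSet ρ 𝔮 i ↔ AlgEquiv.restrictNormalHom (splittingField ρ) g ∈
      (𝔮 ^ (i + 1)).inertia Gal(splittingField ρ/ℚ) := by
  constructor
  · rintro ⟨τ, hτ, h⟩
    convert hτ
    ext x
    rw [← h x]
    exact AlgEquiv.restrictNormal_commutes g (splittingField ρ) x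
  · intro h
    exact ⟨_, h, fun x => (AlgEquiv.restrictNormal_commutes g (splittingField ρ) x).symm⟩

theorem eq_of_restrictNormalHom_eq {ρ : GQ →* GL (Fin n) (Fpbar p)}
    (hρ : Continuous[krullTopology ℚ Qbar, ⊥] ρ) [Normal ℚ (splittingField ρ)] {g h : GQ}
    (hgh : AlgEquiv.restrictNormalHom (splittingField ρ) g =
      AlgEquiv.restrictNormalHom (splittingField ρ) h) : ρ g = ρ h := by
  have h1 : g⁻¹ * h ∈ (splittingField ρ).fixingSubgroup := by
    rw [IntermediateField.mem_fixingSubgroup_iff]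
    intro x hx
    have h2 : g x = h x :=
      (AlgEquiv.restrictNormal_commutes g (splittingField ρ) ⟨x, hx⟩).symm.trans
        ((congrArg (fun τ : Gal(splittingField ρ/ℚ) => (τ ⟨x, hx⟩ : Qbar)) hgh).trans
          (AlgEquiv.restrictNormal_commutes h (splittingField ρ) ⟨x, hx⟩))
    rw [AlgEquiv.mul_apply, ← h2]
    exact g.symm_apply_apply x
  rw [fixingSubgroup_splittingField hρ, MonoidHom.mem_ker, map_mul, map_inv, inv_mul_eq_one] at h1
  exact h1

/-- The higher ramification groups act through q-groups with q ≠ p, and inertia is generated by wild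
inertia and one tame element. -/
theorem finrank_fixedBy_ramificationSet {ρ : GQ →* GL (Fin n) (Fpbar p)}
    (hρ : Continuous[krullTopology ℚ Qbar, ⊥] ρ) {q : ℕ} (hq : q.Prime) (hqp : q ≠ p)
    {𝔮 : Ideal (𝓞 (splittingField ρ))} (h𝔮 : 𝔮.IsPrime)
    (hmem : (q : 𝓞 (splittingField ρ)) ∈ 𝔮) (i : ℕ) :
    Module.finrank (Fpbar p) (fixedBy (contragredient ρ) (ramificationSet ρ 𝔮 i)) =
      Module.finrank (Fpbar p) (fixedBy ρ (ramificationSet ρ 𝔮 i)) := by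
  obtain ⟨hfin, hgal⟩ := finite_splittingField hρ
  have hnf : NumberField (splittingField ρ) := ⟨⟩
  have hfaith := faithfulSMul_ringOfIntegers (splittingField ρ)
  have h𝔮0 : 𝔮 ≠ ⊥ := by
    rintro rfl
    rw [Ideal.mem_bot, Nat.cast_eq_zero] at hmem
    exact hq.ne_zero hmem
  have hfinq : Finite (𝓞 (splittingField ρ) ⧸ 𝔮) := Ideal.finiteQuotientOfFreeOfNeBot 𝔮 h𝔮0
  set res := AlgEquiv.restrictNormalHom (F := ℚ) (K₁ := Qbar) (splittingField ρ) with hres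
  have hsurj : Function.Surjective res := AlgEquiv.restrictNormalHom_surjective Qbar
  have hmem_iff : ∀ j g, g ∈ ramificationSet ρ 𝔮 j ↔
      res g ∈ (𝔮 ^ (j + 1)).inertia Gal(splittingField ρ/ℚ) := fun j g => mem_ramificationSet_iff
  let H (j : ℕ) : Subgroup (GL (Fin n) (Fpbar p)) :=
    (((𝔮 ^ (j + 1)).inertia Gal(splittingField ρ/ℚ)).comap res).map ρ
  have hHmem : ∀ j, ∀ x ∈ H j, ∃ g ∈ ramificationSet ρ 𝔮 j, ρ g = x := by
    rintro j _ ⟨g, hg, rfl⟩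
    exact ⟨g, (hmem_iff j g).2 hg, rfl⟩
  have hHfin : ∀ j, Finite (H j) := by
    intro j
    choose lift hlift using hsurj
    refine ((Set.finite_range fun τ => ρ (lift τ)).subset ?_).to_subtype
    rintro _ ⟨g, -, rfl⟩
    exact ⟨res g, eq_of_restrictNormalHom_eq hρ (hlift _)⟩
  obtain ⟨m, hm⟩ := exists_pow_pow_eq_one (G := Gal(splittingField ρ/ℚ))
    (P := 𝔮) h𝔮.ne_top hmem
  have hcard : ∀ j [Fintype (H j)], 1 ≤ j → (Fintype.card (H j) : Fpbar p) ≠ 0 := by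
    intro j _ hj
    have hpg : IsPGroup q (H j) := by
      rintro ⟨_, g, hg, rfl⟩
      refine ⟨m, Subtype.ext ?_⟩
      have h1 : res (g ^ q ^ m) = res 1 := by
        rw [map_pow, map_one]
        exact hm _ (inertia_pow_le (by omega) hg)
      have h2 := eq_of_restrictNormalHom_eq hρ h1
      rw [map_pow, map_one] at h2
      exact h2
    have : Fact q.Prime := ⟨hq⟩
    obtain ⟨k, hk⟩ := IsPGroup.iff_card.1 hpg
    rw [← Nat.card_eq_fintype_card, hk, Nat.cast_pow]
    refine pow_ne_zero _ ?_
    rw [Ne, CharP.cast_eq_zero_iff (Fpbar p) p, Nat.prime_dvd_prime_iff_eq Fact.out hq]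
    exact hqp.symm
  -- For i = 0 take H the wild part and T a tame generator; for i ≥ 1 the whole group is H and T =
  -- 1.
  rcases Nat.eq_zero_or_pos i with rfl | hi
  · obtain ⟨t, ht, htgen⟩ := exists_tame_generator (G := Gal(splittingField ρ/ℚ)) h𝔮0
    obtain ⟨t, rfl⟩ := hsurj t
    have := Fintype.ofFinite (H 1)
    refine finrank_fixedBy_contragredient (H := H 1) (T := ρ t) (hcard 1 le_rfl) ?_ ?_ ?_ ?_
    · rintro _ ⟨g, hg, rfl⟩
      refine ⟨t * g * t⁻¹, ?_, by rw [map_mul, map_mul, map_inv]⟩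
      rw [SetLike.mem_coe, Subgroup.mem_comap, map_mul, map_mul, map_inv]
      exact conj_mem_inertia_pow ht hg
    · refine ⟨t, (hmem_iff 0 t).2 ?_, rfl⟩
      rwa [zero_add, pow_one]
    · intro x hx
      obtain ⟨g, hg, rfl⟩ := hHmem 1 x hx
      exact ⟨g, (hmem_iff 0 g).2 (inertia_pow_le (by omega) ((hmem_iff 1 g).1 hg)), rfl⟩
    · intro g hg
      rw [hmem_iff, zero_add, pow_one] at hg
      obtain ⟨j, τ, hτ, hg⟩ := htgen _ hg
      refine ⟨j, ρ ((t ^ j)⁻¹ * g), ⟨_, ?_, rfl⟩, ?_⟩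
      · rw [SetLike.mem_coe, Subgroup.mem_comap, map_mul, map_inv, map_zpow, hg,
          inv_mul_cancel_left]
        exact hτ
      · rw [← map_zpow, ← map_mul, mul_inv_cancel_left]
  · have := Fintype.ofFinite (H i)
    refine finrank_fixedBy_contragredient (H := H i) (T := 1) (hcard i hi) ?_ ?_ (hHmem i) ?_
    · intro h hh
      rwa [one_mul, inv_one, mul_one]
    · exact ⟨1, (hmem_iff i 1).2 (by rw [map_one]; exact one_mem _), map_one _⟩
    · intro g hg
      exact ⟨0, ρ g, ⟨g, (hmem_iff i g).1 hg, rfl⟩, by rw [zpow_zero, one_mul]⟩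

/-- The elements of `G_ℚ` that restrict to the `i`-th ramification group of a prime of `K`. -/
def ramificationSetOf (K : IntermediateField ℚ Qbar) (𝔮 : Ideal (𝓞 K)) (i : ℕ) : Set GQ :=
  {g | ∃ τ ∈ (𝔮 ^ (i + 1)).inertia Gal(K/ℚ), ∀ x : K, g (x : Qbar) = (τ x : Qbar)}

/-- The conductor exponent, computed with a field `K` that need not be the one cut out by `ρ`. -/
def conductorExponentOf (ρ : GQ →* GL (Fin n) (Fpbar p)) (K : IntermediateField ℚ Qbar)
    (𝔮 : Ideal (𝓞 K)) : ℚ :=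
  ∑ᶠ i : ℕ, (Nat.card (ρ '' ramificationSetOf K 𝔮 i) : ℚ) /
    Nat.card (ρ '' ramificationSetOf K 𝔮 0) *
    Module.finrank (Fpbar p) ((Fin n → Fpbar p) ⧸ fixedBy ρ (ramificationSetOf K 𝔮 i))

theorem card_image_contragredient (ρ : GQ →* GL (Fin n) (Fpbar p)) (S : Set GQ) :
    Nat.card (contragredient ρ '' S) = Nat.card (ρ '' S) := by
  have : contragredient ρ '' S = transposeInv (Fpbar p) '' (ρ '' S) := by
    rw [← Set.image_comp]
    rfl
  rw [this, Nat.card_image_of_injective transposeInv_injective]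

theorem conductorExponentOf_contragredient {ρ : GQ →* GL (Fin n) (Fpbar p)}
    (hρ : Continuous[krullTopology ℚ Qbar, ⊥] ρ) {q : ℕ} (hq : q.Prime) (hqp : q ≠ p)
    {𝔮 : Ideal (𝓞 (splittingField ρ))} (h𝔮 : 𝔮.IsPrime)
    (hmem : (q : 𝓞 (splittingField ρ)) ∈ 𝔮) :
    conductorExponentOf (contragredient ρ) (splittingField ρ) 𝔮 = conductorExponent ρ 𝔮 := by
  refine finsum_congr fun i => ?_
  rw [card_image_contragredient, card_image_contragredient]
  have h1 := finrank_fixedBy_ramificationSet hρ hq hqp h𝔮 hmem i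
  have h2 := Submodule.finrank_quotient_add_finrank
    (fixedBy (contragredient ρ) (ramificationSet ρ 𝔮 i))
  have h3 := Submodule.finrank_quotient_add_finrank (fixedBy ρ (ramificationSet ρ 𝔮 i))
  have h4 : Module.finrank (Fpbar p)
      ((Fin n → Fpbar p) ⧸ fixedBy (contragredient ρ) (ramificationSet ρ 𝔮 i)) =
      Module.finrank (Fpbar p) ((Fin n → Fpbar p) ⧸ fixedBy ρ (ramificationSet ρ 𝔮 i)) := by
    omega
  exact congrArg (fun m : ℕ => (Nat.card (ρ '' ramificationSet ρ 𝔮 i) : ℚ) /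
    Nat.card (ρ '' ramificationSet ρ 𝔮 0) * m) h4

theorem IsLevel.contragredient {ρ : GQ →* GL (Fin n) (Fpbar p)} {N : ℕ}
    (hρ : Continuous[krullTopology ℚ Qbar, ⊥] ρ) (h : IsLevel ρ N) :
    IsLevel (contragredient ρ) N where
  ne_zero := h.ne_zero
  not_dvd := h.not_dvd
  exponent q hq hqp := by
    -- Primes of the two splitting fields live in different types. A variable subgroup in place of
    -- the kernel allows the equality of kernels to be substituted.
    suffices hs : ∀ H : Subgroup GQ, H = ρ.ker →
        ∀ 𝔮 : Ideal (𝓞 (IntermediateField.fixedField H : IntermediateField ℚ Qbar)), 𝔮.IsPrime →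
        (q : 𝓞 (IntermediateField.fixedField H : IntermediateField ℚ Qbar)) ∈ 𝔮 →
        (N.factorization q : ℚ) = conductorExponentOf (GaloisHecke.contragredient ρ) _ 𝔮 from
      hs _ (ker_contragredient ρ)
    rintro _ rfl 𝔮 h𝔮 hmem
    exact (h.exponent q hq hqp 𝔮 h𝔮 hmem).trans
      (conductorExponentOf_contragredient hρ hq hqp h𝔮 hmem).symm

end Level

end GaloisHecke

/-! ### Duality of weights: simple submodules of dual Weyl modules -/

namespace GaloisHecke

/-! ### LU decomposition -/

section LU

/-- Induction on the size: nonzero leading minors make the factors of the leading block invertible,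
so the border can be solved for. -/
theorem exists_lu_decomposition {k : Type*} [Field k] (n : ℕ) (A : Matrix (Fin n) (Fin n) k)
    (hA : ∀ (m : ℕ) (h : m ≤ n), (A.submatrix (Fin.castLE h) (Fin.castLE h)).det ≠ 0) :
    ∃ L U : Matrix (Fin n) (Fin n) k, (∀ i j, i < j → L i j = 0) ∧ (∀ i j, j < i → U i j = 0) ∧
      (∀ i, U i i = 1) ∧ A = L * U := by
  induction n with
  | zero => exact ⟨1, 1, fun i => i.elim0, fun i => i.elim0, fun i => i.elim0,
      by ext i; exact i.elim0⟩
  | succ n ih =>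
    obtain ⟨L', U', hL', hU', hU1', hLU'⟩ := ih (A.submatrix Fin.castSucc Fin.castSucc)
      fun m h => hA m (h.trans n.le_succ)
    have hdet : (A.submatrix Fin.castSucc Fin.castSucc).det ≠ 0 := hA n n.le_succ
    rw [hLU', Matrix.det_mul] at hdet
    have hL0 : IsUnit L'.det := (left_ne_zero_of_mul hdet).isUnit
    have hU0 : IsUnit U'.det := (right_ne_zero_of_mul hdet).isUnit
    set c : Fin n → k := fun j => A (Fin.last n) j.castSucc
    set d : Fin n → k := fun i => A i.castSucc (Fin.last n)
    set r : Fin n → k := c ᵥ* U'⁻¹ with hr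
    set l : Fin n → k := L'⁻¹ *ᵥ d with hl
    -- The borders solve r U' = c and L' l = d; the corner is the Schur complement A_nn - r·l.
    refine ⟨Matrix.of (Fin.snoc (fun i => Fin.snoc (L' i) 0)
        (Fin.snoc r (A (Fin.last n) (Fin.last n) - r ⬝ᵥ l))),
      Matrix.of (Fin.snoc (fun i => Fin.snoc (U' i) (l i)) (Fin.snoc 0 1)), ?_, ?_, ?_, ?_⟩
    · intro i j hij
      induction i using Fin.lastCases with
      | last => exact absurd hij (not_lt.2 (Fin.le_last j))
      | cast i =>
        induction j using Fin.lastCases with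
        | last => simp
        | cast j => simpa using hL' i j (by simpa using hij)
    · intro i j hij
      induction j using Fin.lastCases with
      | last => exact absurd hij (not_lt.2 (Fin.le_last i))
      | cast j =>
        induction i using Fin.lastCases with
        | last => simp
        | cast i => simpa using hU' i j (by simpa using hij)
    · intro i
      induction i using Fin.lastCases with
      | last => simp
      | cast i => simpa using hU1' i
    · have h1 : L' *ᵥ l = d := by
        rw [hl, Matrix.mulVec_mulVec, Matrix.mul_nonsing_inv _ hL0, Matrix.one_mulVec]
      have h2 : r ᵥ* U' = c := by
        rw [hr, Matrix.vecMul_vecMul, Matrix.nonsing_inv_mul _ hU0, Matrix.vecMul_one]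
      ext i j
      rw [Matrix.mul_apply, Fin.sum_univ_castSucc]
      induction i using Fin.lastCases with
      | last =>
        induction j using Fin.lastCases with
        | last => simp [dotProduct]
        | cast j => simpa [Matrix.vecMul, dotProduct, c] using (congrFun h2 j).symm
      | cast i =>
        induction j using Fin.lastCases with
        | last => simpa [Matrix.mulVec, dotProduct, d] using (congrFun h1 i).symm
        | cast j => simpa [Matrix.mul_apply] using congrFun (congrFun hLU' i) j

end LU

section RegularFunctions

variable {p : ℕ} [Fact p.Prime] {n : ℕ}

/-! ### Regular functions -/

theorem coord_mem_regularFunctions (i j : Fin n) :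
    (fun x : GL (Fin n) (Fpbar p) => x.val i j) ∈ regularFunctions p n :=
  Algebra.subset_adjoin (Or.inl ⟨(i, j), rfl⟩)

theorem det_inv_mem_regularFunctions :
    (fun x : GL (Fin n) (Fpbar p) => (x.val.det)⁻¹) ∈ regularFunctions p n :=
  Algebra.subset_adjoin (Or.inr rfl)

theorem const_mem_regularFunctions (a : Fpbar p) :
    (fun _ : GL (Fin n) (Fpbar p) => a) ∈ regularFunctions p n :=
  (regularFunctions p n).algebraMap_mem a

theorem det_mem_regularFunctions_of_entries {m : ℕ}
    {A : GL (Fin n) (Fpbar p) → Matrix (Fin m) (Fin m) (Fpbar p)}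
    (h : ∀ i j, (fun x => A x i j) ∈ regularFunctions p n) :
    (fun x => (A x).det) ∈ regularFunctions p n := by
  have h1 : (fun x => (A x).det) = ∑ s : Equiv.Perm (Fin m),
      ((s.sign : ℤ) : Fpbar p) • ∏ i, fun x => A x (s i) i := by
    ext x
    rw [Matrix.det_apply']
    simp
  rw [h1]
  exact sum_mem fun s _ => Subalgebra.smul_mem _ (prod_mem fun i _ => h _ _) _

theorem det_mem_regularFunctions :
    (fun x : GL (Fin n) (Fpbar p) => x.val.det) ∈ regularFunctions p n :=
  det_mem_regularFunctions_of_entries coord_mem_regularFunctions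

theorem det_zpow_mem_regularFunctions (K : ℤ) :
    (fun x : GL (Fin n) (Fpbar p) => x.val.det ^ K) ∈ regularFunctions p n := by
  cases K with
  | ofNat m =>
    have := pow_mem (det_mem_regularFunctions (p := p) (n := n)) m
    convert this using 1
    ext x
    simp
  | negSucc m =>
    have := pow_mem (det_inv_mem_regularFunctions (p := p) (n := n)) (m + 1)
    convert this using 1
    ext x
    simp [zpow_negSucc]

theorem inv_entry_mem_regularFunctions (i j : Fin n) :
    (fun x : GL (Fin n) (Fpbar p) => (x⁻¹).val i j) ∈ regularFunctions p n := by
  have h1 : (fun x : GL (Fin n) (Fpbar p) => (x⁻¹).val i j) =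
      (fun x => (x.val.det)⁻¹) * fun x => (x.val.updateRow j (Pi.single i 1)).det := by
    ext x
    rw [Pi.mul_apply, Matrix.coe_units_inv, Matrix.inv_def, Matrix.smul_apply,
      Ring.inverse_eq_inv', smul_eq_mul, Matrix.adjugate_apply]
  rw [h1]
  refine mul_mem det_inv_mem_regularFunctions (det_mem_regularFunctions_of_entries fun a b => ?_)
  by_cases ha : a = j
  · subst ha
    simpa using const_mem_regularFunctions _
  · simpa [Matrix.updateRow_ne ha] using coord_mem_regularFunctions a b

theorem comp_mem_regularFunctions {f : GL (Fin n) (Fpbar p) → Fpbar p}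
    (hf : f ∈ regularFunctions p n) {φ : GL (Fin n) (Fpbar p) → GL (Fin n) (Fpbar p)}
    (h1 : ∀ i j, (fun x => (φ x).val i j) ∈ regularFunctions p n)
    (h2 : (fun x => ((φ x).val.det)⁻¹) ∈ regularFunctions p n) :
    (fun x => f (φ x)) ∈ regularFunctions p n := by
  induction hf using Algebra.adjoin_induction with
  | mem f hf =>
    rcases hf with ⟨⟨i, j⟩, rfl⟩ | rfl
    · exact h1 i j
    · exact h2
  | algebraMap r => exact const_mem_regularFunctions r
  | add f g _ _ hf hg => exact add_mem hf hg
  | mul f g _ _ hf hg => exact mul_mem hf hg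

/-- The transpose, as an element of `GL_n`. -/
def transposeGL {R : Type*} [CommRing R] (x : GL (Fin n) R) : GL (Fin n) R :=
  (transposeInv R x)⁻¹

theorem transposeGL_val {R : Type*} [CommRing R] (x : GL (Fin n) R) :
    (transposeGL x).val = x.valᵀ := rfl

theorem transposeGL_mul {R : Type*} [CommRing R] (x y : GL (Fin n) R) :
    transposeGL (x * y) = transposeGL y * transposeGL x := by
  simp only [transposeGL, map_mul, mul_inv_rev]

theorem transposeGL_transposeGL {R : Type*} [CommRing R] (x : GL (Fin n) R) :
    transposeGL (transposeGL x) = x :=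
  Units.ext (Matrix.transpose_transpose _)

theorem transposeGL_mem_regularFunctions {f : GL (Fin n) (Fpbar p) → Fpbar p}
    (hf : f ∈ regularFunctions p n) : (fun x => f (transposeGL x)) ∈ regularFunctions p n := by
  refine comp_mem_regularFunctions hf (fun i j => coord_mem_regularFunctions j i) ?_
  simpa only [transposeGL_val, Matrix.det_transpose] using det_inv_mem_regularFunctions

theorem rev_transposeInv_mem_regularFunctions {f : GL (Fin n) (Fpbar p) → Fpbar p}
    (hf : f ∈ regularFunctions p n) :
    (fun x => f (revGL n _ * transposeInv _ x)) ∈ regularFunctions p n := by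
  have h1 : ∀ i j, (fun x : GL (Fin n) (Fpbar p) => (revGL n _ * transposeInv _ x).val i j) ∈
      regularFunctions p n := fun i j => by
    convert inv_entry_mem_regularFunctions j i.rev using 1
    ext x
    change (revMatrix n (Fpbar p) * (x⁻¹).valᵀ) i j = _
    rw [revMatrix_mul]
    rfl
  refine comp_mem_regularFunctions hf h1 ?_
  have h2 : (fun x : GL (Fin n) (Fpbar p) => ((revGL n _ * transposeInv _ x).val.det)⁻¹) =
      (fun _ => ((revGL n (Fpbar p)).val.det)⁻¹) * fun x => x.val.det := by
    ext x
    rw [Units.val_mul, Matrix.det_mul, mul_inv, transposeInv_val, Matrix.det_transpose,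
      Matrix.coe_units_inv, Matrix.det_nonsing_inv, Ring.inverse_eq_inv', inv_inv]
    rfl
  rw [h2]
  exact mul_mem (const_mem_regularFunctions _) det_mem_regularFunctions

/-! ### Density of the big cell -/

/-- `x` is a lower triangular times an upper unipotent matrix. -/
def IsBigCell (x : GL (Fin n) (Fpbar p)) : Prop :=
  ∃ β u : GL (Fin n) (Fpbar p), (∀ i j, i < j → β.val i j = 0) ∧ (∀ i j, j < i → u.val i j = 0) ∧
    (∀ i, u.val i i = 1) ∧ x = β * u

theorem isBigCell_of_minors {x : GL (Fin n) (Fpbar p)}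
    (h : ∀ (m : ℕ) (h : m ≤ n), (x.val.submatrix (Fin.castLE h) (Fin.castLE h)).det ≠ 0) :
    IsBigCell x := by
  obtain ⟨L, U, hL, hU, hU1, hx⟩ := exists_lu_decomposition n x.val h
  have hdet : L.det * U.det ≠ 0 := by
    rw [← Matrix.det_mul, ← hx]
    exact x.det.ne_zero
  exact ⟨Matrix.GeneralLinearGroup.mkOfDetNeZero L (left_ne_zero_of_mul hdet),
    Matrix.GeneralLinearGroup.mkOfDetNeZero U (right_ne_zero_of_mul hdet), hL, hU, hU1,
    Units.ext hx⟩

/-- The line through the identity and `x`. -/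
def lineMatrix (x : Matrix (Fin n) (Fin n) (Fpbar p)) : Matrix (Fin n) (Fin n) (Fpbar p)[X] :=
  1 + (Polynomial.X : (Fpbar p)[X]) • (x - 1).map Polynomial.C

theorem lineMatrix_eval (x : Matrix (Fin n) (Fin n) (Fpbar p)) (t : Fpbar p) :
    (lineMatrix x).map (Polynomial.eval t) = 1 + t • (x - 1) := by
  ext i j
  simp [lineMatrix, Matrix.one_apply, apply_ite (Polynomial.eval t)]

theorem eval_det_submatrix {m : ℕ} (A : Matrix (Fin n) (Fin n) (Fpbar p)[X]) (t : Fpbar p)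
    (φ : Fin m → Fin n) :
    (A.submatrix φ φ).det.eval t = ((A.map (Polynomial.eval t)).submatrix φ φ).det := by
  have := RingHom.map_det (Polynomial.evalRingHom t) (A.submatrix φ φ)
  rw [Polynomial.coe_evalRingHom] at this
  rw [this]
  rfl

/-- A regular function has only powers of the determinant as denominators, so on a line it becomes
polynomial once these are cleared. -/
theorem exists_polynomial_on_line {f : GL (Fin n) (Fpbar p) → Fpbar p}
    (hf : f ∈ regularFunctions p n) (x : Matrix (Fin n) (Fin n) (Fpbar p)) :
    ∃ (m : ℕ) (P : (Fpbar p)[X]), ∀ (t : Fpbar p) (y : GL (Fin n) (Fpbar p)),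
      y.val = 1 + t • (x - 1) → f y * y.val.det ^ m = P.eval t := by
  have hdet : ∀ (t : Fpbar p) (y : GL (Fin n) (Fpbar p)), y.val = 1 + t • (x - 1) →
      (lineMatrix x).det.eval t = y.val.det := fun t y hy => by
    have := eval_det_submatrix (lineMatrix x) t id
    rwa [Matrix.submatrix_id_id, lineMatrix_eval, Matrix.submatrix_id_id, ← hy] at this
  induction hf using Algebra.adjoin_induction with
  | mem f hf =>
    rcases hf with ⟨⟨i, j⟩, rfl⟩ | rfl
    · refine ⟨0, lineMatrix x i j, fun t y hy => ?_⟩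
      rw [pow_zero, mul_one]
      change y.val i j = _
      rw [hy, ← lineMatrix_eval]
      rfl
    · refine ⟨1, 1, fun t y hy => ?_⟩
      rw [pow_one, Polynomial.eval_one]
      exact inv_mul_cancel₀ y.det.ne_zero
  | algebraMap r =>
    refine ⟨0, Polynomial.C r, fun t y hy => ?_⟩
    rw [pow_zero, mul_one, Polynomial.eval_C]
    rfl
  | add f g _ _ hf hg =>
    obtain ⟨m, P, hP⟩ := hf
    obtain ⟨m', P', hP'⟩ := hg
    refine ⟨m + m', P * (lineMatrix x).det ^ m' + P' * (lineMatrix x).det ^ m, fun t y hy => ?_⟩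
    rw [Polynomial.eval_add, Polynomial.eval_mul, Polynomial.eval_mul, Polynomial.eval_pow,
      Polynomial.eval_pow, hdet t y hy, ← hP t y hy, ← hP' t y hy, Pi.add_apply]
    ring
  | mul f g _ _ hf hg =>
    obtain ⟨m, P, hP⟩ := hf
    obtain ⟨m', P', hP'⟩ := hg
    refine ⟨m + m', P * P', fun t y hy => ?_⟩
    rw [Polynomial.eval_mul, ← hP t y hy, ← hP' t y hy, Pi.mul_apply]
    ring

/-- Join x to the identity by a line. The product Q of the leading minors has value 1 at t = 0, so Q
≠ 0, and f vanishes wherever Q does not. As F̄_p is infinite, PQ = 0 for the polynomial P of f on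
the line; hence P = 0, and t = 1 gives f(x) = 0. -/
theorem eq_zero_of_forall_isBigCell {f : GL (Fin n) (Fpbar p) → Fpbar p}
    (hf : f ∈ regularFunctions p n) (h : ∀ x, IsBigCell x → f x = 0) : f = 0 := by
  ext x
  obtain ⟨m, P, hP⟩ := exists_polynomial_on_line hf x.val
  let Q : (Fpbar p)[X] := ∏ i : Fin (n + 1), ((lineMatrix x.val).submatrix
    (Fin.castLE (Nat.lt_succ_iff.1 i.isLt)) (Fin.castLE (Nat.lt_succ_iff.1 i.isLt))).det
  have hQ0 : Q.eval 0 = 1 := by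
    rw [Polynomial.eval_prod]
    refine Finset.prod_eq_one fun i _ => ?_
    rw [eval_det_submatrix, lineMatrix_eval, zero_smul, add_zero,
      Matrix.submatrix_one _ (Fin.castLE_injective _), Matrix.det_one]
  have hPQ : P * Q = 0 := by
    refine Polynomial.funext fun t => ?_
    rw [Polynomial.eval_mul, Polynomial.eval_zero]
    by_cases ht : Q.eval t = 0
    · rw [ht, mul_zero]
    · have hminor : ∀ (m : ℕ) (hm : m ≤ n),
          ((1 + t • (x.val - 1)).submatrix (Fin.castLE hm) (Fin.castLE hm)).det ≠ 0 := by
        intro m hm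
        rw [Polynomial.eval_prod, ← Ne, Finset.prod_ne_zero_iff] at ht
        have := ht ⟨m, Nat.lt_succ_iff.2 hm⟩ (Finset.mem_univ _)
        rwa [eval_det_submatrix, lineMatrix_eval] at this
      have hdet : (1 + t • (x.val - 1)).det ≠ 0 := hminor n le_rfl
      have h1 := hP t (Matrix.GeneralLinearGroup.mkOfDetNeZero _ hdet) rfl
      rw [h _ (isBigCell_of_minors hminor), zero_mul] at h1
      rw [← h1, zero_mul]
  have hP0 : P = 0 := by
    refine (mul_eq_zero.1 hPQ).resolve_right fun hQ => ?_
    rw [hQ, Polynomial.eval_zero] at hQ0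
    exact zero_ne_one hQ0
  have h1 := hP 1 x (by rw [one_smul, add_sub_cancel])
  rw [hP0, Polynomial.eval_zero] at h1
  exact (mul_eq_zero.1 h1).resolve_right (pow_ne_zero _ x.det.ne_zero)

end RegularFunctions

end GaloisHecke

namespace GaloisHecke

section Unipotent

variable {p : ℕ} [Fact p.Prime] {n : ℕ}

/-! ### Vectors fixed by the unipotent radical -/

/-- Right translation of functions on `GL_n`. -/
def rightTranslation (p : ℕ) [Fact p.Prime] (n : ℕ) :
    Representation (Fpbar p) (GL (Fin n) (Fpbar p)) (GL (Fin n) (Fpbar p) → Fpbar p) where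
  toFun g := LinearMap.funLeft _ _ (· * g)
  map_one' := by ext f x; simp [LinearMap.funLeft]
  map_mul' g h := by ext f x; simp [LinearMap.funLeft, mul_assoc]

/-- The span over the prime field of one orbit is a finite nonzero F_p-space stable under H. Its
cardinality is divisible by p, so 0 is not the only fixed point. -/
theorem exists_fixed_of_isPGroup {H : Subgroup (GL (Fin n) (Fpbar p))} [Finite H]
    (hH : IsPGroup p H) {S : Submodule (Fpbar p) (GL (Fin n) (Fpbar p) → Fpbar p)}
    (hS : IsTranslationStable S) (hS0 : S ≠ ⊥) :
    ∃ f ∈ S, f ≠ 0 ∧ ∀ g ∈ H, rightTranslation p n g f = f := by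
  obtain ⟨f₀, hf₀, hf₀0⟩ := Submodule.exists_mem_ne_zero_of_ne_bot hS0
  let W : Submodule (ZMod p) (GL (Fin n) (Fpbar p) → Fpbar p) :=
    Submodule.span (ZMod p) (Set.range fun h : H => rightTranslation p n h f₀)
  have hWS : ∀ w ∈ W, w ∈ S := by
    have : W ≤ S.restrictScalars (ZMod p) := by
      refine Submodule.span_le.2 ?_
      rintro _ ⟨h, rfl⟩
      exact hS f₀ hf₀ h
    exact fun w hw => this hw
  have hWH : ∀ (h : H), ∀ w ∈ W, rightTranslation p n h w ∈ W := by
    intro h w hw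
    have : W ≤ W.comap ((rightTranslation p n h).restrictScalars (ZMod p)) := by
      refine Submodule.span_le.2 ?_
      rintro _ ⟨h', rfl⟩
      refine Submodule.subset_span ⟨h * h', ?_⟩
      change rightTranslation p n (h.val * h'.val) f₀ = _
      rw [map_mul]
      rfl
    exact this hw
  have hfin : Module.Finite (ZMod p) W := Module.Finite.span_of_finite _ (Set.finite_range _)
  have hWfin : Finite W := Module.finite_of_finite (ZMod p)
  let _ : MulAction H W :=
    { smul h w := ⟨rightTranslation p n h w, hWH h w w.prop⟩
      one_smul w := Subtype.ext (by
        change rightTranslation p n ((1 : H) : GL (Fin n) (Fpbar p)) w = w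
        rw [Subgroup.coe_one, map_one]
        rfl)
      mul_smul h h' w := Subtype.ext (by
        change rightTranslation p n ((h * h' : H) : GL (Fin n) (Fpbar p)) w = _
        rw [Subgroup.coe_mul, map_mul]
        rfl) }
  have hdvd : p ∣ Nat.card W := by
    have hmem : f₀ ∈ W := Submodule.subset_span ⟨1, by
      change rightTranslation p n 1 f₀ = f₀
      rw [map_one]
      rfl⟩
    have h1 : addOrderOf (⟨f₀, hmem⟩ : W) = p := by
      refine addOrderOf_eq_prime (Subtype.ext ?_) (fun h => hf₀0 (congrArg Subtype.val h))
      ext x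
      simp [CharP.cast_eq_zero]
    exact h1.symm.dvd.trans (addOrderOf_dvd_natCard _)
  obtain ⟨w, hw, hw0⟩ := hH.exists_fixed_point_of_prime_dvd_card_of_fixed_point W hdvd
    (a := 0) (fun h => Subtype.ext (map_zero (rightTranslation p n h)))
  refine ⟨w, hWS w w.prop, fun h => hw0 (Subtype.ext h.symm), fun g hg => ?_⟩
  exact congrArg Subtype.val (hw ⟨g, hg⟩)

/-- Cayley–Hamilton gives (u - 1)^n = 0, and in characteristic p one has u^(p^n) - 1 = (u - 1)^(p^n)
with p^n ≥ n. -/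
theorem unipotent_pow_eq_one [NeZero n] {u : GL (Fin n) (Fpbar p)}
    (hu : ∀ i j, j < i → u.val i j = 0) (hu1 : ∀ i, u.val i i = 1) : u ^ p ^ n = 1 := by
  have h1 : (u.val - 1) ^ n = 0 := by
    have h2 := Matrix.aeval_self_charpoly u.val
    rw [Matrix.charpoly_of_isUpperTriangular _ fun i j hij => hu i j hij] at h2
    simpa [hu1] using h2
  apply Units.ext
  have h2 : (u.val - 1) ^ p ^ n = 0 := by
    have h3 : n ≤ p ^ n := (Nat.lt_pow_self (Fact.out : p.Prime).one_lt).le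
    rw [← Nat.add_sub_cancel' h3, pow_add, h1, zero_mul]
  rw [sub_pow_expChar_pow_of_commute p n (Commute.one_right u.val), one_pow,
    sub_eq_zero] at h2
  rw [Units.val_pow_eq_pow_val, h2, Units.val_one]

/-- The group of upper unipotent matrices. -/
def unipotent (p : ℕ) [Fact p.Prime] (n : ℕ) [NeZero n] : Subgroup (GL (Fin n) (Fpbar p)) :=
  let M : Submonoid (GL (Fin n) (Fpbar p)) :=
    { carrier := {u | (∀ i j, j < i → u.val i j = 0) ∧ ∀ i, u.val i i = 1}
      one_mem' := ⟨fun i j h => Matrix.one_apply_ne' h.ne, fun i => Matrix.one_apply_eq i⟩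
      mul_mem' := by
        rintro u v ⟨hu, hu1⟩ ⟨hv, hv1⟩
        refine ⟨fun i j hij => ?_, fun i => ?_⟩
        · rw [Units.val_mul, Matrix.mul_apply]
          refine Finset.sum_eq_zero fun k _ => ?_
          rcases lt_or_ge k i with h | h
          · rw [hu i k h, zero_mul]
          · rw [hv k j (lt_of_lt_of_le hij h), mul_zero]
        · rw [Units.val_mul, Matrix.mul_apply, Finset.sum_eq_single i, hu1, hv1, one_mul]
          · intro k _ hk
            rcases lt_or_gt_of_ne hk with h | h
            · rw [hu i k h, zero_mul]
            · rw [hv k i h, mul_zero]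
          · simp }
  { M with
    inv_mem' := by
      intro u hu
      have h1 := unipotent_pow_eq_one hu.1 hu.2
      -- The inverse is a positive power, so closure under products suffices.
      have h2 : u⁻¹ = u ^ (p ^ n - 1) := by
        rw [inv_eq_iff_mul_eq_one, ← pow_succ',
          Nat.sub_add_cancel (Nat.one_le_pow _ _ (Fact.out : p.Prime).pos), h1]
      rw [h2]
      exact M.pow_mem hu _ }

theorem mem_unipotent [NeZero n] {u : GL (Fin n) (Fpbar p)} :
    u ∈ unipotent p n ↔ (∀ i j, j < i → u.val i j = 0) ∧ ∀ i, u.val i i = 1 := Iff.rfl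

/-- The upper unipotent matrices with entries in the field with `p ^ m!` elements. -/
def finiteUnipotent (p : ℕ) [Fact p.Prime] (n : ℕ) [NeZero n] (m : ℕ) :
    Subgroup (GL (Fin n) (Fpbar p)) :=
  unipotent p n ⊓ MonoidHom.eqLocus
    (Matrix.GeneralLinearGroup.map (iterateFrobenius (Fpbar p) p m.factorial)) (MonoidHom.id _)

theorem mem_finiteUnipotent [NeZero n] {m : ℕ} {u : GL (Fin n) (Fpbar p)} :
    u ∈ finiteUnipotent p n m ↔
      u ∈ unipotent p n ∧ ∀ i j, u.val i j ^ p ^ m.factorial = u.val i j := by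
  rw [finiteUnipotent, Subgroup.mem_inf, and_congr_right_iff]
  intro _
  constructor
  · intro h i j
    exact congrFun (congrFun (congrArg (Units.val : GL (Fin n) (Fpbar p) → _) h) i) j
  · intro h
    exact Units.ext (Matrix.ext h)

theorem finite_pow_eq_self (m : ℕ) : {a : Fpbar p | a ^ p ^ m.factorial = a}.Finite := by
  have h1 : 1 < p ^ m.factorial :=
    Nat.one_lt_pow (Nat.factorial_ne_zero m) (Fact.out : p.Prime).one_lt
  refine (Polynomial.finite_setOfPred_isRoot
    (FiniteField.X_pow_card_sub_X_ne_zero (Fpbar p) h1)).subset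
    fun a ha => ?_
  simpa [sub_eq_zero] using ha

theorem finite_finiteUnipotent [NeZero n] (m : ℕ) : Finite (finiteUnipotent p n m) := by
  have := (finite_pow_eq_self (p := p) m).to_subtype
  refine Finite.of_injective
    (fun (u : finiteUnipotent p n m) (i j : Fin n) =>
      (⟨u.val.val i j, (mem_finiteUnipotent.1 u.prop).2 i j⟩ :
        {a : Fpbar p | a ^ p ^ m.factorial = a})) fun u v h => ?_
  refine Subtype.ext (Units.ext (Matrix.ext fun i j => ?_))
  exact congrArg Subtype.val (congrFun (congrFun h i) j)

theorem isPGroup_finiteUnipotent [NeZero n] (m : ℕ) : IsPGroup p (finiteUnipotent p n m) :=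
  fun u => ⟨n, Subtype.ext (unipotent_pow_eq_one (mem_finiteUnipotent.1 u.prop).1.1
    (mem_finiteUnipotent.1 u.prop).1.2)⟩

theorem pow_pow_mul_eq_self {a : Fpbar p} {d : ℕ} (h : a ^ p ^ d = a) (e : ℕ) :
    a ^ p ^ (d * e) = a := by
  induction e with
  | zero => simp
  | succ e ih => rw [Nat.mul_succ, pow_add, pow_mul, ih, h]

theorem exists_pow_pow_eq_self (a : Fpbar p) : ∃ d, 0 < d ∧ a ^ p ^ d = a := by
  have hintegral : IsIntegral (ZMod p) a := Algebra.IsIntegral.isIntegral a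
  have h1 : FiniteDimensional (ZMod p) (IntermediateField.adjoin (ZMod p) {a}) :=
    IntermediateField.adjoin.finiteDimensional hintegral
  have h2 : Finite (IntermediateField.adjoin (ZMod p) {a}) := Module.finite_of_finite (ZMod p)
  have := Fintype.ofFinite (IntermediateField.adjoin (ZMod p) {a})
  refine ⟨Module.finrank (ZMod p) (IntermediateField.adjoin (ZMod p) {a}), Module.finrank_pos, ?_⟩
  have h3 := FiniteField.pow_card (IntermediateField.AdjoinSimple.gen (ZMod p) a)
  rw [Module.card_eq_pow_finrank (K := ZMod p), ZMod.card] at h3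
  have h4 := congrArg (algebraMap _ (Fpbar p)) h3
  rwa [map_pow, IntermediateField.AdjoinSimple.algebraMap_gen] at h4

/-- The factorials turn the divisibility order of finite fields into a chain that exhausts F̄_p. -/
theorem finiteUnipotent_mono [NeZero n] {m m' : ℕ} (h : m ≤ m') :
    finiteUnipotent p n m ≤ finiteUnipotent p n m' := by
  intro u hu
  rw [mem_finiteUnipotent] at hu ⊢
  obtain ⟨e, he⟩ := Nat.factorial_dvd_factorial h
  exact ⟨hu.1, fun i j => by rw [he]; exact pow_pow_mul_eq_self (hu.2 i j) e⟩

theorem exists_mem_finiteUnipotent [NeZero n] {u : GL (Fin n) (Fpbar p)} (hu : u ∈ unipotent p n)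
    (m : ℕ) : ∃ m', m ≤ m' ∧ u ∈ finiteUnipotent p n m' := by
  choose d hd0 hd using fun ij : Fin n × Fin n => exists_pow_pow_eq_self (u.val ij.1 ij.2)
  refine ⟨m + ∑ ij, d ij, Nat.le_add_right _ _, mem_finiteUnipotent.2 ⟨hu, fun i j => ?_⟩⟩
  have h1 : d (i, j) ≤ m + ∑ ij, d ij :=
    (Finset.single_le_sum (fun _ _ => Nat.zero_le _) (Finset.mem_univ (i, j))).trans
      (Nat.le_add_left _ _)
  obtain ⟨e, he⟩ := Nat.dvd_factorial (hd0 (i, j)) h1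
  rw [he]
  exact pow_pow_mul_eq_self (hd (i, j)) e

/-- The unipotent group is an increasing union of finite p-groups. Their fixed spaces in S are
nonzero, decreasing and finite-dimensional, hence eventually constant. -/
theorem exists_unipotent_fixed [NeZero n]
    {S : Submodule (Fpbar p) (GL (Fin n) (Fpbar p) → Fpbar p)} [FiniteDimensional (Fpbar p) S]
    (hS : IsTranslationStable S) (hS0 : S ≠ ⊥) :
    ∃ f ∈ S, f ≠ 0 ∧ ∀ u ∈ unipotent p n, ∀ x, f (x * u) = f x := by
  let F (m : ℕ) : Submodule (Fpbar p) (GL (Fin n) (Fpbar p) → Fpbar p) :=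
    S ⊓ ⨅ u ∈ finiteUnipotent p n m, LinearMap.ker (rightTranslation p n u - 1)
  have hF : ∀ m f, f ∈ F m ↔ f ∈ S ∧ ∀ u ∈ finiteUnipotent p n m,
      rightTranslation p n u f = f := fun m f => by
    simp only [F, Submodule.mem_inf, Submodule.mem_iInf, LinearMap.mem_ker, LinearMap.sub_apply,
      Module.End.one_apply, sub_eq_zero]
  have hfd : ∀ m, FiniteDimensional (Fpbar p) (F m) := fun m =>
    Submodule.finiteDimensional_of_le inf_le_left
  obtain ⟨m, hm⟩ : ∃ m, ∀ m', Module.finrank (Fpbar p) (F m) ≤ Module.finrank (Fpbar p) (F m') :=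
    ⟨Function.argmin fun m => Module.finrank (Fpbar p) (F m), fun m' =>
      Function.argmin_le (fun m => Module.finrank (Fpbar p) (F m)) m'⟩
  have := finite_finiteUnipotent (p := p) (n := n) m
  obtain ⟨f, hf, hf0, hfix⟩ := exists_fixed_of_isPGroup (isPGroup_finiteUnipotent m) hS hS0
  refine ⟨f, hf, hf0, fun u hu x => ?_⟩
  obtain ⟨m', hmm', hu'⟩ := exists_mem_finiteUnipotent hu m
  have hle : F m' ≤ F m := fun f hf => by
    rw [hF] at hf ⊢
    exact ⟨hf.1, fun u hu => hf.2 u (finiteUnipotent_mono hmm' hu)⟩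
  have heq := Submodule.eq_of_le_of_finrank_le hle (hm m')
  have hmem : f ∈ F m' := by
    rw [heq, hF]
    exact ⟨hf, hfix⟩
  exact congrFun (((hF m' f).1 hmem).2 u hu') x

end Unipotent

end GaloisHecke

namespace GaloisHecke

section Contravariant

variable {p : ℕ} [Fact p.Prime] {n : ℕ}

/-! ### The contravariant form -/

/-- By density take x = βu in the big cell, where h(βu) = β^b h(1). Then ᵗx = ᵗu ᵗβ with ᵗu lower
unipotent and ᵗβ the diagonal D of β times an upper unipotent matrix, so h(ᵗx) has the same value.
-/
theorem highest_apply_transpose [NeZero n] {b : Fin n → ℤ}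
    {h : GL (Fin n) (Fpbar p) → Fpbar p} (hb : h ∈ dualWeyl b)
    (hu : ∀ u ∈ unipotent p n, ∀ x, h (x * u) = h x) (x : GL (Fin n) (Fpbar p)) :
    h (transposeGL x) = h x := by
  have hreg : (fun x => h (transposeGL x)) - h ∈ regularFunctions p n :=
    sub_mem (transposeGL_mem_regularFunctions hb.1) hb.1
  refine sub_eq_zero.1 (congrFun (eq_zero_of_forall_isBigCell hreg ?_) x)
  rintro _ ⟨β, u, hβ, hu0, hu1, rfl⟩
  have hdiag : ∀ i, β.val i i ≠ 0 := by
    have h1 : β.val.det = ∏ i, β.val i i := Matrix.det_of_isLowerTriangular β.val hβ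
    have h2 : β.val.det ≠ 0 := β.det.ne_zero
    rw [h1, Finset.prod_ne_zero_iff] at h2
    exact fun i => h2 i (Finset.mem_univ i)
  have hdet : (Matrix.diagonal fun i => β.val i i).det ≠ 0 := by
    rw [Matrix.det_diagonal]
    exact Finset.prod_ne_zero_iff.2 fun i _ => hdiag i
  let D : GL (Fin n) (Fpbar p) := Matrix.GeneralLinearGroup.mkOfDetNeZero _ hdet
  have hD : D.val = Matrix.diagonal fun i => β.val i i := rfl
  have hDu : D⁻¹ * transposeGL β ∈ unipotent p n := by
    have h1 : (D⁻¹).val = Matrix.diagonal fun i => (β.val i i)⁻¹ := by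
      rw [← Units.val_inj (a := D⁻¹) |>.2 rfl]
      refine (Units.eq_inv_of_mul_eq_one_left (u := D) ?_).symm
      rw [hD, Matrix.diagonal_mul_diagonal, ← Matrix.diagonal_one]
      congr 1
      ext i
      exact mul_inv_cancel₀ (hdiag i)
    rw [mem_unipotent, Units.val_mul, h1, transposeGL_val]
    refine ⟨fun i j hij => ?_, fun i => ?_⟩
    · rw [Matrix.diagonal_mul, Matrix.transpose_apply, hβ j i hij, mul_zero]
    · rw [Matrix.diagonal_mul, Matrix.transpose_apply, inv_mul_cancel₀ (hdiag i)]
  have h1 : h (transposeGL (β * u)) = (∏ i, β.val i i ^ b i) * h 1 := by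
    rw [transposeGL_mul, hb.2 (transposeGL u) _ fun i j hij => hu0 j i hij,
      ← mul_inv_cancel_left D (transposeGL β), hu _ hDu, ← mul_one D,
      hb.2 D 1 fun i j hij => Matrix.diagonal_apply_ne _ hij.ne]
    simp [transposeGL_val, hu1, hD]
  have h2 : h (β * u) = (∏ i, β.val i i ^ b i) * h 1 := by
    rw [hu u ⟨hu0, hu1⟩, ← mul_one β, hb.2 β 1 hβ, mul_one]
  rw [Pi.sub_apply, h1, h2, sub_self]

/-- A simple submodule of a dual Weyl module, twisted by the automorphism `ᵗx⁻¹`, is isomorphic to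
its dual. -/
theorem exists_contravariant [NeZero n] {b : Fin n → ℤ}
    {S : Submodule (Fpbar p) (GL (Fin n) (Fpbar p) → Fpbar p)} [FiniteDimensional (Fpbar p) S]
    (hb : S ≤ dualWeyl b) (hS : IsTranslationStable S) (hS0 : S ≠ ⊥)
    (hsimple : ∀ S' ≤ S, IsTranslationStable S' → S' = ⊥ ∨ S' = S) :
    ∃ e : S ≃ₗ[Fpbar p] Module.Dual (Fpbar p) S, ∀ (g : GL (Fin n) (Fpbar p)) (f f' : S),
      e ⟨rightTranslation p n g f, hS f f.prop g⟩ f' =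
        e f ⟨rightTranslation p n (transposeGL g) f', hS f' f'.prop _⟩ := by
  obtain ⟨h, hhS, hh0, hhu⟩ := exists_unipotent_fixed hS hS0
  have hsymm := highest_apply_transpose (hb hhS) hhu
  -- The form is to satisfy ⟨v g, f⟩ = f(ᵗg). It is defined first on formal sums of translates of h,
  -- through Φ and Ψ, and then descends to S.
  let v (g : GL (Fin n) (Fpbar p)) : S := ⟨rightTranslation p n g h, hS h hhS g⟩
  let ev (g : GL (Fin n) (Fpbar p)) : Module.Dual (Fpbar p) S :=
    (LinearMap.proj (transposeGL g)).comp S.subtype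
  let Φ : (GL (Fin n) (Fpbar p) →₀ Fpbar p) →ₗ[Fpbar p] S := Finsupp.linearCombination _ v
  let Ψ : (GL (Fin n) (Fpbar p) →₀ Fpbar p) →ₗ[Fpbar p] Module.Dual (Fpbar p) S :=
    Finsupp.linearCombination _ ev
  have hspan : Submodule.span (Fpbar p) (Set.range fun g => rightTranslation p n g h) = S := by
    refine (hsimple _ ?_ ?_).resolve_left ?_
    · refine Submodule.span_le.2 ?_
      rintro _ ⟨g, rfl⟩
      exact (v g).prop
    · intro f hf g
      have : Submodule.span (Fpbar p) (Set.range fun g => rightTranslation p n g h) ≤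
          (Submodule.span (Fpbar p) (Set.range fun g => rightTranslation p n g h)).comap
            (rightTranslation p n g) := by
        refine Submodule.span_le.2 ?_
        rintro _ ⟨g', rfl⟩
        refine Submodule.subset_span ⟨g * g', ?_⟩
        change rightTranslation p n (g * g') h = _
        rw [map_mul]
        rfl
      exact this hf
    · intro hbot
      rw [Submodule.span_eq_bot] at hbot
      refine hh0 (hbot h ⟨1, ?_⟩)
      change rightTranslation p n 1 h = h
      rw [map_one]
      rfl
  have hΦ : Function.Surjective Φ := by
    rw [← LinearMap.range_eq_top, Finsupp.range_linearCombination]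
    refine Submodule.map_injective_of_injective S.injective_subtype ?_
    rw [Submodule.map_span, ← Set.range_comp, Submodule.map_top, Submodule.range_subtype]
    exact hspan
  have hΦv : ∀ c x, (Φ c : GL (Fin n) (Fpbar p) → Fpbar p) x = c.sum fun g a => a * h (x * g) := by
    intro c x
    change ((LinearMap.proj x).comp S.subtype) (Φ c) = _
    rw [Finsupp.linearCombination_apply, map_finsuppSum]
    rfl
  have hΨv : ∀ c f, Ψ c f = c.sum fun g a => a * (f : GL (Fin n) (Fpbar p) → Fpbar p)
      (transposeGL g) := by
    intro c f
    rw [Finsupp.linearCombination_apply, Finsupp.sum, LinearMap.sum_apply]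
    rfl
  -- Symmetry of the form: h(ᵗg x) = h(ᵗx g) by invariance of h under transposition.
  have hcross : ∀ c x, Ψ c (v x) = (Φ c : GL (Fin n) (Fpbar p) → Fpbar p) (transposeGL x) := by
    intro c x
    rw [hΨv, hΦv]
    refine Finsupp.sum_congr fun g _ => ?_
    change c g * h (transposeGL g * x) = _
    rw [← hsymm (transposeGL g * x), transposeGL_mul, transposeGL_transposeGL]
  -- One direction is well-definedness on S, the other nondegeneracy; thus any linear section s of Φ
  -- gives the same map Ψ ∘ s.
  have hker : ∀ c, Φ c = 0 ↔ Ψ c = 0 := by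
    intro c
    constructor
    · intro hc
      refine LinearMap.ext fun f => ?_
      obtain ⟨c', rfl⟩ := hΦ f
      induction c' using Finsupp.induction_linear with
      | zero => rw [map_zero, map_zero, map_zero]
      | add c₁ c₂ h₁ h₂ => rw [map_add, map_add, h₁, h₂, map_add]
      | single g a =>
        rw [Finsupp.linearCombination_single, map_smul, hcross, hc]
        simp
    · intro hc
      ext x
      have := hcross c (transposeGL x)
      rw [hc, transposeGL_transposeGL] at this
      exact this.symm
  obtain ⟨s, hs⟩ := Φ.exists_rightInverse_of_surjective (LinearMap.range_eq_top.2 hΦ)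
  have hs' : ∀ f, Φ (s f) = f := fun f => LinearMap.congr_fun hs f
  have he : ∀ c, Ψ (s (Φ c)) = Ψ c := by
    intro c
    rw [← sub_eq_zero, ← map_sub, ← hker, map_sub, hs', sub_self]
  have hinj : Function.Injective (Ψ.comp s) := by
    rw [injective_iff_map_eq_zero]
    intro f hf
    rw [← hs' f]
    exact (hker _).2 hf
  refine ⟨LinearMap.linearEquivOfInjective (Ψ.comp s) hinj Subspace.dual_finrank_eq.symm,
    fun g f f' => ?_⟩
  rw [LinearMap.linearEquivOfInjective_apply, LinearMap.linearEquivOfInjective_apply,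
    LinearMap.comp_apply, LinearMap.comp_apply]
  obtain ⟨c, rfl⟩ := hΦ f
  have h1 : (⟨rightTranslation p n g (Φ c), hS _ (Φ c).prop g⟩ : S) =
      Φ (c.mapDomain fun x => g * x) := by
    ext x
    rw [hΦv, Finsupp.sum_mapDomain_index (fun _ => zero_mul _) fun _ _ _ => add_mul _ _ _]
    change (Φ c : GL (Fin n) (Fpbar p) → Fpbar p) (x * g) = _
    rw [hΦv]
    exact Finsupp.sum_congr fun _ _ => by rw [mul_assoc]
  rw [h1, he, he, hΨv, hΨv,
    Finsupp.sum_mapDomain_index (fun _ => zero_mul _) fun _ _ _ => add_mul _ _ _]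
  refine Finsupp.sum_congr fun x _ => ?_
  rw [transposeGL_mul]
  rfl

end Contravariant

/-! ### Duality for the modules `F(b)` -/

section ModuleF

variable {p : ℕ} [Fact p.Prime] {n : ℕ} {V V' : Type} [AddCommGroup V] [Module (Fpbar p) V]
  [AddCommGroup V'] [Module (Fpbar p) V']
  {σ : Representation (Fpbar p) (GL (Fin n) (ZMod p)) V}
  {σ' : Representation (Fpbar p) (GL (Fin n) (ZMod p)) V'} {b : Fin n → ℤ}

theorem glMap_transposeInv (g : GL (Fin n) (ZMod p)) :
    glMap p n (transposeInv _ g) = transposeInv _ (glMap p n g) :=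
  Units.ext rfl

/-- The contravariant form moves g to ᵗg in the other variable; with ᵗg⁻¹ in place of g this is the
dual action. -/
theorem IsModuleF.exists_dual_equiv [NeZero n] [FiniteDimensional (Fpbar p) V]
    (h : IsModuleF b σ) : ∃ e : V ≃ₗ[Fpbar p] Module.Dual (Fpbar p) V,
      ∀ g v, e (σ (transposeInv _ g) v) = σ.dual g (e v) := by
  obtain ⟨S, hSb, hS0, hS, hsimple, e, he⟩ := h
  have := Module.Finite.equiv e
  obtain ⟨B, hB⟩ := exists_contravariant hSb hS hS0 hsimple
  refine ⟨(e.trans B).trans e.dualMap, fun g v => LinearMap.ext fun w => ?_⟩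
  have he' : ∀ g v, e (σ g v) = ⟨rightTranslation p n (glMap p n g) (e v), hS _ (e v).prop _⟩ :=
    fun g v => Subtype.ext (funext fun x => he g v x)
  change B (e (σ (transposeInv _ g) v)) (e w) = B (e v) (e (σ g⁻¹ w))
  rw [he', hB, he']
  congr 4

theorem IsModuleF.of_equiv (h : IsModuleF b σ) (e : V' ≃ₗ[Fpbar p] V)
    (he : ∀ g v, e (σ' g v) = σ g (e v)) : IsModuleF b σ' := by
  obtain ⟨S, hSb, hS0, hS, hsimple, e', he'⟩ := h
  refine ⟨S, hSb, hS0, hS, hsimple, e.trans e', fun g v x => ?_⟩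
  rw [LinearEquiv.trans_apply, LinearEquiv.trans_apply, he, he']

/-- Transport of `F(b)` along an automorphism of the space of functions on `GL_n` that is
compatible with translations up to an automorphism of `GL_n`. -/
theorem IsModuleF.transport {b' : Fin n → ℤ} (h : IsModuleF b σ)
    (E : (GL (Fin n) (Fpbar p) → Fpbar p) ≃ₗ[Fpbar p] (GL (Fin n) (Fpbar p) → Fpbar p))
    (hE : ∀ f ∈ dualWeyl b, E f ∈ dualWeyl b')
    (θ : GL (Fin n) (Fpbar p) ≃ GL (Fin n) (Fpbar p))
    (χ : GL (Fin n) (Fpbar p) → (Fpbar p)ˣ)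
    (hθ : ∀ f g x, E f (x * g) = (χ g : Fpbar p) * E (rightTranslation p n (θ g) f) x)
    {σ' : Representation (Fpbar p) (GL (Fin n) (ZMod p)) V}
    (hσ' : ∀ g v, ∃ g', glMap p n g' = θ (glMap p n g) ∧
      σ' g v = (χ (glMap p n g) : Fpbar p) • σ g' v) :
    IsModuleF b' σ' := by
  obtain ⟨S, hSb, hS0, hS, hsimple, e, he⟩ := h
  have hθ' : ∀ f g, (fun x => E f (x * g)) =
      (χ g : Fpbar p) • E (rightTranslation p n (θ g) f) := fun f g => funext fun x => hθ f g x
  refine ⟨S.map E.toLinearMap, ?_, ?_, ?_, ?_, e.trans (E.submoduleMap S), ?_⟩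
  · rintro _ ⟨f, hf, rfl⟩
    exact hE f (hSb hf)
  · intro hbot
    refine hS0 ((Submodule.eq_bot_iff S).2 fun f hf => ?_)
    exact E.map_eq_zero_iff.1 ((Submodule.eq_bot_iff _).1 hbot _ ⟨f, hf, rfl⟩)
  · rintro _ ⟨f, hf, rfl⟩ g
    change (fun x => E f (x * g)) ∈ _
    rw [hθ']
    exact Submodule.smul_mem _ _ ⟨_, hS f hf (θ g), rfl⟩
  · intro S' hS' hst
    have hst' : IsTranslationStable (S'.map E.symm.toLinearMap) := by
      rintro _ ⟨f', hf', rfl⟩ g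
      obtain ⟨f, rfl⟩ := E.surjective f'
      obtain ⟨g, rfl⟩ := θ.surjective g
      have h1 := hst _ hf' g
      rw [hθ'] at h1
      have h2 := (Submodule.smul_mem_iff _ (χ g).ne_zero).1 h1
      refine ⟨_, h2, ?_⟩
      change E.symm (E _) = _
      rw [E.symm_apply_apply]
      change _ = fun x => (E.symm (E f)) (x * θ g)
      rw [E.symm_apply_apply]
      rfl
    have hle : S'.map E.symm.toLinearMap ≤ S := by
      rintro _ ⟨f', hf', rfl⟩
      obtain ⟨f, hf, rfl⟩ := hS' hf'
      change E.symm (E f) ∈ S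
      rwa [E.symm_apply_apply]
    have hback : (S'.map E.symm.toLinearMap).map E.toLinearMap = S' := by
      rw [← Submodule.map_comp]
      convert Submodule.map_id S'
      exact LinearMap.ext fun f => E.apply_symm_apply f
    rcases hsimple _ hle hst' with h1 | h1
    · left
      rw [← hback, h1, Submodule.map_bot]
    · right
      rw [← hback, h1]
  · intro g v x
    obtain ⟨g', hg', hv⟩ := hσ' g v
    change E (e (σ' g v)) x = E (e v) (x * glMap p n g)
    rw [hv, map_smul, Submodule.coe_smul, map_smul, hθ, ← hg']
    have h1 : (e (σ g' v) : GL (Fin n) (Fpbar p) → Fpbar p) =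
        rightTranslation p n (glMap p n g') (e v) := funext fun x => he g' v x
    rw [h1]
    rfl

/-- The isomorphism is f ↦ f(w₀ ᵗx⁻¹). Inverse transpose makes β upper triangular with inverted
diagonal, and w₀ makes it lower triangular again while reversing the diagonal. -/
theorem IsModuleF.comp_transposeInv (h : IsModuleF b σ) :
    IsModuleF (fun i => -b i.rev) (σ.comp (transposeInv (ZMod p))) := by
  let θ : GL (Fin n) (Fpbar p) ≃ GL (Fin n) (Fpbar p) :=
    { toFun := transposeInv _
      invFun := transposeInv _
      left_inv := transposeInv_transposeInv
      right_inv := transposeInv_transposeInv }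
  refine h.transport (LinearEquiv.funCongrLeft _ _ (θ.trans (Equiv.mulLeft (revGL n _)))) ?_ θ 1
    ?_ fun g v => ⟨transposeInv _ g, glMap_transposeInv g, by simp⟩
  · rintro f ⟨hreg, hf⟩
    refine ⟨rev_transposeInv_mem_regularFunctions hreg, fun β x hβ => ?_⟩
    change f (revGL n _ * transposeInv _ (β * x)) = _ * f (revGL n _ * transposeInv _ x)
    set β' := revGL n _ * transposeInv _ β * (revGL n _)⁻¹ with hβ'
    have h1 : revGL n _ * transposeInv _ (β * x) = β' * (revGL n _ * transposeInv _ x) := by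
      rw [map_mul, hβ']
      group
    have hinv : ∀ i j, i < j → (β⁻¹).val i j = 0 := by
      have : Invertible β.val := β.invertible
      have h2 := Matrix.blockTriangular_inv_of_blockTriangular (M := β.val)
        (b := OrderDual.toDual) fun i j hij => hβ i j hij
      intro i j hij
      rw [Matrix.coe_units_inv]
      exact h2 hij
    have hdiag : ∀ i, (β⁻¹).val i i = (β.val i i)⁻¹ := by
      intro i
      have h2 : (β.val * (β⁻¹).val) i i = 1 := by
        rw [← Units.val_mul, mul_inv_cancel, Units.val_one, Matrix.one_apply_eq]
      rw [Matrix.mul_apply, Finset.sum_eq_single i] at h2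
      · exact eq_inv_of_mul_eq_one_right h2
      · intro j _ hj
        rcases lt_or_gt_of_ne hj with h3 | h3
        · rw [hinv j i h3, mul_zero]
        · rw [hβ i j h3, zero_mul]
      · simp
    rw [h1, hf]
    · congr 1
      rw [← Equiv.prod_comp Fin.revPerm fun i => β.val i i ^ (-b i.rev)]
      refine Finset.prod_congr rfl fun i _ => ?_
      rw [hβ', revGL_conj_apply, transposeInv_val, Matrix.transpose_apply, hdiag, Fin.revPerm_apply,
        Fin.rev_rev, zpow_neg, inv_zpow]
    · intro i j hij
      rw [hβ', revGL_conj_apply, transposeInv_val, Matrix.transpose_apply]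
      exact hinv _ _ (Fin.rev_lt_rev.2 hij)
  · intro f g x
    change f (revGL n _ * transposeInv _ (x * g)) =
      1 * f (revGL n _ * transposeInv _ x * transposeInv _ g)
    rw [one_mul, map_mul, mul_assoc]

/-- Multiplication of functions by det^K shifts the weight by K, whereas over F_p the character
det^K depends only on K modulo p - 1. This freedom makes the dual weight p-restricted. -/
theorem IsModuleF.twist_det (h : IsModuleF b σ) {K K' : ℤ} (hK : K ≡ K' [ZMOD (p : ℤ) - 1]) :
    IsModuleF (fun i => b i + K) (twist (detChar p n ^ K') σ) := by
  have hdet0 : ∀ x : GL (Fin n) (Fpbar p), x.val.det ≠ 0 := fun x => x.det.ne_zero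
  let E : (GL (Fin n) (Fpbar p) → Fpbar p) ≃ₗ[Fpbar p] (GL (Fin n) (Fpbar p) → Fpbar p) :=
    { toFun f x := x.val.det ^ K * f x
      invFun f x := x.val.det ^ (-K) * f x
      map_add' f g := funext fun x => mul_add _ _ _
      map_smul' a f := funext fun x => mul_left_comm _ _ _
      left_inv f := funext fun x => by
        change _ * (_ * f x) = f x
        rw [← mul_assoc, ← zpow_add₀ (hdet0 x), neg_add_cancel, zpow_zero, one_mul]
      right_inv f := funext fun x => by
        change _ * (_ * f x) = f x
        rw [← mul_assoc, ← zpow_add₀ (hdet0 x), add_neg_cancel, zpow_zero, one_mul] }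
  refine h.transport E ?_ (Equiv.refl _) (fun g => Matrix.GeneralLinearGroup.det g ^ K) ?_
    fun g v => ⟨g, rfl, ?_⟩
  · rintro f ⟨hreg, hf⟩
    refine ⟨mul_mem (det_zpow_mem_regularFunctions K) hreg, fun β x hβ => ?_⟩
    change (β * x).val.det ^ K * f (β * x) =
      (∏ i, β.val i i ^ (b i + K)) * (x.val.det ^ K * f x)
    rw [hf β x hβ, Units.val_mul, Matrix.det_mul, mul_zpow,
      Matrix.det_of_isLowerTriangular β.val hβ, ← Finset.prod_zpow]
    have h1 : ∀ i, β.val i i ≠ 0 := by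
      have h2 := hdet0 β
      rw [Matrix.det_of_isLowerTriangular β.val hβ, Finset.prod_ne_zero_iff] at h2
      exact fun i => h2 i (Finset.mem_univ i)
    have h3 : ∏ i, β.val i i ^ (b i + K) = (∏ i, β.val i i ^ b i) * ∏ i, β.val i i ^ K := by
      rw [← Finset.prod_mul_distrib]
      exact Finset.prod_congr rfl fun i _ => zpow_add₀ (h1 i) _ _
    rw [h3]
    ring
  · intro f g x
    change (x * g).val.det ^ K * f (x * g) =
      ((Matrix.GeneralLinearGroup.det g ^ K : (Fpbar p)ˣ) : Fpbar p) * (x.val.det ^ K * f (x * g))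
    rw [Units.val_mul, Matrix.det_mul, mul_zpow, Units.val_zpow_eq_zpow_val]
    change _ = g.val.det ^ K * _
    ring
  · change ((detChar p n ^ K') g : Fpbar p) • σ g v = _
    congr 2
    rw [MonoidHom.zpow_apply]
    have h1 : Matrix.GeneralLinearGroup.det (glMap p n g) = detChar p n g :=
      Units.ext (RingHom.map_det (algebraMap (ZMod p) (Fpbar p)) g.val).symm
    have h2 : detChar p n g ^ ((p : ℤ) - 1) = 1 := by
      have h3 : (Matrix.GeneralLinearGroup.det g) ^ (p - 1) = 1 :=
        ZMod.units_pow_card_sub_one_eq_one p _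
      have h4 : ((p : ℤ) - 1) = ((p - 1 : ℕ) : ℤ) := by
        rw [Nat.cast_sub (Fact.out : p.Prime).one_lt.le, Nat.cast_one]
      rw [h4, zpow_natCast, detChar, MonoidHom.comp_apply, ← map_pow, h3, map_one]
    obtain ⟨t, ht⟩ := hK.dvd
    rw [h1, show K' = K + ((p : ℤ) - 1) * t by linarith, zpow_add, zpow_mul, h2, one_zpow, mul_one]

/-- With indices from 0, reversing and negating a_i - (n-1-i) gives -a_{n-1-i} + i, and subtracting
n - 1 leaves the shift -(n-1-i). -/
theorem IsModuleFPrime.dualWeight [NeZero n] [FiniteDimensional (Fpbar p) V] {a : Fin n → ℤ}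
    (h : IsModuleFPrime (fun i => a i - ((n : ℤ) - 1 - (i : ℕ))) σ) :
    IsModuleFPrime (fun i => -a i.rev - ((n : ℤ) - 1 - (i : ℕ))) (dualWeight σ) := by
  obtain ⟨b, hb, hab, hF⟩ := h
  obtain ⟨e, he⟩ := hF.exists_dual_equiv
  have hp : (0 : ℤ) < (p : ℤ) - 1 := by
    have := (Fact.out : p.Prime).one_lt
    omega
  -- The exponent congruent to -(n-1) for which the last entry -b 0 + K is a residue between 0 and p
  -- - 2.
  set K : ℤ := b 0 + (-b 0 - ((n : ℤ) - 1)) % ((p : ℤ) - 1) with hK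
  have hKmod : K ≡ -((n : ℤ) - 1) [ZMOD (p : ℤ) - 1] := by
    have h1 : (-b 0 - ((n : ℤ) - 1)) % ((p : ℤ) - 1) ≡ -b 0 - ((n : ℤ) - 1) [ZMOD (p : ℤ) - 1] :=
      Int.mod_modEq _ _
    have h2 := h1.add_left (b 0)
    convert h2 using 1
    ring
  refine ⟨fun i => -b i.rev + K, ⟨fun i j hij => ?_, fun i hi => ?_⟩, fun i => ?_, ?_⟩
  · have := hb.step j.rev i.rev (by rw [Fin.val_rev, Fin.val_rev]; omega)
    constructor <;> linarith [this.1, this.2]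
  · have hi0 : i.rev = 0 := Fin.ext (by rw [Fin.val_rev, Fin.val_zero]; omega)
    have h1 := Int.emod_nonneg (-b 0 - ((n : ℤ) - 1)) hp.ne'
    have h2 := Int.emod_lt_of_pos (-b 0 - ((n : ℤ) - 1)) hp
    rw [hi0, hK]
    constructor <;> linarith
  · have h1 := ((hab i.rev).neg).add hKmod.symm
    convert h1 using 1
    have h2 : ((i.rev : Fin n) : ℤ) = (n : ℤ) - 1 - (i : ℕ) := by
      rw [Fin.val_rev, Nat.cast_sub (by omega)]
      push_cast
      ring
    dsimp only
    rw [h2]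
    ring
  · refine (hF.comp_transposeInv.twist_det hKmod).of_equiv e.symm fun g v => ?_
    change e.symm (((detChar p n ^ (-((n : ℤ) - 1))) g : Fpbar p) • σ.dual g v) =
      ((detChar p n ^ (-((n : ℤ) - 1))) g : Fpbar p) • σ (transposeInv _ g) (e.symm v)
    rw [map_smul, e.symm_apply_eq.2]
    rw [he, e.apply_symm_apply]

/-- A scalar matrix is central and lower triangular, so right translation by it equals left
translation, which the weight b determines. -/
theorem IsModuleF.scalar (h : IsModuleF b σ) {g : GL (Fin n) (ZMod p)} {z : ZMod p}
    (hg : g.val = Matrix.scalar (Fin n) z) (v : V) :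
    σ g v = (∏ i, (algebraMap (ZMod p) (Fpbar p) z) ^ b i) • v := by
  obtain ⟨S, hSb, hS0, hS, hsimple, e, he⟩ := h
  refine e.injective (Subtype.ext (funext fun x => ?_))
  have h1 : (glMap p n g).val =
      Matrix.scalar (Fin n) (algebraMap (ZMod p) (Fpbar p) z) := by
    change (g.val).map (algebraMap (ZMod p) (Fpbar p)) = _
    rw [hg]
    ext i j
    simp [Matrix.diagonal_apply, apply_ite (algebraMap (ZMod p) (Fpbar p))]
  have h2 : x * glMap p n g = glMap p n g * x := by
    apply Units.ext
    rw [Units.val_mul, Units.val_mul, h1]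
    exact (Matrix.scalar_commute _ (Commute.all _) x.val).symm
  rw [he, h2, (hSb (e v).prop).2]
  · rw [map_smul, Submodule.coe_smul, Pi.smul_apply, smul_eq_mul]
    simp [h1]
  · intro i j hij
    rw [h1]
    simp [hij.ne]

end ModuleF

end GaloisHecke

/-! ### Cohomology of `Gamma0` and duality of Hecke operators -/

namespace GaloisHecke

/-! ### Cocycles and their classes -/

section Classes

open groupCohomology CategoryTheory

universe u

variable {k G H : Type u} [CommRing k] [Group G] [Group H]

theorem cocyclesMk_congr {A : Rep.{u} k G} {i : ℕ} {x y : (Fin i → G) → A} (hxy : x = y)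
    (hx : inhomogeneousCochains.d A i x = 0) (hy : inhomogeneousCochains.d A i y = 0) :
    cocyclesMk x hx = cocyclesMk y hy := by
  subst hxy
  rfl

theorem iCocycles_injective (A : Rep.{u} k G) (i : ℕ) : Function.Injective (iCocycles A i) :=
  (ModuleCat.mono_iff_injective (iCocycles A i)).1 inferInstance

theorem cocyclesMk_smul {A : Rep.{u} k G} {i : ℕ} (c : k) {x : (Fin i → G) → A}
    (hx : inhomogeneousCochains.d A i x = 0) (hcx : inhomogeneousCochains.d A i (c • x) = 0) :
    cocyclesMk (c • x) hcx = c • cocyclesMk x hx := by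
  apply iCocycles_injective
  rw [map_smul, iCocycles_mk, iCocycles_mk]

theorem d_cochainsMap {A : Rep.{u} k H} {B : Rep.{u} k G} (f : G →* H) (φ : Rep.res f A ⟶ B) (i : ℕ)
    {x : (Fin i → H) → A} (hx : inhomogeneousCochains.d A i x = 0) :
    inhomogeneousCochains.d B i (fun γ => φ.hom (x (f ∘ γ))) = 0 := by
  have h1 := (cochainsMap f φ).comm i (i + 1)
  rw [inhomogeneousCochains.d_def, inhomogeneousCochains.d_def] at h1
  have h2 := ConcreteCategory.congr_hom h1 x
  change inhomogeneousCochains.d B i _ = (cochainsMap f φ).f (i + 1)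
    (inhomogeneousCochains.d A i x) at h2
  rw [hx, map_zero] at h2
  exact h2

theorem map_π_cocyclesMk {A : Rep.{u} k H} {B : Rep.{u} k G} (f : G →* H) (φ : Rep.res f A ⟶ B)
    (i : ℕ) {x : (Fin i → H) → A} (hx : inhomogeneousCochains.d A i x = 0) :
    groupCohomology.map f φ i (π A i (cocyclesMk x hx)) =
      π B i (cocyclesMk (fun γ => φ.hom (x (f ∘ γ))) (d_cochainsMap f φ i hx)) := by
  rw [π_map_apply]
  congr 1
  apply iCocycles_injective
  rw [iCocycles_mk]
  have h1 : cocyclesMap f φ i ≫ iCocycles B i = iCocycles A i ≫ (cochainsMap f φ).f i :=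
    HomologicalComplex.cyclesMap_i _ _
  have h2 := ConcreteCategory.congr_hom h1 (cocyclesMk x hx)
  refine h2.trans ?_
  change (cochainsMap f φ).f i (iCocycles A i (cocyclesMk x hx)) = _
  rw [iCocycles_mk]
  rfl

theorem π_cocyclesMk_add_d {A : Rep.{u} k G} {i : ℕ} {x y : (Fin (i + 1) → G) → A}
    (z : (Fin i → G) → A) (hxy : y = x + inhomogeneousCochains.d A i z)
    (hx : inhomogeneousCochains.d A (i + 1) x = 0) (hy : inhomogeneousCochains.d A (i + 1) y = 0) :
    π A (i + 1) (cocyclesMk y hy) = π A (i + 1) (cocyclesMk x hx) := by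
  have h1 : cocyclesMk y hy = cocyclesMk x hx + toCocycles A i (i + 1) z := by
    apply iCocycles_injective
    rw [map_add, iCocycles_mk, iCocycles_mk, hxy]
    congr 1
    have h2 : toCocycles A i (i + 1) ≫ iCocycles A (i + 1) =
        (inhomogeneousCochains A).d i (i + 1) :=
      HomologicalComplex.toCycles_i _ _ _
    rw [inhomogeneousCochains.d_def] at h2
    exact (ConcreteCategory.congr_hom h2 z).symm
  have h3 : toCocycles A i (i + 1) ≫ π A (i + 1) = 0 :=
    HomologicalComplex.toCycles_comp_homologyπ _ _ _
  rw [h1, map_add]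
  have h4 := ConcreteCategory.congr_hom h3 z
  refine (congrArg _ h4).trans ?_
  exact add_zero _

end Classes

section Represents

variable {n : ℕ} [NeZero n] {p : ℕ} [Fact p.Prime] {N : ℕ} {V V' : Type} [AddCommGroup V]
  [Module (Fpbar p) V] [AddCommGroup V'] [Module (Fpbar p) V']
  {ε ε' : DirichletCharacter (Fpbar p) N} {σ : Representation (Fpbar p) (GL (Fin n) (ZMod p)) V}
  {σ' : Representation (Fpbar p) (GL (Fin n) (ZMod p)) V'} {i : ℕ}
  {f : (Fin (i + 1) → GL (Fin n) ℚ) → V} {α : coh ε σ i}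

theorem Represents.congr {f' : (Fin (i + 1) → GL (Fin n) ℚ) → V} (h : Represents ε σ i f α)
    (hf : restrictCochain ε σ i f' = restrictCochain ε σ i f) : Represents ε σ i f' α := by
  unfold Represents
  rw [hf]
  exact h

theorem Represents.unique {β : coh ε σ i} (h : Represents ε σ i f α)
    (h' : Represents ε σ i f β) : α = β := by
  obtain ⟨h1, rfl⟩ := h
  obtain ⟨h2, rfl⟩ := h'
  rfl

theorem Represents.smul (h : Represents ε σ i f α) (c : Fpbar p) :
    Represents ε σ i (c • f) (c • α) := by
  obtain ⟨h1, rfl⟩ := h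
  have h2 : restrictCochain ε σ i (c • f) = c • restrictCochain ε σ i f := rfl
  have h3 : inhomogeneousCochains.d (coeffRep ε σ) i (c • restrictCochain ε σ i f) = 0 := by
    rw [map_smul, h1, smul_zero]
  refine ⟨h2 ▸ h3, ?_⟩
  rw [← map_smul, ← cocyclesMk_smul c h1 h3]
  rfl

theorem Represents.map (h : Represents ε σ i f α) (θ : Gamma0 n N →* Gamma0 n N)
    (φ : Rep.res θ (coeffRep ε σ) ⟶ coeffRep ε' σ') {f' : (Fin (i + 1) → GL (Fin n) ℚ) → V'}
    (hf : ∀ γ, restrictCochain ε' σ' i f' γ = φ.hom (restrictCochain ε σ i f (θ ∘ γ))) :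
    Represents ε' σ' i f' (groupCohomology.map θ φ i α) := by
  obtain ⟨h1, rfl⟩ := h
  have h2 : restrictCochain ε' σ' i f' = fun γ => φ.hom (restrictCochain ε σ i f (θ ∘ γ)) :=
    funext hf
  refine ⟨h2 ▸ d_cochainsMap θ φ i h1, ?_⟩
  rw [map_π_cocyclesMk]
  congr 1
  exact cocyclesMk_congr h2 _ _

end Represents

/-! ### Translation invariance of cohomology classes -/

section Prism

/-- The sequence `z` with its `m`-th term removed. -/
def omitTerm {X : Type*} (m : ℕ) (z : ℕ → X) (l : ℕ) : X := if l < m then z l else z (l + 1)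

/-- The sequence `z_0, …, z_j, t z_j, t z_{j+1}, …`. -/
def prism {X : Type*} (t : X → X) (j : ℕ) (z : ℕ → X) (l : ℕ) : X :=
  if l ≤ j then z l else t (z (l - 1))

/-- The sequence `z_0, …, z_{j-1}, t z_j, t z_{j+1}, …`. -/
def mixed {X : Type*} (t : X → X) (j : ℕ) (z : ℕ → X) (l : ℕ) : X :=
  if l < j then z l else t (z l)

variable {X : Type*} (t : X → X) (z : ℕ → X) {j m : ℕ}

theorem omitTerm_prism_of_lt (h : m < j) :
    omitTerm m (prism t j z) = prism t (j - 1) (omitTerm m z) := by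
  ext l
  grind [omitTerm, prism]

theorem omitTerm_prism_self : omitTerm j (prism t j z) = mixed t j z := by
  ext l
  grind [omitTerm, prism, mixed]

theorem omitTerm_prism_succ : omitTerm (j + 1) (prism t j z) = mixed t (j + 1) z := by
  ext l
  grind [omitTerm, prism, mixed]

theorem omitTerm_prism_of_gt (h : j + 1 < m) :
    omitTerm m (prism t j z) = prism t j (omitTerm (m - 1) z) := by
  ext l
  grind [omitTerm, prism]

/-- The signed faces of the prisms: the two middle faces of the j-th prism are Q j and Q (j + 1) and
telescope, while the remaining faces assemble into prisms over the faces of the base. -/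
theorem prism_telescope {k V : Type*} [CommRing k] [AddCommGroup V] [Module k V] (i : ℕ)
    (A B : ℕ → ℕ → V) (Q : ℕ → V) (hlt : ∀ j m, m < j → A j m = B (j - 1) m)
    (hself : ∀ j, A j j = Q j) (hsucc : ∀ j, A j (j + 1) = Q (j + 1))
    (hgt : ∀ j m, j + 1 < m → A j m = B j (m - 1))
    (h0 : ∀ j < i + 1, ∑ m ∈ Finset.range (i + 2), (-1 : k) ^ m • A j m = 0) :
    ∑ m ∈ Finset.range (i + 1), (-1 : k) ^ m • ∑ j ∈ Finset.range i, (-1 : k) ^ j • B j m =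
      Q 0 - Q (i + 1) := by
  have h1 : ∀ j < i + 1, (∑ m ∈ Finset.range j, (-1 : k) ^ (j + m) • B (j - 1) m) +
      (Q j - Q (j + 1)) - ∑ m ∈ Finset.Ico (j + 1) (i + 1), (-1 : k) ^ (j + m) • B j m = 0 := by
    intro j hj
    have h2 := congrArg ((-1 : k) ^ j • ·) (h0 j hj)
    rw [smul_zero, Finset.smul_sum, Finset.range_eq_Ico,
      ← Finset.sum_Ico_consecutive _ (Nat.zero_le j) (by omega : j ≤ i + 2),
      Finset.sum_eq_sum_Ico_succ_bot (by omega : j < i + 2),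
      Finset.sum_eq_sum_Ico_succ_bot (by omega : j + 1 < i + 2),
      hself, hsucc, ← Finset.range_eq_Ico] at h2
    rw [← h2, sub_eq_add_neg, add_assoc]
    refine congrArg₂ _ (Finset.sum_congr rfl fun m hm => ?_) ?_
    · rw [smul_smul, ← pow_add, hlt j m (Finset.mem_range.1 hm)]
    · rw [← add_assoc, sub_eq_add_neg]
      refine congrArg₂ _ (congrArg₂ _ ?_ ?_) ?_
      · rw [smul_smul, ← pow_add, Even.neg_one_pow ⟨j, rfl⟩, one_smul]
      · rw [smul_smul, ← pow_add, Odd.neg_one_pow ⟨j, by ring⟩, neg_smul, one_smul]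
      · rw [← Finset.sum_neg_distrib,
          ← Finset.sum_Ico_add' (fun m => (-1 : k) ^ j • (-1 : k) ^ m • A j m) (j + 1) (i + 1) 1]
        refine Finset.sum_congr rfl fun m hm => ?_
        rw [Finset.mem_Ico] at hm
        rw [hgt j (m + 1) (by omega), Nat.add_sub_cancel, smul_smul, ← pow_add, ← add_assoc,
          pow_succ, mul_neg_one, neg_smul]
  have h2 := Finset.sum_eq_zero fun j hj => h1 j (Finset.mem_range.1 hj)
  rw [Finset.sum_sub_distrib, Finset.sum_add_distrib, Finset.sum_range_sub', Finset.sum_range_succ',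
    Finset.sum_range_succ (fun j => ∑ m ∈ Finset.Ico (j + 1) (i + 1), _), Finset.Ico_self,
    Finset.sum_empty, add_zero, Finset.range_zero, Finset.sum_empty, add_zero] at h2
  have h3 : ∑ m ∈ Finset.range (i + 1), (-1 : k) ^ m • ∑ j ∈ Finset.range i, (-1 : k) ^ j • B j m =
      ∑ j ∈ Finset.range i, (∑ m ∈ Finset.range (j + 1), (-1 : k) ^ (j + m) • B j m +
        ∑ m ∈ Finset.Ico (j + 1) (i + 1), (-1 : k) ^ (j + m) • B j m) := by
    simp_rw [Finset.smul_sum]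
    rw [Finset.sum_comm]
    refine Finset.sum_congr rfl fun j hj => ?_
    have hj' := Finset.mem_range.1 hj
    rw [Finset.range_eq_Ico, Finset.range_eq_Ico,
      Finset.sum_Ico_consecutive _ (by omega) (by omega)]
    refine Finset.sum_congr rfl fun m _ => ?_
    rw [smul_smul, ← pow_add, add_comm]
  rw [h3, Finset.sum_add_distrib]
  have h4 : ∑ j ∈ Finset.range i, ∑ m ∈ Finset.range (j + 1),
      (-1 : k) ^ (j + 1 + m) • B (j + 1 - 1) m =
      -∑ j ∈ Finset.range i, ∑ m ∈ Finset.range (j + 1), (-1 : k) ^ (j + m) • B j m := by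
    rw [← Finset.sum_neg_distrib]
    refine Finset.sum_congr rfl fun j _ => ?_
    rw [← Finset.sum_neg_distrib]
    refine Finset.sum_congr rfl fun m _ => ?_
    rw [Nat.add_sub_cancel, add_right_comm, pow_succ, mul_neg_one, neg_smul]
  rw [h4] at h2
  rw [← sub_eq_zero, ← neg_eq_zero, ← h2]
  abel

end Prism

end GaloisHecke

namespace GaloisHecke

section Translation

variable {n : ℕ} [NeZero n] {p : ℕ} [Fact p.Prime] {N : ℕ} {V : Type} [AddCommGroup V]
  [Module (Fpbar p) V] {ε : DirichletCharacter (Fpbar p) N}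
  {σ : Representation (Fpbar p) (GL (Fin n) (ZMod p)) V} {i : ℕ}

/-- Equivariance under γ_1 accounts for the first term of the inhomogeneous differential; the other
terms are omissions of a partial product. -/
theorem d_restrictCochain {g : (Fin (i + 1) → GL (Fin n) ℚ) → V}
    (hg : ∀ (γ : Gamma0 n N) (x : Fin (i + 1) → GL (Fin n) ℚ),
      g (fun j => toGLQ n p N (gammaIncl n p N γ) * x j) = coeff ε σ (gammaIncl n p N γ) (g x)) :
    inhomogeneousCochains.d (coeffRep ε σ) i (restrictCochain ε σ i g) =
      restrictCochain ε σ (i + 1) fun x =>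
        ∑ j : Fin (i + 2), (-1 : Fpbar p) ^ (j : ℕ) • g fun l => x (j.succAbove l) := by
  refine funext fun γ => ?_
  rw [inhomogeneousCochains.d_hom_apply]
  unfold restrictCochain
  refine Eq.trans ?_ (Fin.sum_univ_succ fun j : Fin (i + 2) => (-1 : Fpbar p) ^ (j : ℕ) •
    g fun l => toGLQ n p N (gammaIncl n p N (Fin.partialProd γ (j.succAbove l)))).symm
  congr 1
  · rw [Fin.val_zero, pow_zero, one_smul]
    change coeff ε σ (gammaIncl n p N (γ 0)) (g _) = _
    rw [← hg]
    congr 1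
    refine funext fun j => ?_
    rw [← map_mul, ← map_mul, Fin.zero_succAbove, Fin.partialProd_succ']
    rfl
  · refine Finset.sum_congr rfl fun j _ => ?_
    rw [Fin.partialProd_contractNth, Fin.val_succ]
    rfl

/-- The prism operator attached to a map `t`, on functions of `i + 1` variables. -/
def prismOp {X : Type*} (t : X → X) (i : ℕ) (f : (Fin (i + 2) → X) → V) (y : Fin (i + 1) → X) : V :=
  ∑ j ∈ Finset.range (i + 1), (-1 : Fpbar p) ^ j •
    f fun l => prism t j (fun m => y (Fin.ofNat (i + 1) m)) l

/-- Tuples are extended to sequences by reducing indices modulo the length; the faces only see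
indices where this changes nothing. -/
theorem omitTerm_ofNat {X : Type*} (y : Fin (i + 2) → X) (m : Fin (i + 2)) (l : Fin (i + 1)) :
    omitTerm m (fun m => y (Fin.ofNat (i + 2) m)) l = y (m.succAbove l) := by
  unfold omitTerm
  have h1 : m.succAbove l = if (l : ℕ) < m then l.castSucc else l.succ := rfl
  rw [h1]
  split_ifs
  · refine congrArg y (Fin.ext ?_)
    simp
  · refine congrArg y (Fin.ext ?_)
    simp [Nat.mod_eq_of_lt (by omega : (l : ℕ) + 1 < i + 2)]

theorem omitTerm_prism_ofNat {X : Type*} (t : X → X) (y : Fin (i + 2) → X) (m : Fin (i + 2)) (j : ℕ)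
    (l : Fin (i + 2)) (hj : j < i + 1) :
    prism t j (fun m' => y (m.succAbove (Fin.ofNat (i + 1) m'))) l =
      prism t j (omitTerm m fun m => y (Fin.ofNat (i + 2) m)) l := by
  unfold prism
  split_ifs with h
  · refine (omitTerm_ofNat y m _).symm.trans ?_
    congr 1
    exact Nat.mod_eq_of_lt (by omega)
  · refine congrArg t ((omitTerm_ofNat y m _).symm.trans ?_)
    congr 1
    exact Nat.mod_eq_of_lt (by omega)

theorem sum_cocycle_range {X : Type*} {i : ℕ} {f : (Fin (i + 1) → X) → V}
    (hf : ∀ x : Fin (i + 2) → X,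
      ∑ j : Fin (i + 2), (-1 : Fpbar p) ^ (j : ℕ) • f (fun l => x (j.succAbove l)) = 0)
    (z : ℕ → X) :
    ∑ m ∈ Finset.range (i + 2), (-1 : Fpbar p) ^ m • f (fun l => omitTerm m z l) = 0 := by
  rw [← hf fun l => z l, Finset.sum_range]
  refine Finset.sum_congr rfl fun m _ => ?_
  congr 2
  refine funext fun l => ?_
  have h1 : m.succAbove l = if (l : ℕ) < m then l.castSucc else l.succ := rfl
  rw [h1, omitTerm]
  split_ifs <;> rfl

/-- The chain homotopy between the identity and composition with t, evaluated on a cocycle. -/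
theorem prismOp_boundary {X : Type*} (t : X → X) {f : (Fin (i + 2) → X) → V}
    (hf : ∀ x : Fin (i + 3) → X,
      ∑ j : Fin (i + 3), (-1 : Fpbar p) ^ (j : ℕ) • f (fun l => x (j.succAbove l)) = 0)
    (x : Fin (i + 2) → X) :
    ∑ m : Fin (i + 2), (-1 : Fpbar p) ^ (m : ℕ) •
      prismOp (p := p) t i f (fun l => x (m.succAbove l)) =
      f (fun l => t (x l)) - f x := by
  set z : ℕ → X := fun m => x (Fin.ofNat (i + 2) m) with hz
  have hzl : ∀ l : Fin (i + 2), z l = x l := by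
    intro l
    exact congrArg x (Fin.ext (Nat.mod_eq_of_lt l.isLt))
  have h1 := prism_telescope (k := Fpbar p) (i + 1)
    (fun j m => f fun l => omitTerm m (prism t j z) l)
    (fun j m => f fun l => prism t j (omitTerm m z) l) (fun j => f fun l => mixed t j z l)
    (fun j m h => by rw [omitTerm_prism_of_lt t z h]) (fun j => by rw [omitTerm_prism_self])
    (fun j => by rw [omitTerm_prism_succ]) (fun j m h => by rw [omitTerm_prism_of_gt t z h])
    fun j _ => sum_cocycle_range hf _
  have h2 : (fun l : Fin (i + 2) => mixed t 0 z l) = fun l => t (x l) := by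
    refine funext fun l => ?_
    rw [mixed, if_neg (Nat.not_lt_zero _), hzl]
  have h3 : (fun l : Fin (i + 2) => mixed t (i + 1 + 1) z l) = x := by
    refine funext fun l => ?_
    rw [mixed, if_pos l.isLt, hzl]
  rw [h2, h3, Finset.sum_range] at h1
  rw [← h1]
  refine Finset.sum_congr rfl fun m _ => ?_
  congr 1
  refine Finset.sum_congr rfl fun j hj => ?_
  congr 2
  exact funext fun l => omitTerm_prism_ofNat t x m j l (Finset.mem_range.1 hj)

/-- Composition with a `Γ₀(N)`-equivariant map of `GL_n(ℚ)`, such as a scalar, does not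
change the class of a homogeneous cocycle. -/
theorem Represents.translate {f : (Fin (i + 1) → GL (Fin n) ℚ) → V} {α : coh ε σ i}
    (hf : IsHomogCocycle ε σ i f) (h : Represents ε σ i f α) (t : GL (Fin n) ℚ → GL (Fin n) ℚ)
    (ht : ∀ (γ : Gamma0 n N) x, t (toGLQ n p N (gammaIncl n p N γ) * x) =
      toGLQ n p N (gammaIncl n p N γ) * t x) :
    Represents ε σ i (fun x => f fun j => t (x j)) α := by
  cases i with
  | zero =>
    refine h.congr (funext fun γ => ?_)
    -- A homogeneous 0-cocycle is a constant function.
    have h1 := hf.cocycle ![t (toGLQ n p N (gammaIncl n p N (Fin.partialProd γ 0))),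
      toGLQ n p N (gammaIncl n p N (Fin.partialProd γ 0))]
    rw [Fin.sum_univ_two, Fin.val_zero, pow_zero, one_smul, Fin.val_one, pow_one, neg_smul,
      one_smul, ← sub_eq_add_neg, sub_eq_zero] at h1
    change f _ = f _
    convert h1.symm using 2
    · refine funext fun l => ?_
      rw [Fin.fin_one_eq_zero l]
      rfl
    · refine funext fun l => ?_
      rw [Fin.fin_one_eq_zero l]
      rfl
  | succ i =>
    -- Because t commutes with Γ_0(N), the homotopy is equivariant and so restricts to a genuine
    -- cochain of the group.
    have hP : ∀ (γ : Gamma0 n N) (x : Fin (i + 1) → GL (Fin n) ℚ),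
        prismOp (p := p) t i f (fun j => toGLQ n p N (gammaIncl n p N γ) * x j) =
          coeff ε σ (gammaIncl n p N γ) (prismOp (p := p) t i f x) := by
      intro γ x
      unfold prismOp
      rw [map_sum]
      refine Finset.sum_congr rfl fun j _ => ?_
      rw [map_smul, ← hf.equivariant]
      congr 2
      refine funext fun l => ?_
      unfold prism
      split_ifs
      · rfl
      · rw [ht]
    have h1 := d_restrictCochain (ε := ε) (σ := σ) hP
    simp only [prismOp_boundary t hf.cocycle] at h1
    have h2 : restrictCochain ε σ (i + 1) (fun x => f fun j => t (x j)) =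
        restrictCochain ε σ (i + 1) f + inhomogeneousCochains.d (coeffRep ε σ) i
          (restrictCochain ε σ i (prismOp (p := p) t i f)) := by
      rw [h1]
      refine funext fun γ => ?_
      change f _ = f _ + (f _ - f _)
      rw [add_sub_cancel]
    obtain ⟨h3, rfl⟩ := h
    have h4 : inhomogeneousCochains.d (coeffRep ε σ) (i + 1)
        (restrictCochain ε σ (i + 1) fun x => f fun j => t (x j)) = 0 := by
      rw [h2, map_add, h3, zero_add]
      exact CategoryTheory.ConcreteCategory.congr_hom
        (groupCohomology.inhomogeneousCochains.d_comp_d i (coeffRep ε σ)) _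
    exact ⟨h4, π_cocyclesMk_add_d _ h2 h3 h4⟩

end Translation

end GaloisHecke

namespace GaloisHecke

/-! ### The automorphism `x ↦ D ᵗx⁻¹ D⁻¹` with `D = diag(N, 1, …, 1)` -/

section LevelDual

variable {n : ℕ} {R : Type*} [CommRing R]

/-- The scalar matrix of a unit. -/
def scalarGL (n : ℕ) (z : Rˣ) : GL (Fin n) R :=
  Units.map (Matrix.scalar (Fin n)).toMonoidHom z

theorem scalarGL_val (z : Rˣ) : (scalarGL n z).val = Matrix.scalar (Fin n) (z : R) := rfl

theorem scalarGL_mul_comm (z : Rˣ) (x : GL (Fin n) R) : scalarGL n z * x = x * scalarGL n z :=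
  Units.ext (Matrix.scalar_commute _ (Commute.all _) x.val)

variable [NeZero n]

/-- The matrix `diag(u, 1, …, 1)`. -/
def levelGL (n : ℕ) [NeZero n] (u : Rˣ) : GL (Fin n) R where
  val := Matrix.diagonal fun i => if i = 0 then (u : R) else 1
  inv := Matrix.diagonal fun i => if i = 0 then ((u⁻¹ : Rˣ) : R) else 1
  val_inv := by
    rw [Matrix.diagonal_mul_diagonal, ← Matrix.diagonal_one]
    congr 1
    ext i
    split_ifs <;> simp
  inv_val := by
    rw [Matrix.diagonal_mul_diagonal, ← Matrix.diagonal_one]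
    congr 1
    ext i
    split_ifs <;> simp

/-- The automorphism `x ↦ D ᵗx⁻¹ D⁻¹` with `D = diag(u, 1, …, 1)`. -/
def levelDual (n : ℕ) [NeZero n] (u : Rˣ) : GL (Fin n) R →* GL (Fin n) R :=
  (MulAut.conj (levelGL n u)).toMonoidHom.comp (transposeInv R)

theorem levelDual_apply (u : Rˣ) (x : GL (Fin n) R) :
    levelDual n u x = levelGL n u * transposeInv R x * (levelGL n u)⁻¹ := rfl

theorem eq_scalar_mul_levelDual {u z : Rˣ} {A B : GL (Fin n) R}
    (h : B.val * (levelGL n u).val * A.valᵀ = (z : R) • (levelGL n u).val) :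
    B = scalarGL n z * levelDual n u A := by
  have h1 : B * levelGL n u * (transposeInv R A)⁻¹ = scalarGL n z * levelGL n u := by
    apply Units.ext
    rw [Units.val_mul, Units.val_mul, Units.val_mul, transposeInv_inv_val, h, scalarGL_val,
      Matrix.scalar_apply, Matrix.smul_eq_diagonal_mul]
  rw [levelDual_apply, ← mul_assoc, ← mul_assoc, ← h1]
  group

end LevelDual

/-! ### Dual pairs of integral matrices -/

section DualPair

variable {n : ℕ} [NeZero n] {N : ℕ}

/-- The integral matrix `diag(N, 1, …, 1)`. -/
def levelMatrix (n : ℕ) [NeZero n] (N : ℕ) : Matrix (Fin n) (Fin n) ℤ :=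
  Matrix.diagonal fun i => if i = 0 then (N : ℤ) else 1

theorem det_levelMatrix : (levelMatrix n N).det = N := by
  rw [levelMatrix, Matrix.det_diagonal, Finset.prod_ite_eq' Finset.univ 0,
    if_pos (Finset.mem_univ _)]

/-- The integral matrices `A`, `B` satisfy `B = z D ᵗA⁻¹ D⁻¹`, with `D = diag(N, 1, …, 1)`. -/
def IsLevelDualPair (N : ℕ) (z : ℤ) (A B : Matrix (Fin n) (Fin n) ℤ) : Prop :=
  B * levelMatrix n N * Aᵀ = z • levelMatrix n N

variable {z w : ℤ} {A B A' B' : Matrix (Fin n) (Fin n) ℤ}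

theorem IsLevelDualPair.symm (h : IsLevelDualPair N z A B) : IsLevelDualPair N z B A := by
  have h1 := congrArg Matrix.transpose h
  rw [Matrix.transpose_mul, Matrix.transpose_mul, Matrix.transpose_transpose, Matrix.transpose_smul,
    levelMatrix, Matrix.diagonal_transpose, ← mul_assoc] at h1
  exact h1

theorem IsLevelDualPair.mul (h : IsLevelDualPair N z A B) (h' : IsLevelDualPair N w A' B') :
    IsLevelDualPair N (z * w) (A * A') (B * B') := by
  unfold IsLevelDualPair at *
  calc B * B' * levelMatrix n N * (A * A')ᵀ = B * (B' * levelMatrix n N * A'ᵀ) * Aᵀ := by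
        rw [Matrix.transpose_mul]
        simp only [mul_assoc]
    _ = (z * w) • levelMatrix n N := by
        rw [h', Matrix.mul_smul, Matrix.smul_mul, h, smul_smul, mul_comm]

theorem mul_right_cancel_of_det_ne_zero {n : ℕ} {B B' M : Matrix (Fin n) (Fin n) ℤ} (hM : M.det ≠ 0)
    (h : B * M = B' * M) : B = B' := by
  have h1 := congrArg (· * M.adjugate) h
  simp only [mul_assoc, Matrix.mul_adjugate, Matrix.mul_smul, mul_one] at h1
  exact smul_right_injective _ hM h1

theorem IsLevelDualPair.unique [NeZero N] (hA : A.det ≠ 0) (h : IsLevelDualPair N z A B)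
    (h' : IsLevelDualPair N z A B') : B = B' := by
  refine mul_right_cancel_of_det_ne_zero (M := levelMatrix n N * Aᵀ) ?_ ?_
  · rw [Matrix.det_mul, Matrix.det_transpose, det_levelMatrix]
    exact mul_ne_zero (Nat.cast_ne_zero.2 (NeZero.ne N)) hA
  · rw [← mul_assoc, ← mul_assoc]
    exact Eq.trans h (Eq.symm h')

theorem IsLevelDualPair.det [NeZero N] (h : IsLevelDualPair N z A B) : B.det * A.det = z ^ n := by
  have h1 := congrArg Matrix.det h
  rw [Matrix.det_mul, Matrix.det_mul, Matrix.det_transpose, Matrix.det_smul, Fintype.card_fin,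
    det_levelMatrix] at h1
  have h2 : (N : ℤ) ≠ 0 := Nat.cast_ne_zero.2 (NeZero.ne N)
  exact mul_right_cancel₀ h2 (by linarith)

/-- In the (0,0) entry of B D ᵗA = zD the terms off the diagonal are divisible by N², so a
congruence modulo N survives division by N. -/
theorem IsLevelDualPair.entry [NeZero N] (h : IsLevelDualPair N z A B) (hA : FirstRow N A)
    (hB : FirstRow N B) : (A 0 0 : ZMod N) * (B 0 0 : ZMod N) = (z : ZMod N) := by
  have h1 := congrFun (congrFun h 0) 0
  rw [Matrix.mul_apply, ← Finset.add_sum_erase _ _ (Finset.mem_univ 0)] at h1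
  simp only [levelMatrix, Matrix.mul_diagonal, Matrix.transpose_apply, Matrix.smul_apply,
    Matrix.diagonal_apply_eq, if_pos, smul_eq_mul] at h1
  have h2 : (N : ℤ) * N ∣ ∑ x ∈ Finset.univ.erase (0 : Fin n),
      (B 0 x * if x = 0 then (N : ℤ) else 1) * A 0 x := by
    refine Finset.dvd_sum fun x hx => ?_
    have hx0 := Finset.ne_of_mem_erase hx
    rw [if_neg hx0, mul_one]
    exact mul_dvd_mul (hB x hx0) (hA x hx0)
  obtain ⟨t, ht⟩ := h2
  rw [ht] at h1
  have h3 : (N : ℤ) ≠ 0 := Nat.cast_ne_zero.2 (NeZero.ne N)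
  have h4 : B 0 0 * A 0 0 + N * t = z := mul_right_cancel₀ h3 (by linarith)
  rw [← h4]
  push_cast
  rw [ZMod.natCast_self, zero_mul, add_zero, mul_comm]

/-- The matrix `D ᵗA D⁻¹`, with `D = diag(N, 1, …, 1)`, is integral if `N` divides the first row
of `A` outside the diagonal. -/
theorem FirstRow.exists_levelTranspose [NeZero N] (hA : FirstRow N A) :
    ∃ B, FirstRow N B ∧ B * levelMatrix n N = levelMatrix n N * Aᵀ := by
  have h3 : (N : ℤ) ≠ 0 := Nat.cast_ne_zero.2 (NeZero.ne N)
  refine ⟨Matrix.of fun i j => if i = 0 then if j = 0 then A 0 0 else N * A j 0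
    else if j = 0 then A 0 i / N else A j i, fun j hj => ?_, ?_⟩
  · rw [Matrix.of_apply, if_pos rfl, if_neg hj]
    exact dvd_mul_right _ _
  · ext i j
    rw [levelMatrix, Matrix.mul_diagonal, Matrix.diagonal_mul, Matrix.transpose_apply,
      Matrix.of_apply]
    by_cases hi : i = 0 <;> by_cases hj : j = 0
    · subst hi hj
      simp [mul_comm]
    · subst hi
      simp [hj]
    · subst hj
      simp [hi, Int.ediv_mul_cancel (hA i hi)]
    · simp [hi, hj]

/-- Transposition alone would move the condition from the first row to the first column; conjugation
by D moves it back. The matrix is D ᵗ(γ⁻¹) D⁻¹. -/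
theorem exists_dualPair_gamma0 [NeZero N] (γ : Gamma0 n N) :
    ∃ γ' : Gamma0 n N, IsLevelDualPair N 1 γ.val.val γ'.val.val := by
  obtain ⟨B, hB, h⟩ := FirstRow.exists_levelTranspose (A := (γ⁻¹).val.val) (γ⁻¹).prop
  have hpair : IsLevelDualPair N 1 γ.val.val B := by
    unfold IsLevelDualPair
    rw [h, mul_assoc, ← Matrix.transpose_mul, one_smul]
    have h1 : γ.val.val * (γ⁻¹).val.val = 1 := by
      rw [← Matrix.SpecialLinearGroup.coe_mul, ← Subgroup.coe_mul, mul_inv_cancel]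
      rfl
    rw [h1, Matrix.transpose_one, mul_one]
  have hdet : B.det = 1 := by
    have h1 := hpair.det
    rwa [γ.val.prop, mul_one, one_pow] at h1
  exact ⟨⟨⟨B, hdet⟩, hB⟩, hpair⟩

theorem gamma0_dual_unique [NeZero N] {γ δ δ' : Gamma0 n N}
    (h₁ : IsLevelDualPair N 1 γ.val.val δ.val.val)
    (h₂ : IsLevelDualPair N 1 γ.val.val δ'.val.val) : δ = δ' :=
  Subtype.ext (Subtype.ext (h₁.unique (by rw [γ.val.prop]; exact one_ne_zero) h₂))

/-- The automorphism `γ ↦ D ᵗγ⁻¹ D⁻¹` of `Γ₀(N)`, with `D = diag(N, 1, …, 1)`. -/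
def gammaDual (n : ℕ) [NeZero n] (N : ℕ) [NeZero N] : Gamma0 n N ≃* Gamma0 n N where
  toFun γ := (exists_dualPair_gamma0 γ).choose
  invFun γ := (exists_dualPair_gamma0 γ).choose
  left_inv γ := gamma0_dual_unique (exists_dualPair_gamma0 _).choose_spec
    (exists_dualPair_gamma0 γ).choose_spec.symm
  right_inv γ := gamma0_dual_unique (exists_dualPair_gamma0 _).choose_spec
    (exists_dualPair_gamma0 γ).choose_spec.symm
  map_mul' γ δ := gamma0_dual_unique (exists_dualPair_gamma0 _).choose_spec
    ((exists_dualPair_gamma0 γ).choose_spec.mul (exists_dualPair_gamma0 δ).choose_spec)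

theorem isLevelDualPair_gammaDual [NeZero N] (γ : Gamma0 n N) :
    IsLevelDualPair N 1 γ.val.val (gammaDual n N γ).val.val :=
  (exists_dualPair_gamma0 γ).choose_spec

/-- Needed over ℚ, for the arguments of cochains, and over F_p, for the coefficients. -/
theorem IsLevelDualPair.map {R : Type*} [CommRing R] {u v : Rˣ} (hu : (u : R) = N)
    (hv : (v : R) = z) (h : IsLevelDualPair N z A B) {a b : GL (Fin n) R}
    (ha : a.val = A.map (Int.cast : ℤ → R))
    (hb : b.val = B.map (Int.cast : ℤ → R)) : b = scalarGL n v * levelDual n u a := by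
  have hD : (levelGL n u).val = (levelMatrix n N).map (Int.castRingHom R) := by
    change Matrix.diagonal _ = (Matrix.diagonal _).map _
    rw [Matrix.diagonal_map (map_zero _)]
    congr 1
    ext i
    simp [hu, apply_ite (Int.castRingHom R)]
  apply eq_scalar_mul_levelDual
  have h1 := congrArg (fun M => M.map (Int.castRingHom R)) h
  rw [Matrix.map_mul, Matrix.map_mul, ← hD] at h1
  rw [ha, hb]
  refine h1.trans ?_
  rw [hv, hD]
  ext i j
  rw [Matrix.map_apply, Matrix.smul_apply, Matrix.smul_apply, smul_eq_mul, smul_eq_mul, map_mul]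
  rfl

end DualPair

/-! ### Double cosets of diagonal matrices -/

section DoubleCosets

variable {n : ℕ} [NeZero n] {N : ℕ}

/-- The matrices `s`, `t` have the same double coset with respect to `Γ₀(N)`. -/
def SameDoubleCoset (N : ℕ) (s t : Matrix (Fin n) (Fin n) ℤ) : Prop :=
  ∃ γ δ : Gamma0 n N, t = γ.val.val * s * δ.val.val

theorem SameDoubleCoset.refl (s : Matrix (Fin n) (Fin n) ℤ) : SameDoubleCoset N s s :=
  ⟨1, 1, by simp⟩

theorem SameDoubleCoset.trans {s t u : Matrix (Fin n) (Fin n) ℤ} (h : SameDoubleCoset N s t)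
    (h' : SameDoubleCoset N t u) : SameDoubleCoset N s u := by
  obtain ⟨γ, δ, rfl⟩ := h
  obtain ⟨γ', δ', rfl⟩ := h'
  exact ⟨γ' * γ, δ * δ', by simp [mul_assoc]⟩

theorem coe_mul_inv_gamma0 (γ : Gamma0 n N) : γ.val.val * (γ⁻¹).val.val = 1 := by
  rw [← Matrix.SpecialLinearGroup.coe_mul, ← Subgroup.coe_mul, mul_inv_cancel]
  rfl

theorem coe_inv_mul_gamma0 (γ : Gamma0 n N) : (γ⁻¹).val.val * γ.val.val = 1 := by
  rw [← Matrix.SpecialLinearGroup.coe_mul, ← Subgroup.coe_mul, inv_mul_cancel]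
  rfl

theorem SameDoubleCoset.symm {s t : Matrix (Fin n) (Fin n) ℤ} (h : SameDoubleCoset N s t) :
    SameDoubleCoset N t s := by
  obtain ⟨γ, δ, rfl⟩ := h
  refine ⟨γ⁻¹, δ⁻¹, ?_⟩
  rw [← mul_assoc, ← mul_assoc, coe_inv_mul_gamma0, one_mul, mul_assoc, coe_mul_inv_gamma0, mul_one]

/-- In rows and columns i, j, with ℓh = 1 + rN, the identity is [[ℓ, N], [r, h]] diag(1, ℓ) =
diag(ℓ, 1) [[1, N], [r, 1 + rN]]. The entry N keeps both unimodular factors in Γ_0(N) even when i =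
0. -/
theorem sameDoubleCoset_swap_of_lt {ℓ : ℤ} (hℓ : IsCoprime ℓ (N : ℤ)) {v : Fin n → ℤ}
    (hv0 : ∀ i, v i ≠ 0) {i j : Fin n} (hij : i < j) (hi : v i = 1) (hj : v j = ℓ) :
    SameDoubleCoset N (Matrix.diagonal v) (Matrix.diagonal (v ∘ Equiv.swap i j)) := by
  obtain ⟨h, r', hr⟩ := hℓ
  set r := -r' with hrr
  have hr' : ℓ * h = 1 + r * N := by rw [hrr]; linarith
  have hj0 : j ≠ 0 := fun h0 => by
    subst h0
    exact absurd hij (Fin.not_lt_zero i)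
  let δ : Matrix (Fin n) (Fin n) ℤ := Matrix.transvection j i r * Matrix.transvection i j (N : ℤ)
  have hδ : ∀ k l, δ k l = (if k = l then 1 else 0) + (if k = i ∧ l = j then (N : ℤ) else 0) +
      (if k = j ∧ l = i then r else 0) + if k = j ∧ l = j then r * N else 0 := by
    intro k l
    simp only [δ, Matrix.transvection, Matrix.mul_add, Matrix.add_mul, Matrix.one_mul,
      Matrix.mul_one, Matrix.single_mul_single_same, Matrix.add_apply, Matrix.single_apply,
      Matrix.one_apply]
    grind
  let γ : Matrix (Fin n) (Fin n) ℤ := δ + Matrix.single i i (ℓ - 1) + Matrix.single j j (h - ℓ * h)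
  have hγδ : γ * Matrix.diagonal v = Matrix.diagonal (v ∘ Equiv.swap i j) * δ := by
    ext k l
    rw [Matrix.mul_diagonal, Matrix.diagonal_mul]
    simp only [γ, Matrix.add_apply, Matrix.single_apply, hδ, Function.comp_apply,
      Equiv.swap_apply_def]
    grind
  have hδdet : δ.det = 1 := by
    rw [Matrix.det_mul, Matrix.det_transvection_of_ne _ _ hij.ne',
      Matrix.det_transvection_of_ne _ _ hij.ne,
      one_mul]
  have hγdet : γ.det = 1 := by
    have h1 := congrArg Matrix.det hγδ
    rw [Matrix.det_mul, Matrix.det_mul, hδdet, mul_one, Matrix.det_diagonal,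
      Matrix.det_diagonal] at h1
    have h2 : ∏ k, (v ∘ Equiv.swap i j) k = ∏ k, v k := Equiv.prod_comp _ _
    rw [h2] at h1
    exact mul_right_cancel₀ (Finset.prod_ne_zero_iff.2 fun k _ => hv0 k) (h1.trans (one_mul _).symm)
  have hδrow : FirstRow N δ := by
    intro l hl
    rw [hδ, if_neg hl.symm, if_neg (c := 0 = j ∧ l = i) fun h => hj0 h.1.symm,
      if_neg (c := 0 = j ∧ l = j) fun h => hj0 h.1.symm]
    split_ifs <;> simp
  have hγrow : FirstRow N γ := by
    intro l hl
    have : γ 0 l = δ 0 l := by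
      simp only [γ, Matrix.add_apply, Matrix.single_apply]
      rw [if_neg fun h => hl (h.2.symm.trans h.1), if_neg fun h => hj0 h.1, add_zero, add_zero]
    rw [this]
    exact hδrow l hl
  let γ' : Gamma0 n N := ⟨⟨γ, hγdet⟩, hγrow⟩
  let δ' : Gamma0 n N := ⟨⟨δ, hδdet⟩, hδrow⟩
  refine ⟨γ', δ'⁻¹, ?_⟩
  change _ = γ * _ * _
  rw [hγδ, mul_assoc]
  have h1 : δ * (δ'⁻¹).val.val = 1 := coe_mul_inv_gamma0 δ'
  rw [h1, mul_one]

theorem sameDoubleCoset_perm {ℓ : ℤ} (hℓ : IsCoprime ℓ (N : ℤ)) (hℓ0 : ℓ ≠ 0)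
    (π : Equiv.Perm (Fin n)) {v : Fin n → ℤ} (hv : ∀ i, v i = 1 ∨ v i = ℓ) :
    SameDoubleCoset N (Matrix.diagonal v) (Matrix.diagonal (v ∘ π)) := by
  have hlt : ∀ {v : Fin n → ℤ}, (∀ i, v i = 1 ∨ v i = ℓ) → ∀ {i j : Fin n}, i < j →
      SameDoubleCoset N (Matrix.diagonal v) (Matrix.diagonal (v ∘ Equiv.swap i j)) := by
    intro v hv i j hij
    have hv0 : ∀ {v : Fin n → ℤ}, (∀ i, v i = 1 ∨ v i = ℓ) → ∀ i, v i ≠ 0 := by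
      intro v hv i
      rcases hv i with h | h <;> rw [h]
      · exact one_ne_zero
      · exact hℓ0
    by_cases heq : v i = v j
    · have : v ∘ Equiv.swap i j = v := by
        ext k
        rw [Function.comp_apply, Equiv.swap_apply_def]
        split_ifs with h1 h2
        · rw [h1, heq]
        · rw [h2, heq]
        · rfl
      rw [this]
      exact SameDoubleCoset.refl _
    · rcases hv i with hi | hi
      · exact sameDoubleCoset_swap_of_lt hℓ (hv0 hv) hij hi
          ((hv j).resolve_left fun h => heq (hi.trans h.symm))
      · have hj := (hv j).resolve_right fun h => heq (hi.trans h.symm)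
        have h1 := sameDoubleCoset_swap_of_lt (N := N) hℓ (v := v ∘ Equiv.swap i j)
          (hv0 fun k => hv _) hij (by simp [hj]) (by simp [hi])
        have h2 : (v ∘ Equiv.swap i j) ∘ Equiv.swap i j = v := by
          ext k
          simp
        rw [h2] at h1
        exact h1.symm
  induction π using Equiv.Perm.swap_induction_on generalizing v with
  | one => exact SameDoubleCoset.refl _
  | swap_mul π i j hij ih =>
    have h1 : v ∘ ⇑(Equiv.swap i j * π) = (v ∘ Equiv.swap i j) ∘ π := rfl
    rw [h1]
    refine SameDoubleCoset.trans ?_ (ih fun k => hv _)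
    rcases lt_or_gt_of_ne hij with h | h
    · exact hlt hv h
    · rw [Equiv.swap_comm]
      exact hlt hv h

theorem det_matD (n ℓ : ℕ) {k : ℕ} (hk : k ≤ n) : (matD n ℓ k).det = (ℓ : ℤ) ^ k := by
  rw [matD, Matrix.det_diagonal, Finset.prod_ite, Finset.prod_const_one, mul_one, Finset.prod_const]
  congr 1
  rw [← Finset.card_map Fin.valEmbedding]
  have : (Finset.univ.filter fun i : Fin n => n ≤ (i : ℕ) + k).map Fin.valEmbedding =
      Finset.Ico (n - k) n := by
    ext x
    simp only [Finset.mem_map, Finset.mem_filter, Finset.mem_univ, true_and, Fin.valEmbedding_apply,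
      Finset.mem_Ico]
    constructor
    · rintro ⟨i, hi, rfl⟩
      omega
    · intro hx
      exact ⟨⟨x, hx.2⟩, by simp; omega, rfl⟩
  rw [this, Nat.card_Ico]
  omega

/-- For A = γ D(ℓ,k) δ the dual matrix is γ* s δ* with s = ℓ D(ℓ,k)⁻¹. This s has its entries ℓ
first, so it is a permutation of D(ℓ,n-k) and lies in the same double coset because ℓ is prime to N.
-/
theorem exists_dualPair_matD [NeZero N] {p ℓ k m : ℕ} (hℓ0 : 0 < ℓ) (hℓ : ℓ.Coprime (p * N))
    (hkm : k + m = n) (A : DoubleCoset n p N (matD n ℓ k)) :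
    ∃ B : DoubleCoset n p N (matD n ℓ m), IsLevelDualPair N ℓ A.val.val B.val.val := by
  obtain rfl : m = n - k := by omega
  obtain ⟨A, γ, δ, hA⟩ := A
  have hℓ' : IsCoprime (ℓ : ℤ) ((p * N : ℕ) : ℤ) := Nat.isCoprime_iff_coprime.2 hℓ
  have hℓN : IsCoprime (ℓ : ℤ) (N : ℤ) :=
    Nat.isCoprime_iff_coprime.2 (hℓ.coprime_dvd_right (dvd_mul_left _ _))
  let s : Matrix (Fin n) (Fin n) ℤ :=
    Matrix.diagonal fun i => if n ≤ (i : ℕ) + k then 1 else (ℓ : ℤ)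
  have hs : IsLevelDualPair N ℓ (matD n ℓ k) s := by
    unfold IsLevelDualPair
    rw [matD, Matrix.diagonal_transpose, levelMatrix, Matrix.diagonal_mul_diagonal,
      Matrix.diagonal_mul_diagonal, ← Matrix.diagonal_smul]
    congr 1
    ext i
    rw [Pi.smul_apply, smul_eq_mul]
    split_ifs <;> ring
  have hrow : FirstRow N s := fun j hj => by
    have h0 : s 0 j = 0 := Matrix.diagonal_apply_ne _ hj.symm
    rw [h0]
    exact dvd_zero _
  have hdc : SameDoubleCoset N (matD n ℓ (n - k)) s := by
    have h1 := sameDoubleCoset_perm (N := N) hℓN (Nat.cast_ne_zero.2 hℓ0.ne') (Fin.revPerm (n := n))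
      (v := fun i => if n ≤ (i : ℕ) + (n - k) then (ℓ : ℤ) else 1) fun i => by
        split_ifs <;> simp
    refine (congrArg (SameDoubleCoset N (matD n ℓ (n - k))) ?_).mp h1
    refine congrArg Matrix.diagonal (funext fun i => ?_)
    rw [Function.comp_apply, Fin.revPerm_apply, Fin.val_rev]
    have := i.isLt
    split_ifs <;> first | rfl | omega
  obtain ⟨η, ζ, hηζ⟩ := hdc
  have hpair : IsLevelDualPair N ℓ A.val
      ((gammaDual n N γ).val.val * s * (gammaDual n N δ).val.val) := by
    rw [hA]
    have := ((isLevelDualPair_gammaDual γ).mul hs).mul (isLevelDualPair_gammaDual δ)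
    rwa [one_mul, mul_one] at this
  have hdet := hpair.det
  have hpos : (0 : ℤ) < (ℓ : ℤ) ^ n := pow_pos (Int.natCast_pos.2 hℓ0) n
  refine ⟨⟨⟨(gammaDual n N γ).val.val * s * (gammaDual n N δ).val.val, ?_, ?_, ?_⟩,
    gammaDual n N γ * η, ζ * gammaDual n N δ, ?_⟩, hpair⟩
  · exact ((gammaDual n N γ).prop.mul hrow).mul (gammaDual n N δ).prop
  · rw [← hdet] at hpos
    exact pos_of_mul_pos_left hpos A.prop.2.1.le
  · exact (hℓ'.pow_left (m := n)).of_isCoprime_of_dvd_left ⟨_, hdet.symm⟩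
  · change (gammaDual n N γ).val.val * s * (gammaDual n N δ).val.val =
      (gammaDual n N γ * η).val.val * _ * (ζ * gammaDual n N δ).val.val
    rw [hηζ]
    simp [mul_assoc]

end DoubleCosets

end GaloisHecke

namespace GaloisHecke

/-! ### Hecke operators and duality -/

theorem matD_mem_heckeMonoid {n : ℕ} [NeZero n] {p N ℓ k : ℕ} (hℓ0 : 0 < ℓ)
    (hℓ : ℓ.Coprime (p * N)) (hk : k ≤ n) : matD n ℓ k ∈ heckeMonoid n p N := by
  refine ⟨fun j hj => ?_, ?_, ?_⟩
  · rw [matD, Matrix.diagonal_apply_ne _ hj.symm]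
    exact dvd_zero _
  · rw [det_matD n ℓ hk]
    exact pow_pos (Int.natCast_pos.2 hℓ0) k
  · rw [det_matD n ℓ hk]
    exact (Nat.isCoprime_iff_coprime.2 hℓ).pow_left

theorem matD_zero (n ℓ : ℕ) : matD n ℓ 0 = 1 := by
  rw [matD, ← Matrix.diagonal_one]
  exact congrArg Matrix.diagonal (funext fun i => if_neg (by have := i.isLt; omega))

theorem matD_self (n ℓ : ℕ) : matD n ℓ n = Matrix.scalar (Fin n) (ℓ : ℤ) := by
  rw [matD, Matrix.scalar_apply]
  exact congrArg Matrix.diagonal (funext fun i => if_pos (by omega))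

section HeckeDual

variable {n : ℕ} [NeZero n] {p : ℕ} [Fact p.Prime] {N : ℕ} {V : Type} [AddCommGroup V]
  [Module (Fpbar p) V] {ε : DirichletCharacter (Fpbar p) N}
  {σ : Representation (Fpbar p) (GL (Fin n) (ZMod p)) V} {i : ℕ} {b : Fin n → ℤ}

theorem coeff_apply (A : heckeMonoid n p N) (v : V) :
    coeff ε σ A v = ε ((A.val 0 0 : ℤ) : ZMod N) • σ (reduce n p N A) v := rfl

/-- The terms of a Hecke operator do not depend on the choice of coset representatives. -/
theorem coeff_mul_gamma {f : (Fin (i + 1) → GL (Fin n) ℚ) → V} (hf : IsHomogCocycle ε σ i f)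
    (A : heckeMonoid n p N) (γ : Gamma0 n N) (x : Fin (i + 1) → GL (Fin n) ℚ) :
    coeff ε σ (A * gammaIncl n p N γ)
        (f fun j => (toGLQ n p N (A * gammaIncl n p N γ))⁻¹ * x j) =
      coeff ε σ A (f fun j => (toGLQ n p N A)⁻¹ * x j) := by
  have h1 : (fun j => (toGLQ n p N A)⁻¹ * x j) = fun j => toGLQ n p N (gammaIncl n p N γ) *
      ((toGLQ n p N (A * gammaIncl n p N γ))⁻¹ * x j) := by
    refine funext fun j => ?_
    rw [map_mul]
    group
  rw [h1, hf.equivariant, map_mul, Module.End.mul_apply]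

/-- The double coset of a central element is a single coset. -/
theorem heckeOp_central {f : (Fin (i + 1) → GL (Fin n) ℚ) → V} (hf : IsHomogCocycle ε σ i f)
    (S : heckeMonoid n p N) (hS : ∀ A : heckeMonoid n p N, A * S = S * A)
    (x : Fin (i + 1) → GL (Fin n) ℚ) :
    heckeOp ε σ i S.val f x = coeff ε σ S (f fun j => (toGLQ n p N S)⁻¹ * x j) := by
  have hex : ∀ A : DoubleCoset n p N S.val, ∃ γ, A.val = S * gammaIncl n p N γ := by
    rintro ⟨A, γ, δ, h⟩
    refine ⟨γ * δ, ?_⟩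
    have h1 : A = gammaIncl n p N γ * S * gammaIncl n p N δ := Subtype.ext h
    refine h1.trans ?_
    rw [hS, mul_assoc, ← map_mul]
  let S₀ : DoubleCoset n p N S.val := ⟨S, 1, 1, by simp⟩
  have hq : ∀ q : Quotient (cosetSetoid n p N S.val), q = Quotient.mk _ S₀ := by
    intro q
    induction q using Quotient.inductionOn with
    | h A => exact (Quotient.sound (hex A)).symm
  unfold heckeOp
  rw [finsum_eq_single _ (Quotient.mk (cosetSetoid n p N S.val) S₀) fun q h => absurd (hq q) h]
  obtain ⟨γ, hγ⟩ := hex (Quotient.mk (cosetSetoid n p N S.val) S₀).out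
  rw [hγ, coeff_mul_gamma hf]

theorem heckeOp_matD_zero {f : (Fin (i + 1) → GL (Fin n) ℚ) → V} (hf : IsHomogCocycle ε σ i f)
    (ℓ : ℕ) : heckeOp ε σ i (matD n ℓ 0) f = f := by
  refine funext fun x => ?_
  have h1 : matD n ℓ 0 = (1 : heckeMonoid n p N).val := matD_zero n ℓ
  rw [h1, heckeOp_central hf 1 fun A => by rw [one_mul, mul_one]]
  simp

/-- The eigenvalue of `T(ℓ, n)` is given by the central character of the coefficients. -/
theorem IsEigenclass.central (hF : IsModuleF b σ) {α : coh ε σ i} {a : ℕ → ℕ → Fpbar p}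
    (hα : IsEigenclass ε σ i α a) {ℓ : ℕ} (hℓ : ℓ.Prime) (hℓN : ¬ ℓ ∣ p * N) :
    a ℓ n = ε (ℓ : ZMod N) * ∏ j, (ℓ : Fpbar p) ^ b j := by
  obtain ⟨f, hf, h1, h2⟩ := hα.eigen ℓ n hℓ hℓN le_rfl
  let S : heckeMonoid n p N :=
    ⟨matD n ℓ n, matD_mem_heckeMonoid hℓ.pos ((Nat.Prime.coprime_iff_not_dvd hℓ).2 hℓN) le_rfl⟩
  have hS : ∀ A : heckeMonoid n p N, A * S = S * A := fun A => Subtype.ext (by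
    change A.val * matD n ℓ n = matD n ℓ n * A.val
    rw [matD_self]
    exact (Matrix.scalar_commute _ (Commute.all _) A.val).symm)
  have hop : heckeOp ε σ i (matD n ℓ n) f = (ε (ℓ : ZMod N) * ∏ j, (ℓ : Fpbar p) ^ b j) •
      fun x => f fun j => (toGLQ n p N S)⁻¹ * x j := by
    refine funext fun x => (heckeOp_central hf S hS x).trans ?_
    have hred : (reduce n p N S).val = Matrix.scalar (Fin n) (ℓ : ZMod p) := by
      change (matD n ℓ n).map (Int.cast : ℤ → ZMod p) = _
      rw [matD_self, Matrix.scalar_apply, Matrix.scalar_apply, Matrix.diagonal_map Int.cast_zero]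
      simp
    have hS0 : S.val 0 0 = (ℓ : ℤ) := by
      change matD n ℓ n 0 0 = _
      rw [matD_self, Matrix.scalar_apply, Matrix.diagonal_apply_eq]
    rw [coeff_apply, hF.scalar hred, hS0, smul_smul, map_natCast, Int.cast_natCast]
    rfl
  -- Translation by a scalar does not change the class, so T(ℓ,n) acts through the coefficients
  -- alone.
  have h3 := (h1.translate hf (fun x => (toGLQ n p N S)⁻¹ * x) fun γ x => by
    rw [← mul_assoc, ← mul_assoc]
    congr 1
    rw [inv_mul_eq_iff_eq_mul, ← mul_assoc, eq_mul_inv_iff_mul_eq, ← map_mul, ← map_mul, hS]).smul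
      (ε (ℓ : ZMod N) * ∏ j, (ℓ : Fpbar p) ^ b j)
  rw [hop] at h2
  exact smul_left_injective _ hα.ne_zero (h2.unique h3)

/-- The conjugation by D in `levelDual` is absorbed by composing the duality with σ(D)⁻¹. -/
theorem IsModuleF.exists_level_dual [FiniteDimensional (Fpbar p) V] (hF : IsModuleF b σ)
    (u : (ZMod p)ˣ) : ∃ e : V ≃ₗ[Fpbar p] Module.Dual (Fpbar p) V,
      ∀ g v, e (σ (levelDual n u g) v) = σ.dual g (e v) := by
  obtain ⟨e, he⟩ := hF.exists_dual_equiv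
  let τ : V ≃ₗ[Fpbar p] V := LinearEquiv.ofLinearMap (σ (levelGL n u)⁻¹) (σ (levelGL n u))
    (by rw [← Module.End.mul_eq_comp, ← map_mul, inv_mul_cancel, map_one]; rfl)
    (by rw [← Module.End.mul_eq_comp, ← map_mul, mul_inv_cancel, map_one]; rfl)
  refine ⟨τ.trans e, fun g v => ?_⟩
  change e (σ (levelGL n u)⁻¹ (σ (levelDual n u g) v)) = σ.dual g (e (σ (levelGL n u)⁻¹ v))
  rw [← he, ← Module.End.mul_apply, ← Module.End.mul_apply, ← map_mul, ← map_mul, levelDual_apply,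
    ← mul_assoc, inv_mul_cancel_left]

/-- Compatibility of a duality with the action of the Hecke semigroup. -/
theorem coeff_levelDual [NeZero N] (hF : IsModuleF b σ) {u : (ZMod p)ˣ} (hu : (u : ZMod p) = N)
    {e : V ≃ₗ[Fpbar p] Module.Dual (Fpbar p) V}
    (he : ∀ g v, e (σ (levelDual n u g) v) = σ.dual g (e v)) {z : ℕ} (hz : z.Coprime (p * N))
    {A B : heckeMonoid n p N} (hAB : IsLevelDualPair N z A.val B.val) (v : V) :
    e (coeff ε σ B v) = (ε (z : ZMod N) * (∏ j, (z : Fpbar p) ^ b j) *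
      ((A.val.det : ℤ) : Fpbar p) ^ (n - 1)) • coeff ε⁻¹ (dualWeight σ) A (e v) := by
  have hzp : (z : ZMod p) ≠ 0 := by
    rw [Ne, ZMod.natCast_eq_zero_iff]
    intro h
    have h1 : p ∣ 1 := (hz.coprime_dvd_right (dvd_mul_right p N)) ▸ Nat.dvd_gcd h dvd_rfl
    exact (Fact.out : p.Prime).one_lt.ne' (Nat.dvd_one.1 h1)
  -- Modulo p the matrix B is z times the dual of A: z contributes the central character, and the
  -- dual of A becomes the dual action.
  have hB : reduce n p N B = scalarGL n (Units.mk0 (z : ZMod p) hzp) *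
      levelDual n u (reduce n p N A) :=
    hAB.map (R := ZMod p) hu (by simp) rfl rfl
  have hε : ε (A.val 0 0 : ZMod N) * ε (B.val 0 0 : ZMod N) = ε (z : ZMod N) := by
    rw [← map_mul, hAB.entry A.prop.1 B.prop.1, Int.cast_natCast]
  have hε0 : ε (A.val 0 0 : ZMod N) ≠ 0 := by
    intro h0
    have h1 : IsUnit (z : ZMod N) := (ZMod.isUnit_iff_coprime z N).2
      (hz.coprime_dvd_right (dvd_mul_left N p))
    rw [h0, zero_mul] at hε
    exact (h1.map ε).ne_zero hε.symm
  -- The twist in `dualWeight`; its inverse is the power of det A in the conclusion.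
  have hdet : ((detChar p n ^ (-((n : ℤ) - 1))) (reduce n p N A) : Fpbar p) =
      (((A.val.det : ℤ) : Fpbar p) ^ (n - 1))⁻¹ := by
    have h1 : ((detChar p n (reduce n p N A) : (Fpbar p)ˣ) : Fpbar p) =
        ((A.val.det : ℤ) : Fpbar p) := by
      change algebraMap (ZMod p) (Fpbar p) ((A.val.map (Int.castRingHom (ZMod p))).det) = _
      rw [← RingHom.mapMatrix_apply, ← RingHom.map_det, eq_intCast, map_intCast]
    have h2 : (n : ℤ) - 1 = ((n - 1 : ℕ) : ℤ) := by
      have := NeZero.pos n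
      omega
    rw [MonoidHom.zpow_apply, h2, zpow_neg, zpow_natCast, Units.val_inv_eq_inv_val,
      Units.val_pow_eq_pow_val, h1]
  have hdet0 : ((A.val.det : ℤ) : Fpbar p) ^ (n - 1) ≠ 0 := by
    intro h0
    rw [h0, inv_zero] at hdet
    exact Units.ne_zero _ hdet
  have hdual : coeff ε⁻¹ (dualWeight σ) A (e v) = ε⁻¹ (A.val 0 0 : ZMod N) •
      ((detChar p n ^ (-((n : ℤ) - 1))) (reduce n p N A) : Fpbar p) •
        σ.dual (reduce n p N A) (e v) := rfl
  rw [hdual, hdet, coeff_apply, hB, map_mul, Module.End.mul_apply,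
    hF.scalar (scalarGL_val _), map_smul, map_smul, he, MulChar.inv_apply_eq_inv', smul_smul,
    smul_smul, smul_smul, Units.val_mk0, map_natCast, ← hε]
  congr 1
  field_simp

/-- The scalar matrix `1` or `ℓ⁻¹`, according to whether `det x = 1` or not. -/
def detNormalizer (n : ℕ) {ℓ : ℕ} (hℓ : ℓ ≠ 0) (x : GL (Fin n) ℚ) : GL (Fin n) ℚ :=
  if x.val.det = 1 then 1 else (scalarGL n (Units.mk0 (ℓ : ℚ) (Nat.cast_ne_zero.2 hℓ)))⁻¹

theorem detNormalizer_mul_comm {n ℓ : ℕ} (hℓ : ℓ ≠ 0) (x y : GL (Fin n) ℚ) :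
    detNormalizer n hℓ x * y = y * detNormalizer n hℓ x := by
  unfold detNormalizer
  split_ifs
  · rw [one_mul, mul_one]
  · rw [inv_mul_eq_iff_eq_mul, ← mul_assoc, eq_mul_inv_iff_mul_eq, scalarGL_mul_comm]

theorem det_toGLQ {p : ℕ} (A : heckeMonoid n p N) : (toGLQ n p N A).val.det = (A.val.det : ℚ) :=
  ((Int.castRingHom ℚ).map_det A.val).symm

theorem det_gammaIncl {p : ℕ} (γ : Gamma0 n N) : (gammaIncl n p N γ).val.det = 1 := γ.val.prop

/-- The automorphism `x ↦ D ᵗx⁻¹ D⁻¹` of `GL_n(ℚ)`, with `D = diag(N, 1, …, 1)`. -/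
abbrev ratDual (n : ℕ) [NeZero n] (N : ℕ) [NeZero N] : GL (Fin n) ℚ →* GL (Fin n) ℚ :=
  levelDual n (Units.mk0 (N : ℚ) (Nat.cast_ne_zero.2 (NeZero.ne N)))

theorem toGLQ_gammaDual {p : ℕ} [NeZero N] (γ : Gamma0 n N) :
    toGLQ n p N (gammaIncl n p N (gammaDual n N γ)) =
      ratDual n N (toGLQ n p N (gammaIncl n p N γ)) := by
  have h := (isLevelDualPair_gammaDual γ).map (R := ℚ) (u := Units.mk0 (N : ℚ)
    (Nat.cast_ne_zero.2 (NeZero.ne N))) (v := 1) rfl (by simp)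
    (a := toGLQ n p N (gammaIncl n p N γ)) (b := toGLQ n p N (gammaIncl n p N (gammaDual n N γ)))
    rfl rfl
  rw [h]
  have h1 : scalarGL n (1 : ℚˣ) = 1 := map_one _
  rw [h1, one_mul]

theorem detNormalizer_gamma {p ℓ : ℕ} (hℓ : ℓ ≠ 0) (γ : Gamma0 n N) (x : GL (Fin n) ℚ) :
    detNormalizer n hℓ (toGLQ n p N (gammaIncl n p N γ) * x) = detNormalizer n hℓ x := by
  unfold detNormalizer
  rw [Units.val_mul, Matrix.det_mul, det_toGLQ, det_gammaIncl, Int.cast_one, one_mul]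

/-- The dual of a homogeneous cochain `f`: on matrices of determinant `1`, it is `f` composed with
`x ↦ D ᵗx⁻¹ D⁻¹` and a duality `e`; the normalization makes the coset representatives of
`T(ℓ, k)` correspond to those of `T(ℓ, n - k)`. -/
def dualCochain [NeZero N] (e : V ≃ₗ[Fpbar p] Module.Dual (Fpbar p) V) {ℓ : ℕ} (hℓ : ℓ ≠ 0)
    (f : (Fin (i + 1) → GL (Fin n) ℚ) → V) (x : Fin (i + 1) → GL (Fin n) ℚ) :
    Module.Dual (Fpbar p) V :=
  e (f fun j => detNormalizer n hℓ (x j) * ratDual n N (x j))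

theorem coeff_gammaDual [NeZero N] (hF : IsModuleF b σ) {u : (ZMod p)ˣ} (hu : (u : ZMod p) = N)
    {e : V ≃ₗ[Fpbar p] Module.Dual (Fpbar p) V}
    (he : ∀ g v, e (σ (levelDual n u g) v) = σ.dual g (e v)) (γ : Gamma0 n N) (v : V) :
    e (coeff ε σ (gammaIncl n p N (gammaDual n N γ)) v) =
      coeff ε⁻¹ (dualWeight σ) (gammaIncl n p N γ) (e v) := by
  have h : IsLevelDualPair N ((1 : ℕ) : ℤ) (gammaIncl n p N γ).val
      (gammaIncl n p N (gammaDual n N γ)).val := by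
    rw [Nat.cast_one]
    exact isLevelDualPair_gammaDual γ
  rw [coeff_levelDual hF hu he (Nat.coprime_one_left _) h, det_gammaIncl]
  simp

/-- The normalizing scalar depends only on the determinant, which Γ_0(N) preserves, so equivariance
survives; the cocycle relation holds under any substitution made in each variable separately. -/
theorem IsHomogCocycle.dualCochain [NeZero N] (hF : IsModuleF b σ) {u : (ZMod p)ˣ}
    (hu : (u : ZMod p) = N) {e : V ≃ₗ[Fpbar p] Module.Dual (Fpbar p) V}
    (he : ∀ g v, e (σ (levelDual n u g) v) = σ.dual g (e v))
    {f : (Fin (i + 1) → GL (Fin n) ℚ) → V} (hf : IsHomogCocycle ε σ i f) {ℓ : ℕ} (hℓ : ℓ ≠ 0) :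
    IsHomogCocycle ε⁻¹ (dualWeight σ) i (dualCochain (N := N) e hℓ f) where
  equivariant γ x := by
    unfold GaloisHecke.dualCochain
    rw [← coeff_gammaDual hF hu he, ← hf.equivariant]
    congr 2
    refine funext fun j => ?_
    rw [detNormalizer_gamma, map_mul, ← mul_assoc, ← mul_assoc, detNormalizer_mul_comm,
      toGLQ_gammaDual]
  cocycle x := by
    have h1 := congrArg e (hf.cocycle fun j => detNormalizer n hℓ (x j) * ratDual n N (x j))
    rw [map_sum, map_zero] at h1
    simp only [map_smul] at h1
    exact h1

/-- On Γ_0(N) the normalizer is 1, so the dual cochains attached to different ℓ represent one and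
the same class. -/
theorem dualCochain_gamma [NeZero N] (e : V ≃ₗ[Fpbar p] Module.Dual (Fpbar p) V) {ℓ : ℕ}
    (hℓ : ℓ ≠ 0) (f : (Fin (i + 1) → GL (Fin n) ℚ) → V) (γ : Fin (i + 1) → Gamma0 n N) :
    dualCochain (N := N) e hℓ f (fun j => toGLQ n p N (gammaIncl n p N (γ j))) =
      e (f fun j => toGLQ n p N (gammaIncl n p N (gammaDual n N (γ j)))) := by
  unfold dualCochain
  congr 2
  refine funext fun j => ?_
  rw [toGLQ_gammaDual, detNormalizer, det_toGLQ, det_gammaIncl, Int.cast_one, if_pos rfl, one_mul]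

/-- Up to a scalar, duality exchanges `T(ℓ, k)` and `T(ℓ, n - k)`. -/
theorem heckeOp_dualCochain [NeZero N] (hF : IsModuleF b σ) {u : (ZMod p)ˣ}
    (hu : (u : ZMod p) = N) {e : V ≃ₗ[Fpbar p] Module.Dual (Fpbar p) V}
    (he : ∀ g v, e (σ (levelDual n u g) v) = σ.dual g (e v))
    {f : (Fin (i + 1) → GL (Fin n) ℚ) → V} (hf : IsHomogCocycle ε σ i f) {ℓ k : ℕ}
    (hℓ : ℓ.Prime) (hℓN : ℓ.Coprime (p * N)) (hk0 : k ≠ 0) (hk : k ≤ n)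
    (γ : Fin (i + 1) → Gamma0 n N) :
    (ε (ℓ : ZMod N) * (∏ j, (ℓ : Fpbar p) ^ b j) * ((ℓ : Fpbar p) ^ k) ^ (n - 1)) •
      heckeOp ε⁻¹ (dualWeight σ) i (matD n ℓ k) (dualCochain (N := N) e hℓ.ne_zero f)
        (fun j => toGLQ n p N (gammaIncl n p N (γ j))) =
      e (heckeOp ε σ i (matD n ℓ (n - k)) f
        fun j => toGLQ n p N (gammaIncl n p N (gammaDual n N (γ j)))) := by
  have hex := exists_dualPair_matD (n := n) (N := N) hℓ.pos hℓN (Nat.add_sub_of_le hk)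
  choose F hFdual using hex
  have hdet0 : ∀ A : heckeMonoid n p N, A.val.det ≠ 0 := fun A => A.prop.2.1.ne'
  -- Dual pairs match the cosets of T(ℓ,k) with those of T(ℓ,n-k); both injectivity and surjectivity
  -- come from symmetry and uniqueness of dual pairs.
  let Φ : Quotient (cosetSetoid n p N (matD n ℓ k)) →
      Quotient (cosetSetoid n p N (matD n ℓ (n - k))) :=
    fun q => Quotient.mk _ (F q.out)
  have hΦ : Function.Bijective Φ := by
    constructor
    · intro q q' hqq
      obtain ⟨δ, hδ⟩ := Quotient.exact hqq
      rw [← q.out_eq, ← q'.out_eq]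
      refine Quotient.sound ⟨gammaDual n N δ, Subtype.ext ?_⟩
      have h1 := (hFdual q.out).symm.mul (isLevelDualPair_gammaDual δ)
      rw [mul_one] at h1
      have h2 := (hFdual q'.out).symm
      rw [hδ] at h2
      exact h2.unique (hdet0 _) h1
    · intro q'
      obtain ⟨A, hA⟩ := exists_dualPair_matD (n := n) (N := N) hℓ.pos hℓN
        (Nat.sub_add_cancel hk) q'.out
      refine ⟨Quotient.mk _ A, ?_⟩
      obtain ⟨δ, hδ⟩ := Quotient.exact
        (Quotient.out_eq (Quotient.mk (cosetSetoid n p N (matD n ℓ k)) A)).symm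
      rw [← q'.out_eq]
      refine Quotient.sound ((cosetSetoid n p N _).symm ⟨gammaDual n N δ, Subtype.ext ?_⟩)
      have h1 := hA.symm.mul (isLevelDualPair_gammaDual δ)
      rw [mul_one] at h1
      have h2 := hFdual (Quotient.mk (cosetSetoid n p N (matD n ℓ k)) A).out
      rw [hδ] at h2
      exact h2.unique (hdet0 _) h1
  unfold heckeOp
  rw [smul_finsum, AddEquivClass.map_finsum e]
  refine finsum_eq_of_bijective Φ hΦ fun q => ?_
  obtain ⟨δ, hδ⟩ : ∃ δ : Gamma0 n N, (Φ q).out.val = (F q.out).val * gammaIncl n p N δ :=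
    Quotient.exact (Quotient.out_eq (Φ q)).symm
  rw [hδ, coeff_mul_gamma hf, coeff_levelDual hF hu he hℓN (hFdual q.out)]
  have hdet : q.out.val.val.det = (ℓ : ℤ) ^ k := by
    obtain ⟨η, ζ, h⟩ := q.out.prop
    rw [h, Matrix.det_mul, Matrix.det_mul, det_gammaIncl, det_gammaIncl, det_matD n ℓ hk,
      one_mul, mul_one]
  rw [hdet]
  push_cast
  congr 2
  unfold dualCochain
  congr 2
  refine funext fun j => ?_
  have hB := (hFdual q.out).map (R := ℚ) (u := Units.mk0 (N : ℚ) (Nat.cast_ne_zero.2 (NeZero.ne N)))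
    (v := Units.mk0 (ℓ : ℚ) (Nat.cast_ne_zero.2 hℓ.ne_zero)) rfl (by simp)
    (a := toGLQ n p N q.out.val) (b := toGLQ n p N (F q.out).val) rfl rfl
  -- The inverse of the dual representative contains the scalar ℓ⁻¹, exactly what the normalizer
  -- supplies.
  rw [hB, toGLQ_gammaDual, detNormalizer, if_neg, map_mul, map_inv, mul_inv_rev, ← mul_assoc]
  · congr 1
    rw [inv_mul_eq_iff_eq_mul, ← mul_assoc, eq_mul_inv_iff_mul_eq, scalarGL_mul_comm]
  -- The argument has determinant ℓ^(-k), which differs from 1 because k ≠ 0.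
  · rw [Units.val_mul, Matrix.det_mul, det_toGLQ, det_gammaIncl, Int.cast_one, mul_one]
    intro h1
    have h2 : (toGLQ n p N q.out.val).val.det = 1 := by
      have h3 : ((toGLQ n p N q.out.val)⁻¹ * toGLQ n p N q.out.val).val.det = 1 := by
        rw [inv_mul_cancel, Units.val_one, Matrix.det_one]
      rwa [Units.val_mul, Matrix.det_mul, h1, one_mul] at h3
    rw [det_toGLQ, hdet] at h2
    push_cast at h2
    have h4 : ℓ ^ k = 1 := by exact_mod_cast h2
    exact hℓ.one_lt.ne' ((Nat.pow_eq_one.1 h4).resolve_right hk0)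

end HeckeDual

end GaloisHecke

namespace GaloisHecke

/-! ### The dual eigenclass -/

section DualEigenclass

variable {n : ℕ} [NeZero n] {p : ℕ} [Fact p.Prime] {N : ℕ} {V : Type} [AddCommGroup V]
  [Module (Fpbar p) V] {ε : DirichletCharacter (Fpbar p) N}
  {σ : Representation (Fpbar p) (GL (Fin n) (ZMod p)) V} {i : ℕ} {b : Fin n → ℤ}

theorem natCast_ne_zero_of_coprime {ℓ : ℕ} (h : ℓ.Coprime (p * N)) : (ℓ : Fpbar p) ≠ 0 := by
  intro h0
  rw [CharP.cast_eq_zero_iff (Fpbar p) p] at h0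
  have h1 : p ∣ 1 := (h.coprime_dvd_right (dvd_mul_right p N)) ▸ Nat.dvd_gcd h0 dvd_rfl
  exact (Fact.out : p.Prime).one_lt.ne' (Nat.dvd_one.1 h1)

/-- The class is the image of α under the isomorphism induced by `gammaDual` and the duality of
coefficients. The constant in `heckeOp_dualCochain` is a(ℓ,n) ℓ^(k(n-1)) by `IsEigenclass.central`.
-/
theorem IsEigenclass.exists_dual [NeZero N] [FiniteDimensional (Fpbar p) V] (hpN : ¬ p ∣ N)
    (hF : IsModuleF b σ) {α : coh ε σ i} {a : ℕ → ℕ → Fpbar p} (hα : IsEigenclass ε σ i α a) :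
    ∃ β : coh ε⁻¹ (dualWeight σ) i, IsEigenclass ε⁻¹ (dualWeight σ) i β fun ℓ k =>
      (a ℓ n * ((ℓ : Fpbar p) ^ k) ^ (n - 1))⁻¹ * a ℓ (n - k) := by
  have hN : (N : ZMod p) ≠ 0 := by rwa [Ne, ZMod.natCast_eq_zero_iff]
  obtain ⟨e, he⟩ := hF.exists_level_dual (Units.mk0 (N : ZMod p) hN)
  have hcoeff := coeff_gammaDual (ε := ε) hF (u := Units.mk0 (N : ZMod p) hN) rfl he
  let I := groupCohomology.mapIso (A := coeffRep ε⁻¹ (dualWeight σ)) (B := coeffRep ε σ)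
    (gammaDual n N) e (fun γ => LinearMap.ext fun v => by
      change e (coeff ε σ (gammaIncl n p N γ) v) =
        coeff ε⁻¹ (dualWeight σ) (gammaIncl n p N (gammaDual n N γ)) (e v)
      rw [← hcoeff]
      have h1 : gammaDual n N (gammaDual n N γ) = γ := (gammaDual n N).left_inv γ
      rw [h1]) i
  have hrep : ∀ {f : (Fin (i + 1) → GL (Fin n) ℚ) → V} {α' : coh ε σ i}
      {f' : (Fin (i + 1) → GL (Fin n) ℚ) → Module.Dual (Fpbar p) V}, Represents ε σ i f α' →
      (∀ γ : Fin (i + 1) → Gamma0 n N, f' (fun j => toGLQ n p N (gammaIncl n p N (γ j))) =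
        e (f fun j => toGLQ n p N (gammaIncl n p N (gammaDual n N (γ j))))) →
      Represents ε⁻¹ (dualWeight σ) i f' (I.hom α') := by
    intro f α' f' h hff
    refine h.map _ _ fun γ => ?_
    refine (hff _).trans ?_
    change e (f _) = e (f _)
    congr 2
    refine funext fun j => ?_
    congr 2
    induction j using Fin.induction with
    | zero => rw [Fin.partialProd_zero, Fin.partialProd_zero, map_one]
    | succ j ih =>
      rw [Fin.partialProd_succ, Fin.partialProd_succ, map_mul, ih]
      rfl
  have hI : Function.Injective I.hom := (ModuleCat.mono_iff_injective I.hom).1 inferInstance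
  refine ⟨I.hom α, fun h0 => hα.ne_zero (hI (h0.trans (map_zero I.hom.hom).symm)), ?_⟩
  intro ℓ k hℓ hℓN hk
  have hcop : ℓ.Coprime (p * N) := (Nat.Prime.coprime_iff_not_dvd hℓ).2 hℓN
  have hℓ0 : (ℓ : Fpbar p) ≠ 0 := natCast_ne_zero_of_coprime hcop
  have hcen := hα.central hF hℓ hℓN
  have hε : ε (ℓ : ZMod N) ≠ 0 := (((ZMod.isUnit_iff_coprime ℓ N).2
    (hcop.coprime_dvd_right (dvd_mul_left N p))).map ε).ne_zero
  have hcen0 : a ℓ n ≠ 0 := by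
    rw [hcen]
    exact mul_ne_zero hε (Finset.prod_ne_zero_iff.2 fun j _ => zpow_ne_zero _ hℓ0)
  obtain ⟨f, hf, h1, h2⟩ := hα.eigen ℓ (n - k) hℓ hℓN (Nat.sub_le n k)
  have hf' := hf.dualCochain hF (u := Units.mk0 (N : ZMod p) hN) rfl he hℓ.ne_zero
  have h1' := hrep h1 (dualCochain_gamma e hℓ.ne_zero f)
  refine ⟨_, hf', h1', ?_⟩
  -- For k = 0 the determinants cannot detect the normalizing scalar; but T(ℓ,0) is the identity and
  -- the claimed eigenvalue is 1.
  rcases Nat.eq_zero_or_pos k with rfl | hk0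
  · dsimp only
    rw [heckeOp_matD_zero hf', pow_zero, one_pow, mul_one, Nat.sub_zero, inv_mul_cancel₀ hcen0,
      one_smul]
    exact h1'
  · have hC : a ℓ n * ((ℓ : Fpbar p) ^ k) ^ (n - 1) ≠ 0 :=
      mul_ne_zero hcen0 (pow_ne_zero _ (pow_ne_zero _ hℓ0))
    have h3 := (hrep (f' := (a ℓ n * ((ℓ : Fpbar p) ^ k) ^ (n - 1)) •
      heckeOp ε⁻¹ (dualWeight σ) i (matD n ℓ k) (dualCochain (N := N) e hℓ.ne_zero f)) h2
      fun γ => by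
        rw [hcen]
        exact heckeOp_dualCochain hF rfl he hf hℓ hcop hk0.ne' hk γ).smul
          (a ℓ n * ((ℓ : Fpbar p) ^ k) ^ (n - 1))⁻¹
    rw [smul_smul, inv_mul_cancel₀ hC, one_smul] at h3
    have h4 : I.hom (a ℓ (n - k) • α) = a ℓ (n - k) • I.hom α := map_smul I.hom.hom _ _
    rw [h4, smul_smul] at h3
    exact h3

end DualEigenclass

/-! ### Characteristic polynomials -/

section Charpoly

variable {n : ℕ} {K : Type*} [Field K]

theorem coeff_charpolyRev_of_le (M : Matrix (Fin n) (Fin n) K) {k : ℕ} (hk : k ≤ n) :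
    M.charpolyRev.coeff k = M.charpoly.coeff (n - k) := by
  rw [← Matrix.reverse_charpoly, Polynomial.coeff_reverse, Matrix.charpoly_natDegree_eq_dim,
    Fintype.card_fin, Polynomial.revAt_le hk]

theorem coeff_charpolyRev_of_lt (M : Matrix (Fin n) (Fin n) K) {k : ℕ} (hk : n < k) :
    M.charpolyRev.coeff k = 0 := by
  rw [← Matrix.reverse_charpoly, Polynomial.coeff_reverse, Matrix.charpoly_natDegree_eq_dim,
    Fintype.card_fin, Polynomial.revAt_eq_self_of_lt hk]
  refine Polynomial.coeff_eq_zero_of_natDegree_lt ?_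
  rwa [Matrix.charpoly_natDegree_eq_dim, Fintype.card_fin]

/-- From det(1 - A⁻¹X) = (-1)^n det(A)⁻¹ det(X - A), which reverses the order of the coefficients.
-/
theorem coeff_charpolyRev_transposeInv (A : GL (Fin n) K) {k : ℕ} (hk : k ≤ n) :
    (transposeInv K A).val.charpolyRev.coeff k =
      (-1) ^ n * A.val.det⁻¹ * A.val.charpolyRev.coeff (n - k) := by
  rw [coeff_charpolyRev_of_le _ hk, transposeInv_val, Matrix.charpoly_transpose,
    Matrix.coe_units_inv, Matrix.charpoly_inv _ A.isUnit, Fintype.card_fin, Ring.inverse_eq_inv]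
  have h1 : ((-1) ^ n * Polynomial.C A.val.det⁻¹ : K[X]) =
      Polynomial.C ((-1) ^ n * A.val.det⁻¹) := by
    simp
  rw [h1, Polynomial.coeff_C_mul]

theorem coeff_sum_C_mul_X_pow (c : ℕ → K) (n k : ℕ) :
    (∑ j ∈ Finset.range (n + 1), Polynomial.C (c j) * Polynomial.X ^ j).coeff k =
      if k ≤ n then c k else 0 := by
  rw [Polynomial.finsetSum_coeff]
  simp only [Polynomial.coeff_C_mul_X_pow]
  rw [Finset.sum_ite_eq]
  simp only [Finset.mem_range, Nat.lt_succ_iff]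

/-- With n = k + m, this balances the powers of ℓ in the two Hecke polynomials. -/
theorem half_mul_pred_add (k m : ℕ) :
    k * (k - 1) / 2 + (k + m) * (k + m - 1) / 2 = m * (m - 1) / 2 + k * (k + m - 1) := by
  have h : ∀ j : ℕ, j * (j - 1) / 2 * 2 = j * (j - 1) := fun j =>
    Nat.div_mul_cancel (Nat.even_mul_pred_self j).two_dvd
  have h1 := h k
  have h2 := h m
  have h3 := h (k + m)
  have h4 : k * (k - 1) + (k + m) * (k + m - 1) = m * (m - 1) + 2 * (k * (k + m - 1)) := by
    rcases k with - | k
    · simp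
    rcases m with - | m
    · simp
      ring
    simp only [Nat.add_sub_cancel, show k + 1 + (m + 1) - 1 = k + m + 1 by omega]
    ring
  omega

/-- The top coefficient gives det A = ℓ^(n(n-1)/2) a_n, so a_n ≠ 0. Comparing coefficients then
reduces to `half_mul_pred_add` and the sign (-1)^n (-1)^(n-k) = (-1)^k. -/
theorem charpolyRev_transposeInv {A : GL (Fin n) K} {ℓ : K} (hℓ : ℓ ≠ 0) {a : ℕ → K}
    (h : A.val.charpolyRev = ∑ k ∈ Finset.range (n + 1),
      Polynomial.C ((-1) ^ k * ℓ ^ (k * (k - 1) / 2) * a k) * Polynomial.X ^ k) :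
    (transposeInv K A).val.charpolyRev = ∑ k ∈ Finset.range (n + 1),
      Polynomial.C ((-1) ^ k * ℓ ^ (k * (k - 1) / 2) *
        ((a n * (ℓ ^ k) ^ (n - 1))⁻¹ * a (n - k))) * Polynomial.X ^ k := by
  have hc : ∀ k ≤ n, A.val.charpolyRev.coeff k = (-1) ^ k * ℓ ^ (k * (k - 1) / 2) * a k := by
    intro k hk
    rw [h, coeff_sum_C_mul_X_pow fun k => (-1) ^ k * ℓ ^ (k * (k - 1) / 2) * a k, if_pos hk]
  have hdet : A.val.det = ℓ ^ (n * (n - 1) / 2) * a n := by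
    have h1 := hc n le_rfl
    rw [coeff_charpolyRev_of_le _ le_rfl, Nat.sub_self] at h1
    rw [Matrix.det_eq_sign_charpoly_coeff, h1, Fintype.card_fin, ← mul_assoc, ← mul_assoc,
      ← pow_add, Even.neg_one_pow ⟨n, rfl⟩, one_mul]
  have han : a n ≠ 0 := by
    intro h0
    rw [h0, mul_zero] at hdet
    exact A.det.ne_zero hdet
  ext k
  rw [coeff_sum_C_mul_X_pow fun k => (-1) ^ k * ℓ ^ (k * (k - 1) / 2) *
    ((a n * (ℓ ^ k) ^ (n - 1))⁻¹ * a (n - k))]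
  split_ifs with hk
  · obtain ⟨m, rfl⟩ := Nat.exists_eq_add_of_le hk
    rw [coeff_charpolyRev_transposeInv A hk, hc _ (Nat.sub_le _ _), hdet, Nat.add_sub_cancel_left]
    have h1 : ((-1 : K)) ^ (k + m) * (-1) ^ m = (-1) ^ k := by
      rw [pow_add, mul_assoc, ← pow_add, Even.neg_one_pow ⟨m, rfl⟩, mul_one]
    have h2 : ℓ ^ (k * (k - 1) / 2) * ℓ ^ ((k + m) * (k + m - 1) / 2) =
        ℓ ^ (m * (m - 1) / 2) * ℓ ^ (k * (k + m - 1)) := by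
      rw [← pow_add, ← pow_add, half_mul_pred_add]
    rw [← pow_mul, mul_inv, mul_inv]
    have h3 : ℓ ^ ((k + m) * (k + m - 1) / 2) ≠ 0 := pow_ne_zero _ hℓ
    have h4 : ℓ ^ (k * (k + m - 1)) ≠ 0 := pow_ne_zero _ hℓ
    have h5 : ℓ ^ (k * (k - 1) / 2) * (ℓ ^ (k * (k + m - 1)))⁻¹ =
        (ℓ ^ ((k + m) * (k + m - 1) / 2))⁻¹ * ℓ ^ (m * (m - 1) / 2) := by
      rw [← div_eq_mul_inv, div_eq_iff h4, mul_assoc, eq_inv_mul_iff_mul_eq₀ h3, ← h2, mul_comm]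
    calc _ = ((-1 : K) ^ (k + m) * (-1) ^ m) * ((ℓ ^ ((k + m) * (k + m - 1) / 2))⁻¹ *
          ℓ ^ (m * (m - 1) / 2)) * ((a (k + m))⁻¹ * a m) := by ring
      _ = _ := by
        rw [h1, ← h5]
        ring
  · exact coeff_charpolyRev_of_lt _ (not_le.1 hk)

end Charpoly

/-! ### Assembly of the theorem -/

section Main

variable {n : ℕ} [NeZero n] {p : ℕ} [Fact p.Prime] {N : ℕ} [NeZero N] {V : Type} [AddCommGroup V]
  [Module (Fpbar p) V] [FiniteDimensional (Fpbar p) V] {ε : DirichletCharacter (Fpbar p) N}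
  {σ : Representation (Fpbar p) (GL (Fin n) (ZMod p)) V} {i : ℕ}
  {ρ : GQ →* GL (Fin n) (Fpbar p)}

theorem IsAttached.exists_contragredient {b : Fin n → ℤ} (hpN : ¬ p ∣ N) (hF : IsModuleF b σ)
    {α : coh ε σ i} (hα : IsAttached ρ ε σ i α) : ∃ β : coh ε⁻¹ (dualWeight σ) i,
      IsAttached (contragredient ρ) ε⁻¹ (dualWeight σ) i β := by
  obtain ⟨a, ha, hρ⟩ := hα
  obtain ⟨β, hβ⟩ := ha.exists_dual hpN hF
  refine ⟨β, _, hβ, fun ℓ hℓ hℓN => ⟨(hρ ℓ hℓ hℓN).1.contragredient, fun 𝔩 h𝔩 g hg => ?_⟩⟩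
  exact charpolyRev_transposeInv (natCast_ne_zero_of_coprime (N := N)
    ((Nat.Prime.coprime_iff_not_dvd hℓ).2 hℓN)) ((hρ ℓ hℓ hℓN).2 𝔩 h𝔩 g hg)

theorem IsPredicted.contragredient {𝔓 : Ideal (𝓞 Qbar)} {c : GQ} (h : IsPredicted 𝔓 c ρ N ε σ) :
    IsPredicted 𝔓 c (contragredient ρ) N ε⁻¹ (dualWeight σ) where
  continuous := continuous_contragredient h.continuous
  semisimple := semisimple_contragredient h.semisimple
  level := h.level.contragredient h.continuous
  nebentype := h.nebentype.contragredient
  weight := by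
    obtain ⟨M, s, a, hs, ha, hσ⟩ := h.weight
    exact ⟨_, _, _, hs.contragredient, ha.contragredient hs.mem_levi, hσ.dualWeight⟩

end Main

end GaloisHecke

end

theorem theorem3p10 (p : ℕ) [Fact p.Prime] (n : ℕ) [NeZero n] (N : ℕ) [NeZero N]
    (𝔓 : Ideal (NumberField.RingOfIntegers GaloisHecke.Qbar)) (h𝔓 : GaloisHecke.IsAbove 𝔓 p)
    (c : GaloisHecke.GQ) (hc : GaloisHecke.IsComplexConj c)
    (ρ : GaloisHecke.GQ →* Matrix.GeneralLinearGroup (Fin n) (GaloisHecke.Fpbar p))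
    (ε : DirichletCharacter (GaloisHecke.Fpbar p) N)
    (V : Type) [AddCommGroup V] [Module (GaloisHecke.Fpbar p) V]
    [FiniteDimensional (GaloisHecke.Fpbar p) V]
    (σ : Representation (GaloisHecke.Fpbar p)
      (Matrix.GeneralLinearGroup (Fin n) (ZMod p)) V)
    (hpred : GaloisHecke.IsPredicted 𝔓 c ρ N ε σ)
    (i : ℕ) (α : GaloisHecke.coh ε σ i) (hα : GaloisHecke.IsAttached ρ ε σ i α) :
    (∃ β : GaloisHecke.coh ε⁻¹ (GaloisHecke.dualWeight σ) i,
      GaloisHecke.IsAttached (GaloisHecke.contragredient ρ) ε⁻¹ (GaloisHecke.dualWeight σ) i β) ∧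
    GaloisHecke.IsPredicted 𝔓 c (GaloisHecke.contragredient ρ) N ε⁻¹
      (GaloisHecke.dualWeight σ) ∧
    (∀ b : Fin n → ℤ, GaloisHecke.IsDerived 𝔓 ρ b →
      GaloisHecke.IsDerived 𝔓 (GaloisHecke.contragredient ρ) (fun j => -b j.rev)) := by
  obtain ⟨_, _, _, -, -, b, -, -, hF⟩ := hpred.weight
  exact ⟨hα.exists_contragredient hpred.level.not_dvd hF, hpred.contragredient,
    fun _ hb => hb.contragredient⟩
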